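/- Let $d=n+1\ge 2$, $m>0$, and write $x\cdot y=x^0y^0-\sum_{i=1}^{n}x^iy^i$ for the Lorentzian scalar product on $\mathbb{R}^d$. Put $\omega_{\mathbf p}=\sqrt{\mathbf p^2+m^2}$, $p=(\omega_{\mathbf p},\mathbf p)$, $d\mu(\mathbf p)=(2\omega_{\mathbf p})^{-1}d^n\mathbf p$, and let $\mathscr H_1=L^2(\mathbb{R}^n,d\mu)$, $\mathscr H=\bigoplus_{k\ge 0}\mathscr H_1^{\otimes_s k}$ the bosonic Fock space over $\mathscr H_1$ with vacuum $\Omega$ and creation and annihilation operators $a^*(g)$, $a(g)=a^*(g)^*$, and $\mathcal D\subset\mathscr H$ the subspace of vectors of finite particle number. For $f\in\mathscr S(\mathbb{R}^d)$ (complex valued) let $f^{\pm}(\mathbf p)=\int f(x)e^{\pm ip\cdot x}dx$ and let $\phi(f)=a(\overline{f^-})+a^*(f^+)$ be the free scalar field of mass $m$, on its natural domain (those $\Psi$ for which the components of $\phi(f)\Psi$ are square summable). Let $V$ be an arbitrary unitary operator on $\mathscr H_1$, $\Gamma(V)=\bigoplus_k V^{\otimes k}$ its second quantization, $P=(P_\mu)$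 the second-quantized momentum operator (multiplication by $p_1+\dots+p_k$ on $k$-particle vectors), $X_\mu=\Gamma(V^{-1})P_\mu\Gamma(V)$ and $V(y)=e^{iy\cdot X}=\Gamma(V^{-1})e^{iy\cdot P}\Gamma(V)$ for $y\in\mathbb{R}^d$. Let $\theta$ be a real $d\times d$ matrix that is skew-symmetric with respect to the Lorentzian scalar product, i.e. $(\theta x)\cdot y=-x\cdot(\theta y)$. The deformed field is defined by $$\phi_{\theta,X}(f)\Psi=(2\pi)^{-d}\lim_{\varepsilon\downarrow 0}\iint dx\,dy\,e^{-ix\cdot y}\,\chi(\varepsilon x,\varepsilon y)\,V(\theta x)\phi(f)V(-\theta x)V(y)\Psi ,$$ its domain being the set $\mathcal D^{\theta,X}$ of all $\Psi\in\mathscr H$ for which all vectors $V(-\theta x)V(y)\Psi$ lie in the domain of $\phi(f)$, the integrand is (Bochner) integrable for every $\varepsilon>0$ and every $\chi\in\mathscr S(\mathbb{R}^d\times\mathbb{R}^d)$, and the limit exists in norm, with the same value, for every $\chi\in\mathscr S(\mathbb{R}^d\times\mathbb{R}^d)$ with $\chi(0,0)=1$. Then: (a) $\mathcal D$ is dense in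 $\mathscr H$, and for every $f\in\mathscr S(\mathbb{R}^d)$ it is contained in the domain $\mathcal D^{\theta,X}$ of $\phi_{\theta,X}(f)$; moreover $\phi_{\theta,X}(f)\mathcal D\subset\mathcal D$ and $\phi_{\theta,X}(f)\Omega=\phi(f)\Omega$. (b) For every $\Psi\in\mathcal D$ the map $f\mapsto\phi_{\theta,X}(f)\Psi$ is a vector-valued tempered distribution, i.e. a continuous linear map $\mathscr S(\mathbb{R}^d)\to\mathscr H$. (c) For every $f\in\mathscr S(\mathbb{R}^d)$ and $\Psi\in\mathcal D$, $\Psi$ lies in the domain of the adjoint and $\phi_{\theta,X}(f)^*\Psi=\phi_{\theta,X}(\overline f)\Psi$. For real $f$, $\phi_{\theta,X}(f)$ is essentially self-adjoint on $\mathcal D$. (d) (Reeh–Schlieder property) For every non-empty open set $\mathcal O\subset\mathbb{R}^d$, the linear span of the vectors $\phi_{\theta,X}(f_1)\cdots\phi_{\theta,X}(f_k)\Omega$, with $k\in\{0,1,2,\dots\}$ and $f_1,\dots,f_k\in\mathscr S(\mathbb{R}^d)$ supported in $\mathcal O$, is dense in $\mathscr H$. -/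

import Mathlib

open MeasureTheory Filter Topology
open scoped SchwartzMap FourierTransform ENNReal InnerProductSpace

noncomputable section

namespace WarpedField

/-! ### Minkowski space and the mass shell -/

/-- Space-time `ℝ^d` with `d = n + 1`; coordinate `0` is time. -/
abbrev Spacetime (n : ℕ) : Type := EuclideanSpace ℝ (Fin (n + 1))

/-- Spatial momenta `ℝ^n`. -/
abbrev Momentum (n : ℕ) : Type := EuclideanSpace ℝ (Fin n)

/-- The Lorentzian scalar product `x⁰y⁰ - ∑ xⁱyⁱ`. -/
def mink {n : ℕ} (x y : Spacetime n) : ℝ :=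
  x 0 * y 0 - ∑ i : Fin n, x i.succ * y i.succ

/-- A real matrix acting on space-time. -/
abbrev act {n : ℕ} (θ : Matrix (Fin (n + 1)) (Fin (n + 1)) ℝ) (x : Spacetime n) : Spacetime n :=
  Matrix.toEuclideanLin θ x

/-- Skew-symmetry with respect to the Lorentzian scalar product. -/
def IsLorentzSkew {n : ℕ} (θ : Matrix (Fin (n + 1)) (Fin (n + 1)) ℝ) : Prop :=
  ∀ x y : Spacetime n, mink (act θ x) y = -mink x (act θ y)

/-- The energy `ω_p = √(p² + m²)`. -/
def energy {n : ℕ} (m : ℝ) (p : Momentum n) : ℝ := √(m ^ 2 + ‖p‖ ^ 2)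

/-- The point `(ω_p, p)` of the upper mass shell. -/
def onShell {n : ℕ} (m : ℝ) (p : Momentum n) : Spacetime n :=
  WithLp.toLp 2 (Fin.cons (energy m p) (fun i => p i))

/-- The invariant measure `dμ(p) = (2 ω_p)⁻¹ dⁿp`. -/
def shellMeasure (n : ℕ) (m : ℝ) : Measure (Momentum n) :=
  volume.withDensity fun p => ENNReal.ofReal (1 / (2 * energy m p))

instance (n : ℕ) (m : ℝ) : SigmaFinite (shellMeasure n m) := by
  unfold shellMeasure; exact SigmaFinite.withDensity_ofReal _

/-- The one-particle Hilbert space `L²(ℝⁿ, dμ)`. -/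
abbrev OneParticle (n : ℕ) (m : ℝ) : Type := Lp ℂ 2 (shellMeasure n m)

/-! ### Bosonic Fock space -/

/-- The product measure `dμ(p₁) ⋯ dμ(p_k)`. -/
abbrev shellMeasurePow (n : ℕ) (m : ℝ) (k : ℕ) : Measure (Fin k → Momentum n) :=
  Measure.pi fun _ => shellMeasure n m

theorem measurePreserving_perm (n : ℕ) (m : ℝ) (k : ℕ) (σ : Equiv.Perm (Fin k)) :
    MeasurePreserving (fun p : Fin k → Momentum n => fun i => p (σ i))
      (shellMeasurePow n m k) (shellMeasurePow n m k) := by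
  have h := measurePreserving_piCongrLeft (α := fun _ : Fin k => Momentum n)
    (fun _ : Fin k => shellMeasure n m) σ.symm
  convert h using 1
  funext p i
  rw [MeasurableEquiv.coe_piCongrLeft]
  have := Equiv.piCongrLeft_apply_apply (fun _ : Fin k => Momentum n) σ.symm p (σ i)
  simpa using this.symm

/-- The action `F ↦ F(p_{σ(1)}, …, p_{σ(k)})` of a permutation. -/
def permute (n : ℕ) (m : ℝ) (k : ℕ) (σ : Equiv.Perm (Fin k)) :
    Lp ℂ 2 (shellMeasurePow n m k) →ₗᵢ[ℂ] Lp ℂ 2 (shellMeasurePow n m k) :=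
  Lp.compMeasurePreservingₗᵢ ℂ _ (measurePreserving_perm n m k σ)

/-- The subspace of totally symmetric functions in `L²((ℝⁿ)ᵏ, dμᵏ)`. -/
def symmetric (n : ℕ) (m : ℝ) (k : ℕ) : Submodule ℂ (Lp ℂ 2 (shellMeasurePow n m k)) where
  carrier := {F | ∀ σ, permute n m k σ F = F}
  add_mem' hF hG σ := by rw [map_add, hF σ, hG σ]
  zero_mem' σ := map_zero _
  smul_mem' c F hF σ := by rw [map_smul, hF σ]

/-- The `k`-particle space. -/
abbrev Sector (n : ℕ) (m : ℝ) (k : ℕ) : Type := symmetric n m k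

theorem isClosed_symmetric (n : ℕ) (m : ℝ) (k : ℕ) :
    IsClosed (symmetric n m k : Set (Lp ℂ 2 (shellMeasurePow n m k))) := by
  have : (symmetric n m k : Set (Lp ℂ 2 (shellMeasurePow n m k)))
      = ⋂ σ, {F | permute n m k σ F = F} := by
    ext F; simp [symmetric]
  rw [this]
  exact isClosed_iInter fun σ => isClosed_eq (permute n m k σ).continuous continuous_id

instance (n : ℕ) (m : ℝ) (k : ℕ) : CompleteSpace (Sector n m k) :=
  (isClosed_symmetric n m k).completeSpace_coe

/-- The bosonic Fock space, the Hilbert sum of the `k`-particle spaces, `k = 0, 1, 2, …`. -/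
abbrev Fock (n : ℕ) (m : ℝ) : Type := lp (fun k => Sector n m k) 2

/-- The vector `Ψ` of the `k`-particle space as a vector of Fock space. -/
def inSector {n : ℕ} {m : ℝ} (k : ℕ) (Ψ : Sector n m k) : Fock n m := lp.single 2 k Ψ

/-- The subspace `𝒟` of vectors of finite particle number. -/
def finiteParticle (n : ℕ) (m : ℝ) : Submodule ℂ (Fock n m) where
  carrier := {Ψ | ∃ N : ℕ, ∀ k, N ≤ k → Ψ k = 0}
  add_mem' := by
    rintro Ψ Φ ⟨N, hN⟩ ⟨M, hM⟩
    refine ⟨max N M, fun k hk => ?_⟩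
    rw [lp.coeFn_add, Pi.add_apply, hN k (le_trans (le_max_left _ _) hk),
      hM k (le_trans (le_max_right _ _) hk), add_zero]
  zero_mem' := ⟨0, fun k _ => by rw [lp.coeFn_zero]; rfl⟩
  smul_mem' := by
    rintro c Ψ ⟨N, hN⟩
    exact ⟨N, fun k hk => by rw [lp.coeFn_smul, Pi.smul_apply, hN k hk, smul_zero]⟩

theorem memLp_one (n : ℕ) (m : ℝ) :
    MemLp (fun _ : Fin 0 → Momentum n => (1 : ℂ)) 2 (shellMeasurePow n m 0) := by
  have : IsFiniteMeasure (shellMeasurePow n m 0) := by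
    rw [shellMeasurePow, Measure.pi_of_empty]; infer_instance
  exact memLp_const 1

/-- The unit vector `1` of the zero-particle space `ℂ`. -/
def vacuumSector (n : ℕ) (m : ℝ) : Sector n m 0 :=
  ⟨(memLp_one n m).toLp, fun σ => by
    have : σ = 1 := Subsingleton.elim _ _
    subst this
    exact Lp.compMeasurePreserving_id_apply _⟩

/-- The vacuum vector `Ω`. -/
def vacuum (n : ℕ) (m : ℝ) : Fock n m := inSector 0 (vacuumSector n m)

/-! ### Creation and annihilation operators -/

section Tensor

variable {α β : Type*} [MeasurableSpace α] [MeasurableSpace β] {μ : Measure α} {ν : Measure β}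

theorem aestronglyMeasurable_tensor [SFinite ν] (g : Lp ℂ 2 μ) (F : Lp ℂ 2 ν) :
    AEStronglyMeasurable (fun z : α × β => g z.1 * F z.2) (μ.prod ν) :=
  (Lp.aestronglyMeasurable g).comp_fst.mul (Lp.aestronglyMeasurable F).comp_snd

theorem eLpNorm_tensor [SFinite ν] (g : Lp ℂ 2 μ) (F : Lp ℂ 2 ν) :
    eLpNorm (fun z : α × β => g z.1 * F z.2) 2 (μ.prod ν)
      = eLpNorm g 2 μ * eLpNorm F 2 ν := by
  simp only [eLpNorm_eq_lintegral_rpow_enorm_toReal (p := 2) (by norm_num) (by norm_num), enorm_mul]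
  rw [← ENNReal.mul_rpow_of_nonneg _ _ (by norm_num), ← lintegral_prod_mul]
  · simp only [ENNReal.mul_rpow_of_nonneg _ _ ENNReal.toReal_nonneg]
  · exact (Lp.aestronglyMeasurable g).enorm.pow_const _
  · exact (Lp.aestronglyMeasurable F).enorm.pow_const _

theorem memLp_tensor [SFinite ν] (g : Lp ℂ 2 μ) (F : Lp ℂ 2 ν) :
    MemLp (fun z : α × β => g z.1 * F z.2) 2 (μ.prod ν) :=
  ⟨aestronglyMeasurable_tensor g F, by
    rw [eLpNorm_tensor]
    exact ENNReal.mul_lt_top (Lp.eLpNorm_lt_top g) (Lp.eLpNorm_lt_top F)⟩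

/-- The bounded map `F ↦ g ⊗ F`, where `(g ⊗ F)(x, y) = g(x) F(y)`. -/
def tensorLeft [SFinite μ] [SFinite ν] (g : Lp ℂ 2 μ) : Lp ℂ 2 ν →L[ℂ] Lp ℂ 2 (μ.prod ν) :=
  LinearMap.mkContinuous
    { toFun := fun F => (memLp_tensor g F).toLp
      map_add' := fun F G => by
        rw [← MemLp.toLp_add]
        refine MemLp.toLp_congr _ _ ?_
        filter_upwards [Measure.quasiMeasurePreserving_snd.ae (Lp.coeFn_add F G)] with z hz
        change g z.1 * (F + G : Lp ℂ 2 ν) z.2 = g z.1 * F z.2 + g z.1 * G z.2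
        rw [hz, Pi.add_apply, mul_add]
      map_smul' := fun c F => by
        rw [RingHom.id_apply, ← MemLp.toLp_const_smul]
        refine MemLp.toLp_congr _ _ ?_
        filter_upwards [Measure.quasiMeasurePreserving_snd.ae (Lp.coeFn_smul c F)] with z hz
        simp [hz, mul_left_comm] }
    ‖g‖ fun F => by
      change ‖(memLp_tensor g F).toLp‖ ≤ _
      rw [Lp.norm_toLp, eLpNorm_tensor, ENNReal.toReal_mul]
      rfl

end Tensor

/-- The creation operator from `k` to `k + 1` particles,
`a*(g) F = √(k+1) P_{k+1} (g ⊗ F)`, with `P_{k+1}` the projection onto the symmetric functions. -/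
def createSector {n : ℕ} {m : ℝ} (g : OneParticle n m) (k : ℕ) :
    Sector n m k →L[ℂ] Sector n m (k + 1) :=
  ((√(k + 1 : ℝ) : ℝ) : ℂ) • ((symmetric n m (k + 1)).orthogonalProjectionOnto.comp
    ((Lp.compMeasurePreservingₗᵢ ℂ (MeasurableEquiv.piFinSuccAbove (fun _ => Momentum n) 0)
        (measurePreserving_piFinSuccAbove (fun _ : Fin (k + 1) => shellMeasure n m) 0)
      ).toContinuousLinearMap.comp
        ((tensorLeft g).comp (symmetric n m k).subtypeL)))

/-- The annihilation operator from `k + 1` to `k` particles, the adjoint of the creation operator: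
`(a(g) F)(p₁, …, p_k) = √(k+1) ∫ conj (g p) F(p, p₁, …, p_k) dμ(p)`. -/
def annihilateSector {n : ℕ} {m : ℝ} (g : OneParticle n m) (k : ℕ) :
    Sector n m (k + 1) →L[ℂ] Sector n m k :=
  ContinuousLinearMap.adjoint (createSector g k)

/-! ### Second quantization -/

/-- The `k`-particle component of `a*(h₁) ⋯ a*(h_k) Ω`, that is
`√(k!) P_k (h₁ ⊗ ⋯ ⊗ h_k)`. -/
def createMany {n : ℕ} {m : ℝ} : (l : List (OneParticle n m)) → Sector n m l.length
  | [] => vacuumSector n m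
  | h :: l => createSector h l.length (createMany l)

/-- The vector `a*(h₁) ⋯ a*(h_k) Ω` of Fock space. -/
def productVector {n : ℕ} {m : ℝ} (l : List (OneParticle n m)) : Fock n m :=
  inSector l.length (createMany l)

/-- The second quantization `Γ(T) = ⨁ T^{⊗ k}` of a one-particle operator of norm at most one:
the continuous extension of the linear map
`P_k (h₁ ⊗ ⋯ ⊗ h_k) ↦ P_k (T h₁ ⊗ ⋯ ⊗ T h_k)` on the span of these vectors, which is dense. -/
def secondQuantization {n : ℕ} {m : ℝ} (T : OneParticle n m →L[ℂ] OneParticle n m) :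
    Fock n m →L[ℂ] Fock n m :=
  LinearMap.extendOfNorm
    (Finsupp.linearCombination ℂ fun l : List (OneParticle n m) => productVector (l.map T))
    (Finsupp.linearCombination ℂ fun l : List (OneParticle n m) => productVector l)

/-- The function `p ↦ e^{i y·p}` on the mass shell. -/
def phase {n : ℕ} (m : ℝ) (y : Spacetime n) (p : Momentum n) : ℂ :=
  Complex.exp (Complex.I * (mink y (onShell m p) : ℝ))

theorem measurable_phase {n : ℕ} (m : ℝ) (y : Spacetime n) : Measurable (phase m y) := by
  have : Continuous (phase m y) := by
    unfold phase mink onShell energy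
    simp only [Fin.cons_zero, Fin.cons_succ]
    fun_prop
  exact this.measurable

theorem norm_phase {n : ℕ} (m : ℝ) (y : Spacetime n) (p : Momentum n) : ‖phase m y p‖ = 1 := by
  rw [phase, mul_comm, Complex.norm_exp_ofReal_mul_I]

theorem memLp_phase_mul {n : ℕ} {m : ℝ} (y : Spacetime n) (h : OneParticle n m) :
    MemLp (fun p => phase m y p * h p) 2 (shellMeasure n m) := by
  refine (Lp.memLp h).of_le
    ((measurable_phase m y).aestronglyMeasurable.mul (Lp.aestronglyMeasurable h))
    (ae_of_all _ fun p => ?_)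
  rw [norm_mul, norm_phase, one_mul]

/-- The one-particle translation `e^{i y·P}`: multiplication by `e^{i y·p}`. -/
def oneParticleTranslation {n : ℕ} (m : ℝ) (y : Spacetime n) :
    OneParticle n m →L[ℂ] OneParticle n m :=
  LinearMap.mkContinuous
    { toFun := fun h => (memLp_phase_mul y h).toLp
      map_add' := fun F G => by
        rw [← MemLp.toLp_add]
        refine MemLp.toLp_congr _ _ ?_
        filter_upwards [Lp.coeFn_add F G] with z hz
        change phase m y z * (F + G : OneParticle n m) z = phase m y z * F z + phase m y z * G z
        rw [hz, Pi.add_apply, mul_add]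
      map_smul' := fun c F => by
        rw [RingHom.id_apply, ← MemLp.toLp_const_smul]
        refine MemLp.toLp_congr _ _ ?_
        filter_upwards [Lp.coeFn_smul c F] with z hz
        simp [hz, mul_left_comm] }
    1 fun F => by
      change ‖(memLp_phase_mul y F).toLp‖ ≤ _
      rw [one_mul, Lp.norm_toLp, Lp.norm_def,
        eLpNorm_congr_norm_ae (g := F) (ae_of_all _ fun p => by rw [norm_mul, norm_phase, one_mul])]

/-- The translations `U(y) = e^{i y·P}` on Fock space, where `P` is the second-quantized momentum
operator, which acts on `k` particles as multiplication by `p₁ + ⋯ + p_k`. -/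
def translation {n : ℕ} (m : ℝ) (y : Spacetime n) : Fock n m →L[ℂ] Fock n m :=
  secondQuantization (oneParticleTranslation m y)

/-- The unitary group `e^{i y·X}` generated by `X = Γ(V⁻¹) P Γ(V)`. -/
def groupX {n : ℕ} {m : ℝ} (V : OneParticle n m ≃ₗᵢ[ℂ] OneParticle n m) (y : Spacetime n) :
    Fock n m →L[ℂ] Fock n m :=
  (secondQuantization (V.symm : OneParticle n m →L[ℂ] OneParticle n m)).comp
    ((translation m y).comp (secondQuantization (V : OneParticle n m →L[ℂ] OneParticle n m)))

/-! ### The free field -/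

/-- The complex conjugate of a Schwartz function. -/
def conjTest {n : ℕ} (f : 𝓢(Spacetime n, ℂ)) : 𝓢(Spacetime n, ℂ) :=
  SchwartzMap.postcompCLM (𝕜 := ℝ) (Complex.conjCLE : ℂ →L[ℝ] ℂ) f

/-- `f⁺(p) = ∫ f(x) e^{i p·x} dx` for `p` on the upper mass shell. -/
def plusFun {n : ℕ} (m : ℝ) (f : 𝓢(Spacetime n, ℂ)) (p : Momentum n) : ℂ :=
  ∫ x : Spacetime n, f x * Complex.exp (Complex.I * (mink (onShell m p) x : ℝ))

/-- `f⁻(p) = ∫ f(x) e^{-i p·x} dx` for `p` on the upper mass shell. -/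
def minusFun {n : ℕ} (m : ℝ) (f : 𝓢(Spacetime n, ℂ)) (p : Momentum n) : ℂ :=
  ∫ x : Spacetime n, f x * Complex.exp (-(Complex.I * (mink (onShell m p) x : ℝ)))

/-- The vector `(ω_p, -p)` dual to `(ω_p, p)`. -/
def onShellDual {n : ℕ} (m : ℝ) (p : Momentum n) : Spacetime n :=
  WithLp.toLp 2 (Fin.cons (energy m p) (fun i => -p i))

theorem mink_onShell {n : ℕ} (m : ℝ) (p : Momentum n) (x : Spacetime n) :
    mink (onShell m p) x = inner ℝ x (onShellDual m p) := by
  simp [mink, onShell, onShellDual, PiLp.inner_apply, Fin.sum_univ_succ, Finset.sum_neg_distrib]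
  ring

theorem norm_le_onShellDual {n : ℕ} (m : ℝ) (p : Momentum n) : ‖p‖ ≤ ‖onShellDual m p‖ := by
  rw [EuclideanSpace.norm_eq, EuclideanSpace.norm_eq]
  apply Real.sqrt_le_sqrt
  simp [onShellDual, Fin.sum_univ_succ]
  positivity

theorem continuous_onShellDual {n : ℕ} (m : ℝ) :
    Continuous (onShellDual m : Momentum n → Spacetime n) := by
  unfold onShellDual
  refine (PiLp.continuous_toLp 2 _).comp (continuous_pi fun i => ?_)
  refine Fin.cases ?_ (fun j => ?_) i
  · simp only [Fin.cons_zero, energy]; fun_prop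
  · simp only [Fin.cons_succ]; fun_prop

theorem plusFun_eq {n : ℕ} (m : ℝ) (f : 𝓢(Spacetime n, ℂ)) (p : Momentum n) :
    plusFun m f p = (𝓕 f) ((-(2 * Real.pi)⁻¹ : ℝ) • onShellDual m p) := by
  rw [SchwartzMap.fourier_coe, Real.fourier_eq']
  unfold plusFun
  congr 1 with x
  rw [mink_onShell, inner_smul_right, smul_eq_mul, mul_comm]
  congr 2
  have := Real.pi_ne_zero
  push_cast
  have : (Real.pi : ℂ) ≠ 0 := by exact_mod_cast this
  field_simp

theorem minusFun_eq {n : ℕ} (m : ℝ) (f : 𝓢(Spacetime n, ℂ)) (p : Momentum n) :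
    minusFun m f p = (𝓕 f) (((2 * Real.pi)⁻¹ : ℝ) • onShellDual m p) := by
  rw [SchwartzMap.fourier_coe, Real.fourier_eq']
  unfold minusFun
  congr 1 with x
  rw [mink_onShell, inner_smul_right, smul_eq_mul, mul_comm]
  congr 2
  have := Real.pi_ne_zero
  push_cast
  have : (Real.pi : ℂ) ≠ 0 := by exact_mod_cast this
  field_simp

theorem shellMeasure_le (n : ℕ) {m : ℝ} (hm : 0 < m) :
    shellMeasure n m ≤ ENNReal.ofReal (1 / (2 * m)) • volume := by
  rw [← withDensity_const]
  refine withDensity_mono (ae_of_all _ fun p => ENNReal.ofReal_le_ofReal ?_)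
  have : m ≤ energy m p := Real.le_sqrt_of_sq_le (by nlinarith [sq_nonneg ‖p‖])
  exact one_div_le_one_div_of_le (by positivity) (by linarith)

theorem memLp_onShell {n : ℕ} {m : ℝ} (hm : 0 < m) (g : 𝓢(Spacetime n, ℂ)) {c : ℝ} (hc : c ≠ 0) :
    MemLp (fun p => g (c • onShellDual m p)) 2 (shellMeasure n m) := by
  refine MemLp.of_measure_le_smul ENNReal.ofReal_ne_top (shellMeasure_le n hm) ?_
  have hcont : Continuous fun p : Momentum n => g (c • onShellDual m p) :=
    g.continuous.comp ((continuous_onShellDual m).const_smul c)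
  obtain ⟨C, hC⟩ : ∃ C, ∀ x, (1 + ‖x‖) ^ (n + 1) * ‖g x‖ ≤ C :=
    ⟨_, fun x => by
      simpa using SchwartzMap.one_add_le_sup_seminorm_apply (𝕜 := ℝ) (m := (n + 1, 0))
        (k := n + 1) (n := 0) le_rfl le_rfl g x⟩
  have hC0 : 0 ≤ C := le_trans (by positivity) (hC 0)
  set b := min |c| 1 with hb
  have hb0 : 0 < b := lt_min (abs_pos.mpr hc) one_pos
  have hbound : ∀ p : Momentum n,
      ‖g (c • onShellDual m p)‖ ≤ C * (b ^ (n + 1))⁻¹ * (1 + ‖p‖) ^ (-((n : ℝ) + 1)) := by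
    intro p
    have h1 : b * (1 + ‖p‖) ≤ 1 + ‖c • onShellDual m p‖ := by
      rw [norm_smul, Real.norm_eq_abs, mul_add, mul_one]
      exact add_le_add (min_le_right _ _) (mul_le_mul (min_le_left _ _) (norm_le_onShellDual m p)
        (norm_nonneg _) (abs_nonneg _))
    have h2 : (b * (1 + ‖p‖)) ^ (n + 1) * ‖g (c • onShellDual m p)‖ ≤ C :=
      le_trans (by gcongr) (hC _)
    have h3 : (1 + ‖p‖) ^ (-((n : ℝ) + 1)) = ((1 + ‖p‖) ^ (n + 1))⁻¹ := by
      rw [Real.rpow_neg (by positivity), ← Real.rpow_natCast]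
      norm_num
    rw [h3, mul_assoc, ← mul_inv, ← mul_pow, ← div_eq_mul_inv, le_div_iff₀ (by positivity),
      mul_comm]
    exact h2
  rw [memLp_two_iff_integrable_sq_norm hcont.aestronglyMeasurable]
  have hint : Integrable (fun p : Momentum n => (1 + ‖p‖) ^ (-((n : ℝ) + 1))) volume :=
    integrable_one_add_norm (by simp)
  refine (hint.const_mul ((C * (b ^ (n + 1))⁻¹) ^ 2)).mono'
    (hcont.norm.pow 2).aestronglyMeasurable (ae_of_all _ fun p => ?_)
  rw [Real.norm_of_nonneg (by positivity)]
  have h4 : (1 + ‖p‖) ^ (-((n : ℝ) + 1)) ≤ 1 :=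
    Real.rpow_le_one_of_one_le_of_nonpos (by linarith [norm_nonneg p]) (by linarith)
  have h5 : 0 ≤ (1 + ‖p‖) ^ (-((n : ℝ) + 1)) := by positivity
  calc ‖g (c • onShellDual m p)‖ ^ 2
      ≤ (C * (b ^ (n + 1))⁻¹ * (1 + ‖p‖) ^ (-((n : ℝ) + 1))) ^ 2 := by gcongr; exact hbound p
    _ = (C * (b ^ (n + 1))⁻¹) ^ 2
          * ((1 + ‖p‖) ^ (-((n : ℝ) + 1)) * (1 + ‖p‖) ^ (-((n : ℝ) + 1))) := by ring
    _ ≤ _ := by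
      gcongr
      nlinarith

/-! ### Partially defined operators -/

section Partial

variable {H : Type*} [NormedAddCommGroup H] [InnerProductSpace ℂ H]

/-- The value of a partially defined operator, with the value `0` off its domain. -/
def applyOrZero (T : H →ₗ.[ℂ] H) (Ψ : H) : H :=
  open Classical in if h : Ψ ∈ T.domain then T ⟨Ψ, h⟩ else 0

theorem applyOrZero_of_mem (T : H →ₗ.[ℂ] H) {Ψ : H} (h : Ψ ∈ T.domain) :
    applyOrZero T Ψ = T ⟨Ψ, h⟩ := dif_pos h

theorem applyOrZero_add (T : H →ₗ.[ℂ] H) {Ψ Φ : H} (h : Ψ ∈ T.domain) (h' : Φ ∈ T.domain) :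
    applyOrZero T (Ψ + Φ) = applyOrZero T Ψ + applyOrZero T Φ := by
  rw [applyOrZero_of_mem T h, applyOrZero_of_mem T h', applyOrZero_of_mem T (T.domain.add_mem h h'),
    ← T.map_add]
  rfl

theorem applyOrZero_smul (T : H →ₗ.[ℂ] H) (c : ℂ) {Ψ : H} (h : Ψ ∈ T.domain) :
    applyOrZero T (c • Ψ) = c • applyOrZero T Ψ := by
  rw [applyOrZero_of_mem T h, applyOrZero_of_mem T (T.domain.smul_mem c h), ← T.map_smul]
  rfl

/-- An operator is essentially self-adjoint if it is densely defined and closable and its closure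
is self-adjoint. -/
def IsEssentiallySelfAdjoint [CompleteSpace H] (T : H →ₗ.[ℂ] H) : Prop :=
  Dense (T.domain : Set H) ∧ T.IsClosable ∧ IsSelfAdjoint T.closure

end Partial

section Field

variable {n : ℕ} {m : ℝ} [Fact (0 < m)]

/-- `f⁺` as a one-particle vector. -/
def plusVec (n : ℕ) (m : ℝ) [hm : Fact (0 < m)] (f : 𝓢(Spacetime n, ℂ)) : OneParticle n m :=
  MemLp.toLp (plusFun m f) (by
    simp only [funext (plusFun_eq m f)]
    exact memLp_onShell hm.out _ (neg_ne_zero.mpr (inv_ne_zero (by positivity))))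

/-- The complex conjugate of `f⁻` as a one-particle vector. -/
def minusConjVec (n : ℕ) (m : ℝ) [hm : Fact (0 < m)] (f : 𝓢(Spacetime n, ℂ)) : OneParticle n m :=
  MemLp.toLp (fun p => starRingEnd ℂ (minusFun m f p)) (by
    refine MemLp.star (f := minusFun m f) ?_
    simp only [funext (minusFun_eq m f)]
    exact memLp_onShell hm.out _ (inv_ne_zero (by positivity)))

/-- The components of `φ(f)Ψ = (a(conj f⁻) + a*(f⁺))Ψ`. -/
def fieldComponent (f : 𝓢(Spacetime n, ℂ)) (Ψ : Fock n m) : (k : ℕ) → Sector n m k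
  | 0 => annihilateSector (minusConjVec n m f) 0 (Ψ 1)
  | k + 1 => annihilateSector (minusConjVec n m f) (k + 1) (Ψ (k + 2))
      + createSector (plusVec n m f) k (Ψ k)

theorem fieldComponent_add (f : 𝓢(Spacetime n, ℂ)) (Ψ Φ : Fock n m) (k : ℕ) :
    fieldComponent f (Ψ + Φ) k = fieldComponent f Ψ k + fieldComponent f Φ k := by
  cases k with
  | zero => simp [fieldComponent]
  | succ k => simp [fieldComponent]; abel

theorem fieldComponent_smul (f : 𝓢(Spacetime n, ℂ)) (c : ℂ) (Ψ : Fock n m) (k : ℕ) :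
    fieldComponent f (c • Ψ) k = c • fieldComponent f Ψ k := by
  cases k with
  | zero => simp [fieldComponent]
  | succ k => simp [fieldComponent]

/-- The smeared free scalar field `φ(f)` of mass `m`, on its natural domain: the vectors `Ψ` for
which the components of `φ(f)Ψ` are square summable. -/
def freeField (f : 𝓢(Spacetime n, ℂ)) : Fock n m →ₗ.[ℂ] Fock n m where
  domain :=
    { carrier := {Ψ | Memℓp (fieldComponent f Ψ) 2}
      add_mem' := fun {Ψ Φ} h h' => by
        have : fieldComponent f (Ψ + Φ) = fieldComponent f Ψ + fieldComponent f Φ :=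
          funext (fieldComponent_add f Ψ Φ)
        simp only [Set.mem_ofPred_eq] at *
        rw [this]; exact h.add h'
      zero_mem' := by
        have : fieldComponent f (0 : Fock n m) = 0 := funext fun k => by
          simpa using fieldComponent_smul f 0 (0 : Fock n m) k
        simp only [Set.mem_ofPred_eq]
        rw [this]; exact zero_memℓp
      smul_mem' := fun c Ψ h => by
        have : fieldComponent f (c • Ψ) = c • fieldComponent f Ψ :=
          funext (fieldComponent_smul f c Ψ)
        simp only [Set.mem_ofPred_eq] at *
        rw [this]; exact h.const_smul c }
  toFun :=
    { toFun := fun Ψ => ⟨fieldComponent f Ψ, Ψ.2⟩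
      map_add' := fun Ψ Φ => lp.ext (funext (fieldComponent_add f Ψ.1 Φ.1))
      map_smul' := fun c Ψ => lp.ext (funext (fieldComponent_smul f c Ψ.1)) }

/-! ### The deformed field -/

/-- The vector `e^{iθx·X} φ(f) e^{-iθx·X} e^{iy·X} Ψ`. -/
def orbit (θ : Matrix (Fin (n + 1)) (Fin (n + 1)) ℝ) (V : OneParticle n m ≃ₗᵢ[ℂ] OneParticle n m)
    (f : 𝓢(Spacetime n, ℂ)) (Ψ : Fock n m) (x y : Spacetime n) : Fock n m :=
  groupX V (act θ x) (applyOrZero (freeField f) (groupX V (-act θ x) (groupX V y Ψ)))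

/-- The regularized integrand
`e^{-i x·y} χ(εx, εy) e^{iθx·X} φ(f) e^{-iθx·X} e^{iy·X} Ψ`. -/
def warpIntegrand (θ : Matrix (Fin (n + 1)) (Fin (n + 1)) ℝ)
    (V : OneParticle n m ≃ₗᵢ[ℂ] OneParticle n m) (f : 𝓢(Spacetime n, ℂ)) (Ψ : Fock n m)
    (χ : 𝓢(Spacetime n × Spacetime n, ℂ)) (ε : ℝ) (z : Spacetime n × Spacetime n) : Fock n m :=
  (Complex.exp (-(Complex.I * (mink z.1 z.2 : ℝ))) * χ (ε • z)) • orbit θ V f Ψ z.1 z.2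

/-- `Φ` is the value of the oscillatory integral
`(2π)^{-d} lim_{ε → 0} ∬ dx dy e^{-i x·y} χ(εx, εy) e^{iθx·X} φ(f) e^{-iθx·X} e^{iy·X} Ψ`:
the integrands are defined and integrable, and for every cutoff function `χ` with `χ(0, 0) = 1`
the limit exists in norm and equals `Φ`. -/
structure IsWarped (θ : Matrix (Fin (n + 1)) (Fin (n + 1)) ℝ)
    (V : OneParticle n m ≃ₗᵢ[ℂ] OneParticle n m) (f : 𝓢(Spacetime n, ℂ)) (Ψ Φ : Fock n m) :
    Prop where
  mem_domain : ∀ x y : Spacetime n,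
    groupX V (-act θ x) (groupX V y Ψ) ∈ (freeField f : Fock n m →ₗ.[ℂ] Fock n m).domain
  integrable : ∀ χ : 𝓢(Spacetime n × Spacetime n, ℂ), ∀ ε : ℝ, 0 < ε →
    Integrable (warpIntegrand θ V f Ψ χ ε)
  tendsto : ∀ χ : 𝓢(Spacetime n × Spacetime n, ℂ), χ 0 = 1 →
    Tendsto (fun ε : ℝ => (((2 * Real.pi) ^ (n + 1))⁻¹ : ℂ) • ∫ z, warpIntegrand θ V f Ψ χ ε z)
      (𝓝[>] 0) (𝓝 Φ)

theorem warpIntegrand_add {θ : Matrix (Fin (n + 1)) (Fin (n + 1)) ℝ}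
    {V : OneParticle n m ≃ₗᵢ[ℂ] OneParticle n m} {f : 𝓢(Spacetime n, ℂ)} {Ψ Φ Ψ' Φ' : Fock n m}
    (h : IsWarped θ V f Ψ Φ) (h' : IsWarped θ V f Ψ' Φ')
    (χ : 𝓢(Spacetime n × Spacetime n, ℂ)) (ε : ℝ) :
    warpIntegrand θ V f (Ψ + Ψ') χ ε
      = warpIntegrand θ V f Ψ χ ε + warpIntegrand θ V f Ψ' χ ε := by
  funext z
  rw [Pi.add_apply, warpIntegrand, warpIntegrand, warpIntegrand, ← smul_add, orbit, orbit, orbit,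
    ← map_add, ← applyOrZero_add _ (h.mem_domain z.1 z.2) (h'.mem_domain z.1 z.2), ← map_add,
    ← map_add]

theorem warpIntegrand_smul {θ : Matrix (Fin (n + 1)) (Fin (n + 1)) ℝ}
    {V : OneParticle n m ≃ₗᵢ[ℂ] OneParticle n m} {f : 𝓢(Spacetime n, ℂ)} {Ψ Φ : Fock n m}
    (c : ℂ) (h : IsWarped θ V f Ψ Φ) (χ : 𝓢(Spacetime n × Spacetime n, ℂ)) (ε : ℝ) :
    warpIntegrand θ V f (c • Ψ) χ ε = c • warpIntegrand θ V f Ψ χ ε := by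
  funext z
  rw [Pi.smul_apply, warpIntegrand, warpIntegrand, smul_comm c, orbit, orbit,
    (groupX V z.2).map_smul c, (groupX V (-act θ z.1)).map_smul c,
    applyOrZero_smul _ c (h.mem_domain z.1 z.2), (groupX V (act θ z.1)).map_smul c]

theorem warpIntegrand_zero {θ : Matrix (Fin (n + 1)) (Fin (n + 1)) ℝ}
    {V : OneParticle n m ≃ₗᵢ[ℂ] OneParticle n m} {f : 𝓢(Spacetime n, ℂ)}
    (χ : 𝓢(Spacetime n × Spacetime n, ℂ)) (ε : ℝ) :
    warpIntegrand θ V f (0 : Fock n m) χ ε = 0 := by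
  funext z
  have := applyOrZero_smul (freeField f : Fock n m →ₗ.[ℂ] Fock n m) 0
    (Submodule.zero_mem (freeField f : Fock n m →ₗ.[ℂ] Fock n m).domain)
  rw [zero_smul, zero_smul] at this
  rw [Pi.zero_apply, warpIntegrand, orbit, map_zero, map_zero, this, map_zero, smul_zero]

theorem IsWarped.add {θ : Matrix (Fin (n + 1)) (Fin (n + 1)) ℝ}
    {V : OneParticle n m ≃ₗᵢ[ℂ] OneParticle n m} {f : 𝓢(Spacetime n, ℂ)} {Ψ Φ Ψ' Φ' : Fock n m}
    (h : IsWarped θ V f Ψ Φ) (h' : IsWarped θ V f Ψ' Φ') :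
    IsWarped θ V f (Ψ + Ψ') (Φ + Φ') where
  mem_domain x y := by
    rw [map_add, map_add]
    exact Submodule.add_mem _ (h.mem_domain x y) (h'.mem_domain x y)
  integrable χ ε hε := by
    rw [warpIntegrand_add h h']
    exact (h.integrable χ ε hε).add (h'.integrable χ ε hε)
  tendsto χ hχ := by
    refine ((h.tendsto χ hχ).add (h'.tendsto χ hχ)).congr' ?_
    filter_upwards [self_mem_nhdsWithin] with ε hε
    rw [← smul_add, ← integral_add (h.integrable χ ε hε) (h'.integrable χ ε hε),
      warpIntegrand_add h h']
    simp only [Pi.add_apply]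

theorem IsWarped.smul {θ : Matrix (Fin (n + 1)) (Fin (n + 1)) ℝ}
    {V : OneParticle n m ≃ₗᵢ[ℂ] OneParticle n m} {f : 𝓢(Spacetime n, ℂ)} {Ψ Φ : Fock n m}
    (c : ℂ) (h : IsWarped θ V f Ψ Φ) : IsWarped θ V f (c • Ψ) (c • Φ) where
  mem_domain x y := by
    rw [map_smul, map_smul]
    exact Submodule.smul_mem _ c (h.mem_domain x y)
  integrable χ ε hε := by
    rw [warpIntegrand_smul c h]
    exact (h.integrable χ ε hε).smul c
  tendsto χ hχ := by
    refine ((h.tendsto χ hχ).const_smul c).congr fun ε => ?_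
    rw [smul_comm, ← integral_smul, warpIntegrand_smul c h]
    simp only [Pi.smul_apply]

theorem IsWarped.zero (θ : Matrix (Fin (n + 1)) (Fin (n + 1)) ℝ)
    (V : OneParticle n m ≃ₗᵢ[ℂ] OneParticle n m) (f : 𝓢(Spacetime n, ℂ)) :
    IsWarped θ V f (0 : Fock n m) 0 where
  mem_domain x y := by
    rw [map_zero, map_zero]
    exact Submodule.zero_mem _
  integrable χ ε hε := by
    rw [warpIntegrand_zero]
    exact integrable_zero _ _ _
  tendsto χ hχ := by
    simp only [warpIntegrand_zero, Pi.zero_apply, integral_zero, smul_zero]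
    exact tendsto_const_nhds

/-- The graph of the deformed field. -/
def warpedGraph (θ : Matrix (Fin (n + 1)) (Fin (n + 1)) ℝ)
    (V : OneParticle n m ≃ₗᵢ[ℂ] OneParticle n m) (f : 𝓢(Spacetime n, ℂ)) :
    Submodule ℂ (Fock n m × Fock n m) where
  carrier := {w | IsWarped θ V f w.1 w.2}
  add_mem' h h' := IsWarped.add h h'
  zero_mem' := IsWarped.zero θ V f
  smul_mem' c _ h := IsWarped.smul c h

/-- The deformed field `φ_{θ,X}(f)`, `X = Γ(V⁻¹) P Γ(V)`, with domain `𝒟^{θ,X}` the set of all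
vectors on which the oscillatory integral is defined. -/
def deformedField (θ : Matrix (Fin (n + 1)) (Fin (n + 1)) ℝ)
    (V : OneParticle n m ≃ₗᵢ[ℂ] OneParticle n m) (f : 𝓢(Spacetime n, ℂ)) :
    Fock n m →ₗ.[ℂ] Fock n m :=
  (warpedGraph θ V f).toLinearPMap

theorem exists_cutoff (n : ℕ) : ∃ χ : 𝓢(Spacetime n × Spacetime n, ℂ), χ 0 = 1 := by
  let b : ContDiffBump (0 : Spacetime n × Spacetime n) := ⟨1, 2, one_pos, one_lt_two⟩
  have hs : HasCompactSupport fun x => ((b x : ℝ) : ℂ) :=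
    b.hasCompactSupport.comp_left (g := fun r : ℝ => (r : ℂ)) (by simp)
  refine ⟨hs.toSchwartzMap (Complex.ofRealCLM.contDiff.comp b.contDiff), ?_⟩
  have : b 0 = 1 := b.one_of_mem_closedBall (Metric.mem_closedBall_self zero_le_one)
  change ((b 0 : ℝ) : ℂ) = 1
  rw [this, Complex.ofReal_one]

/-- `φ_{θ,X}(f)Ψ = Φ` means exactly that the oscillatory integral has the value `Φ`. -/
theorem mem_graph_deformedField {θ : Matrix (Fin (n + 1)) (Fin (n + 1)) ℝ}
    {V : OneParticle n m ≃ₗᵢ[ℂ] OneParticle n m} {f : 𝓢(Spacetime n, ℂ)} {Ψ Φ : Fock n m} :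
    (Ψ, Φ) ∈ (deformedField θ V f).graph ↔ IsWarped θ V f Ψ Φ := by
  rw [deformedField, Submodule.toLinearPMap_graph_eq]
  · rfl
  · rintro ⟨Ψ, Φ⟩ h h0
    obtain ⟨χ, hχ⟩ := exists_cutoff n
    simp only at h0
    subst h0
    exact tendsto_nhds_unique (IsWarped.tendsto h χ hχ)
      (IsWarped.tendsto (warpedGraph θ V f).zero_mem χ hχ)

/-- The vectors `φ_{θ,X}(f₁) ⋯ φ_{θ,X}(f_k) Ω`, `k = 0, 1, 2, …`, with test functions supported
in `O`. -/
inductive IsLocalMonomial (θ : Matrix (Fin (n + 1)) (Fin (n + 1)) ℝ)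
    (V : OneParticle n m ≃ₗᵢ[ℂ] OneParticle n m) (O : Set (Spacetime n)) : Fock n m → Prop
  | vacuum : IsLocalMonomial θ V O (vacuum n m)
  | apply (f : 𝓢(Spacetime n, ℂ)) (hf : tsupport f ⊆ O) (Ψ : (deformedField θ V f).domain)
      (hΨ : IsLocalMonomial θ V O (Ψ : Fock n m)) : IsLocalMonomial θ V O (deformedField θ V f Ψ)

end Field

end WarpedField

end

noncomputable section
namespace WarpedField

/-! ### Von Neumann's criterion for essential self-adjointness -/

section SelfAdjointness

variable {H : Type*} [NormedAddCommGroup H] [InnerProductSpace ℂ H] [CompleteSpace H]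

/-! On a fixed particle number everything is explicit. Up to conjugation with `Γ(V)`, which turns
`g` into `V g` and `X` into `P`, the translations multiply by `e^{i u·(p₁+⋯+p_k)}`. Hence the
creation part of `e^{iθx·X} φ(f) e^{-iθx·X} e^{iy·X}` is the ordinary one with the extra factor
`e^{i(x·a + y·b)}`, where `a = -θp₀` and `b = p₁+⋯+p_k`. The oscillatory integral of such a plane
wave is `e^{i a·b}`: integrate over `y`, rescale `x`, and use Fourier inversion (`oscIntegral_eq`,
`tendsto_oscIntegral`). The regularized values are bounded uniformly in `ε`, `a`, `b`, so pointwise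
convergence of these multipliers gives strong convergence of the multiplication operators. The
creation operator thus acquires the unimodular factor `twist`. The annihilation part leads to the
adjoint of a creation operator with the same factor, because `θp₀·p₀ = 0` by skewness. So on finite
particle vectors the deformed field is `a*_θ(f⁺) + a*_θ(conj f⁻)*` (`isWarped_inSector`), and the
twist is trivial on the vacuum.

The rest is a study of this block Jacobi operator. Its blocks grow at most linearly in the particle
number and are controlled by the `L²` norms of `f⁺` and `f⁻`, which depend continuously on `f`; this
is temperedness. For the adjoint, the matrix element of the integrand between a `k`-particle vector
and any vector of the maximal domain involves only neighbouring components of the latter, so the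
same limit can be computed there (`inner_of_isWarped`). For real `f` the two blocks are adjoint to
each other, and a square summable eigenvector with non-zero imaginary eigenvalue would force the
harmonic series to converge (`eq_zero_of_jacobi_eigenvector`); von Neumann's criterion then applies.

The Reeh–Schlieder property uses no covariance of the deformed field. The vectors `f⁺` with `f`
supported in an open set are total in the one-particle space: a vector orthogonal to them gives a
function of small translations which vanishes, is a boundary value of a holomorphic function in
time, and after damping by `e^{-ω}` is analytic in space, so injectivity of the Fourier transform
applies. Since the twist is unimodular and symmetric in all variables but the first, the vectors
`a*_θ(f⁺)Ψ` are total in the next sector. Induction on the particle number finishes the proof, as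
the annihilation part of the field falls into a sector already reached. -/

theorem isEssentiallySelfAdjoint_of_deficiency {T : H →ₗ.[ℂ] H} (hd : Dense (T.domain : Set H))
    (hs : ∀ x y : T.domain, inner ℂ (T x) (y : H) = inner ℂ (x : H) (T y))
    (hker : ∀ c : ℂ, c.re = 0 → c ≠ 0 → ∀ Ψ : H,
      (∀ x : T.domain, inner ℂ (T x) Ψ = inner ℂ (x : H) (c • Ψ)) → Ψ = 0) :
    IsEssentiallySelfAdjoint T := by
  have hle : T ≤ T.adjoint := LinearPMap.IsFormalAdjoint.le_adjoint hd hs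
  have hcl : T.adjoint.IsClosed := LinearPMap.adjoint_isClosed hd
  have hclos : T.IsClosable := hcl.isClosable.leIsClosable hle
  have hadj : ∀ w : H × H, w ∈ T.adjoint.graph ↔
      ∀ x : T.domain, inner ℂ (T x) w.1 = inner ℂ (x : H) w.2 := by
    intro w
    rw [LinearPMap.adjoint_graph_eq_graph_adjoint hd, Submodule.mem_adjoint_iff]
    simp only [sub_eq_zero, LinearPMap.mem_graph_iff]
    exact ⟨fun h x => h x (T x) ⟨x, rfl, rfl⟩, fun h a b ⟨x, hx, hb⟩ => by
      subst hx; subst hb; exact h x⟩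
  have hle2 : T.graph.topologicalClosure ≤ T.adjoint.graph :=
    Submodule.topologicalClosure_minimal _ (LinearPMap.le_graph_of_le hle) hcl
  -- The product `H × H` carries the supremum norm; the orthogonal decomposition below needs the
  -- Hilbert sum.
  let e : WithLp 2 (H × H) ≃L[ℂ] H × H := WithLp.prodContinuousLinearEquiv 2 ℂ H H
  let K : Submodule ℂ (WithLp 2 (H × H)) := T.graph.topologicalClosure.comap (e : _ →ₗ[ℂ] _)
  have hKc : IsClosed (K : Set (WithLp 2 (H × H))) :=
    (Submodule.isClosed_topologicalClosure _).preimage e.continuous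
  have : CompleteSpace K := hKc.completeSpace_coe
  have hge : T.adjoint.graph ≤ T.graph.topologicalClosure := by
    intro w hw
    obtain ⟨u, hu, v, hv, huv⟩ := K.exists_add_mem_mem_orthogonal (e.symm w)
    have hv1 : e v ∈ T.adjoint.graph := by
      have : e v = w - e u := by
        rw [← e.apply_symm_apply w, huv, map_add]; abel
      rw [this]
      exact Submodule.sub_mem _ hw (hle2 hu)
    -- Orthogonality of `v` to the graph reads `⟨x, v₁⟩ + ⟨T x, v₂⟩ = 0`, that is `T* v₂ = -v₁`.
    have hv2 : (((e v).2, -(e v).1) : H × H) ∈ T.adjoint.graph := by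
      rw [hadj]
      intro x
      have hxK : e.symm ((x : H), T x) ∈ K := by
        change e (e.symm _) ∈ T.graph.topologicalClosure
        rw [e.apply_symm_apply]
        exact Submodule.le_topologicalClosure _ (T.mem_graph x)
      have := hv _ hxK
      rw [WithLp.prod_inner_apply] at this
      change inner ℂ (x : H) (e v).1 + inner ℂ (T x) (e v).2 = 0 at this
      rw [inner_neg_right]
      linear_combination this
    rw [hadj] at hv1 hv2
    -- From `T* v₁ = v₂` and `T* v₂ = -v₁`, the vectors `v₂ ± i v₁` are eigenvectors of `T*` with
    -- eigenvalues `±i`, hence both vanish.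
    have h1 := hker Complex.I (by simp) Complex.I_ne_zero ((e v).2 + Complex.I • (e v).1) fun x => by
      rw [inner_add_right, hv2 x, inner_smul_right, hv1 x, smul_add, smul_smul, Complex.I_mul_I,
        inner_add_right, inner_smul_right, neg_one_smul]
      ring
    have h2 := hker (-Complex.I) (by simp) (neg_ne_zero.mpr Complex.I_ne_zero)
      ((e v).2 - Complex.I • (e v).1) fun x => by
      rw [inner_sub_right, hv2 x, inner_smul_right, hv1 x, smul_sub, smul_smul, neg_mul,
        Complex.I_mul_I, inner_sub_right, inner_smul_right, neg_neg, one_smul, inner_neg_right]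
      ring
    have h3 : (e v).1 = 0 := by
      have : (2 * Complex.I) • (e v).1 = 0 := by
        rw [← sub_self (0 : H)]
        nth_rw 1 [← h1]
        rw [← h2, mul_smul, two_smul]; abel
      exact (smul_eq_zero.mp this).resolve_left (by simp)
    have h4 : (e v).2 = 0 := by simpa [h3] using h1
    have h5 : e v = 0 := Prod.ext h3 h4
    have h6 : w = e u := by
      rw [← e.apply_symm_apply w, huv, map_add, h5, add_zero]
    rw [h6]; exact hu
  have heq : T.closure = T.adjoint := by
    apply LinearPMap.eq_of_eq_graph
    rw [← hclos.graph_closure_eq_closure_graph]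
    exact le_antisymm hle2 hge
  have hd' : Dense (T.closure.domain : Set H) := hd.mono (LinearPMap.le_closure T).1
  refine ⟨hd, hclos, ?_⟩
  rw [LinearPMap.isSelfAdjoint_def]
  apply LinearPMap.eq_of_eq_graph
  ext w
  rw [LinearPMap.adjoint_graph_eq_graph_adjoint hd', Submodule.mem_adjoint_iff,
    ← hclos.graph_closure_eq_closure_graph]
  rw [show (w ∈ T.graph.topologicalClosure ↔ w ∈ T.adjoint.graph) from
    ⟨fun h => hle2 h, fun h => hge h⟩, hadj]
  -- What remains is that `T` and its closure have the same adjoint: the defining relation is a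
  -- closed condition on the graph.
  constructor
  · intro h x
    exact sub_eq_zero.mp (h x (T x) (Submodule.le_topologicalClosure _ (T.mem_graph x)))
  · intro h a b hab
    have hc : IsClosed {ab : H × H | inner ℂ ab.2 w.1 - inner ℂ ab.1 w.2 = 0} :=
      isClosed_eq (by fun_prop) continuous_const
    refine closure_minimal (s := (T.graph : Set (H × H))) ?_ hc hab
    rintro ⟨a, b⟩ hab
    obtain ⟨x, rfl, hx⟩ := (LinearPMap.mem_graph_iff _).mp hab
    subst hx
    exact sub_eq_zero.mpr (h x)

end SelfAdjointness

/-! ### A Carleman type criterion for block Jacobi operators -/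

section Jacobi

variable {E : ℕ → Type*} [∀ k, NormedAddCommGroup (E k)] [∀ k, InnerProductSpace ℂ (E k)]
  [∀ k, CompleteSpace (E k)]

/-- A block Jacobi operator whose off-diagonal blocks grow at most linearly has no square summable
eigenvector with a non-zero imaginary eigenvalue. -/
theorem eq_zero_of_jacobi_eigenvector (A : ∀ k, E k →L[ℂ] E (k + 1)) {C : ℝ}
    (hA : ∀ k, ‖A k‖ ≤ C * (k + 1)) {c : ℂ} (hc : c.re = 0) (hc0 : c ≠ 0) (Ψ : lp E 2)
    (h0 : ContinuousLinearMap.adjoint (A 0) (Ψ 1) = c • Ψ 0)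
    (hk : ∀ k, ContinuousLinearMap.adjoint (A (k + 1)) (Ψ (k + 2)) + A k (Ψ k) = c • Ψ (k + 1)) :
    Ψ = 0 := by
  have hsum : Summable fun k => ‖Ψ k‖ ^ 2 := by
    have := (lp.memℓp Ψ).summable (by norm_num)
    simpa using this
  have hdiag : ∀ k, (inner ℂ (Ψ k) (c • Ψ k) : ℂ).im = c.im * ‖Ψ k‖ ^ 2 := by
    intro k
    rw [inner_smul_right, inner_self_eq_norm_sq_to_K]
    simp [Complex.mul_im, hc, ← Complex.ofReal_pow]
  -- Pair the first `N + 1` eigenvalue equations with `Ψ k` and add the imaginary parts: the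
  -- off-diagonal terms cancel in pairs, and only the boundary term at `N` survives.
  have key : ∀ N, (inner ℂ (Ψ N) (ContinuousLinearMap.adjoint (A N) (Ψ (N + 1))) : ℂ).im
      = c.im * ∑ k ∈ Finset.range (N + 1), ‖Ψ k‖ ^ 2 := by
    intro N
    induction N with
    | zero => rw [h0, hdiag]; simp
    | succ N ih =>
      have h1 : ContinuousLinearMap.adjoint (A (N + 1)) (Ψ (N + 1 + 1))
          = c • Ψ (N + 1) - A N (Ψ N) := eq_sub_of_add_eq (hk N)
      rw [h1, inner_sub_right, Complex.sub_im, hdiag, Finset.sum_range_succ, mul_add, ← ih,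
        ← ContinuousLinearMap.adjoint_inner_left, ← inner_conj_symm (𝕜 := ℂ) (Ψ N),
        Complex.conj_im]
      ring
  have hcim : 0 < |c.im| := abs_pos.mpr fun h => hc0 (Complex.ext hc h)
  have hbound : ∀ N, |c.im| * ∑ k ∈ Finset.range (N + 1), ‖Ψ k‖ ^ 2
      ≤ C * (N + 1) * (‖Ψ N‖ ^ 2 + ‖Ψ (N + 1)‖ ^ 2) := by
    intro N
    have h1 : |(inner ℂ (Ψ N) (ContinuousLinearMap.adjoint (A N) (Ψ (N + 1))) : ℂ).im|
        ≤ ‖Ψ N‖ * (C * (N + 1) * ‖Ψ (N + 1)‖) :=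
      (Complex.abs_im_le_norm _).trans <| (norm_inner_le_norm _ _).trans <| by
        gcongr
        refine (ContinuousLinearMap.le_opNorm _ _).trans ?_
        gcongr
        rw [LinearIsometryEquiv.norm_map]
        exact hA N
    rw [key, abs_mul, abs_of_nonneg
      (a := ∑ k ∈ Finset.range (N + 1), ‖Ψ k‖ ^ 2) (Finset.sum_nonneg fun k _ => by positivity)] at h1
    refine h1.trans ?_
    have hC : 0 ≤ C * (N + 1) := (norm_nonneg _).trans (hA N)
    nlinarith [sq_nonneg (‖Ψ N‖ - ‖Ψ (N + 1)‖), sq_nonneg (‖Ψ N‖ + ‖Ψ (N + 1)‖)]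
  by_contra hne
  obtain ⟨K, hK⟩ : ∃ K, Ψ K ≠ 0 := by
    by_contra! h
    exact hne (lp.ext (funext h))
  have hC : 0 ≤ C := by
    have := (norm_nonneg _).trans (hA 0)
    simpa using this
  have hδ : 0 < |c.im| * ‖Ψ K‖ ^ 2 := by positivity
  -- Starting at `K`, where `Ψ K ≠ 0`, bounds the partial sums in `hbound` below by a positive
  -- constant.
  have hs : Summable fun N : ℕ => C * (‖Ψ (N + K)‖ ^ 2 + ‖Ψ (N + K + 1)‖ ^ 2) := by
    have h1 := (summable_nat_add_iff K).mpr hsum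
    have h2 := (summable_nat_add_iff (K + 1)).mpr hsum
    exact (h1.add h2).mul_left C
  -- Dividing `hbound` by its linear factor dominates a multiple of the harmonic series by a
  -- convergent series.
  have hs' : Summable fun N : ℕ => |c.im| * ‖Ψ K‖ ^ 2 * (1 / ((N + K + 1 : ℕ) : ℝ)) := by
    refine Summable.of_nonneg_of_le (fun N => by positivity) (fun N => ?_) hs
    rw [mul_one_div, div_le_iff₀ (by positivity)]
    have h1 : ‖Ψ K‖ ^ 2 ≤ ∑ k ∈ Finset.range (N + K + 1), ‖Ψ k‖ ^ 2 :=
      Finset.single_le_sum (f := fun k => ‖Ψ k‖ ^ 2) (fun k _ => by positivity)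
        (Finset.mem_range.mpr (by omega))
    have h2 := hbound (N + K)
    push_cast at h2 ⊢
    nlinarith
  rw [summable_mul_left_iff hδ.ne'] at hs'
  have := (summable_nat_add_iff (f := fun N : ℕ => 1 / (N : ℝ)) (K + 1)).mp
    (by simpa [add_assoc] using hs')
  exact Real.not_summable_one_div_natCast this

end Jacobi

end WarpedField
end

noncomputable section
namespace WarpedField

set_option linter.unusedSectionVars false

/-! ### Partial Fourier transforms of Schwartz functions -/

section Slice

variable {E F : Type*} [NormedAddCommGroup E] [InnerProductSpace ℝ E] [FiniteDimensional ℝ E]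
  [MeasurableSpace E] [BorelSpace E] [NormedAddCommGroup F] [NormedSpace ℝ F]

/-- The slice is `χ` composed with an affine map whose linear part has norm at most one. -/
theorem norm_iteratedFDeriv_slice_le (χ : 𝓢(F × E, ℂ)) (u : F) (l : ℕ) (y : E) :
    ‖iteratedFDeriv ℝ l (fun y => χ (u, y)) y‖ ≤ ‖iteratedFDeriv ℝ l χ (u, y)‖ := by
  have h1 : (fun y => χ (u, y))
      = (fun z => χ (z + (u, 0))) ∘ (ContinuousLinearMap.inr ℝ F E) := by
    ext y; simp
  have h2 : ContDiff ℝ l fun z : F × E => χ (z + (u, 0)) :=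
    (χ.smooth l).comp (contDiff_id.add contDiff_const)
  rw [h1, ContinuousLinearMap.iteratedFDeriv_comp_right _ h2 _ le_rfl,
    iteratedFDeriv_comp_add_right]
  refine (ContinuousMultilinearMap.norm_compContinuousLinearMap_le _ _).trans ?_
  have h3 : (ContinuousLinearMap.inr ℝ F E) y + (u, 0) = (u, y) := by simp
  rw [h3, Finset.prod_const]
  exact mul_le_of_le_one_right (norm_nonneg _)
    (pow_le_one₀ (norm_nonneg _) (ContinuousLinearMap.norm_inr_le_one ℝ F E))

/-- The Schwartz function `y ↦ χ(u, y)`. -/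
def slice (χ : 𝓢(F × E, ℂ)) (u : F) : 𝓢(E, ℂ) where
  toFun y := χ (u, y)
  smooth' := χ.smooth'.comp (contDiff_const.prodMk contDiff_id)
  decay' k l := by
    refine ⟨SchwartzMap.seminorm ℝ k l χ, fun y => ?_⟩
    refine le_trans ?_ (χ.le_seminorm ℝ k l (u, y))
    exact mul_le_mul (pow_le_pow_left₀ (norm_nonneg _) (norm_snd_le (u, y)) _)
      (norm_iteratedFDeriv_slice_le χ u l y) (norm_nonneg _) (by positivity)

theorem slice_apply (χ : 𝓢(F × E, ℂ)) (u : F) (y : E) : slice χ u y = χ (u, y) := rfl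

theorem seminorm_slice_le (χ : 𝓢(F × E, ℂ)) (u : F) (k l : ℕ) :
    SchwartzMap.seminorm ℝ k l (slice χ u) ≤ SchwartzMap.seminorm ℝ k l χ := by
  refine SchwartzMap.seminorm_le_bound ℝ k l _ (apply_nonneg _ _) fun y => ?_
  refine le_trans ?_ (χ.le_seminorm ℝ k l (u, y))
  exact mul_le_mul (pow_le_pow_left₀ (norm_nonneg _) (norm_snd_le (u, y)) _)
    (norm_iteratedFDeriv_slice_le χ u l y) (norm_nonneg _) (by positivity)

/-- The slices form a bounded family of Schwartz functions, and the Fourier transform is continuous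
on Schwartz space. Uniformity in `u` is what later provides a dominating function independent of
`ε`, `a` and `b`. -/
theorem exists_fourier_slice_bound (χ : 𝓢(F × E, ℂ)) (N : ℕ) :
    ∃ C, ∀ u v, (1 + ‖v‖) ^ N * ‖𝓕 (slice χ u) v‖ ≤ C := by
  let p : Seminorm ℝ 𝓢(E, ℂ) :=
    (Finset.Iic (N, 0)).sup fun m => SchwartzMap.seminorm (E := E) (F := ℂ) ℝ m.1 m.2
  have hp : Continuous p := Seminorm.continuous_finsetSup fun m _ =>
    (schwartz_withSeminorms ℝ E ℂ).continuous_seminorm m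
  let q : Seminorm ℝ 𝓢(E, ℂ) :=
    p.comp (SchwartzMap.fourierTransformCLM ℝ : 𝓢(E, ℂ) →L[ℝ] 𝓢(E, ℂ)).toLinearMap
  have hq : Continuous q :=
    hp.comp (SchwartzMap.fourierTransformCLM ℝ : 𝓢(E, ℂ) →L[ℝ] 𝓢(E, ℂ)).continuous
  obtain ⟨s, C, -, hs⟩ := Seminorm.bound_of_continuous (schwartz_withSeminorms ℝ E ℂ) q hq
  refine ⟨2 ^ N * (C * (s.sup fun m => SchwartzMap.seminorm ℝ m.1 m.2) χ), fun u v => ?_⟩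
  have h1 := SchwartzMap.one_add_le_sup_seminorm_apply (𝕜 := ℝ) (m := (N, 0)) le_rfl le_rfl
    (𝓕 (slice χ u)) v
  rw [norm_iteratedFDeriv_zero] at h1
  refine h1.trans ?_
  gcongr
  refine (hs (slice χ u)).trans ?_
  rw [_root_.smul_apply, NNReal.smul_def, smul_eq_mul]
  gcongr
  refine Seminorm.finset_sup_apply_le (apply_nonneg _ _) fun m hm => ?_
  refine (seminorm_slice_le χ u m.1 m.2).trans ?_
  exact (Finset.le_sup (f := fun m : ℕ × ℕ => SchwartzMap.seminorm (E := F × E) (F := ℂ) ℝ m.1 m.2)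
    hm) χ

theorem continuous_fourier_slice (χ : 𝓢(F × E, ℂ)) :
    Continuous fun p : F × E => 𝓕 (slice χ p.1) p.2 := by
  simp only [SchwartzMap.fourier_coe, Real.fourier_eq', slice_apply]
  obtain ⟨C, hC⟩ : ∃ C, ∀ z, (1 + ‖z‖) ^ (Module.finrank ℝ E + 1) * ‖χ z‖ ≤ C :=
    ⟨_, fun z => by
      simpa using SchwartzMap.one_add_le_sup_seminorm_apply (𝕜 := ℝ)
        (m := (Module.finrank ℝ E + 1, 0)) (k := Module.finrank ℝ E + 1) (n := 0) le_rfl le_rfl χ z⟩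
  have hint : Integrable (fun y : E => C * (1 + ‖y‖) ^ (-((Module.finrank ℝ E : ℝ) + 1))) :=
    (integrable_one_add_norm (by simp)).const_mul C
  have hχ := χ.continuous
  refine continuous_of_dominated (fun p => ?_) (fun p => ae_of_all _ fun y => ?_) hint
    (ae_of_all _ fun y => ?_)
  · exact Continuous.aestronglyMeasurable (by fun_prop)
  · rw [norm_smul, Complex.norm_exp_ofReal_mul_I, one_mul, Real.rpow_neg (by positivity),
      ← div_eq_mul_inv, le_div_iff₀ (by positivity), mul_comm]
    refine le_trans ?_ (hC (p.1, y))
    rw [← Nat.cast_succ, Real.rpow_natCast]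
    gcongr
    exact norm_snd_le (p.1, y)
  · fun_prop

end Slice

/-! ### The oscillatory integral of a plane wave -/

section Oscillatory

variable {n : ℕ}

/-- The reflection `(y⁰, 𝐲) ↦ (y⁰, -𝐲)`. -/
def spaceReflection (n : ℕ) : Spacetime n ≃ₗᵢ[ℝ] Spacetime n :=
  LinearIsometryEquiv.piLpCongrRight 2 fun i =>
    Fin.cases (LinearIsometryEquiv.refl ℝ ℝ) (fun _ => LinearIsometryEquiv.neg ℝ) i

theorem spaceReflection_zero (y : Spacetime n) : spaceReflection n y 0 = y 0 := rfl

theorem spaceReflection_succ (y : Spacetime n) (i : Fin n) :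
    spaceReflection n y i.succ = -y i.succ := rfl

theorem mink_eq_inner (x y : Spacetime n) : mink x y = inner ℝ x (spaceReflection n y) := by
  simp only [mink, PiLp.inner_apply, Fin.sum_univ_succ, spaceReflection_zero,
    spaceReflection_succ]
  simp [mul_comm, Finset.sum_neg_distrib, sub_eq_add_neg]

theorem spaceReflection_spaceReflection (y : Spacetime n) :
    spaceReflection n (spaceReflection n y) = y := by
  ext i
  refine Fin.cases ?_ (fun j => ?_) i
  · rfl
  · simp [spaceReflection_succ]

theorem mink_spaceReflection (x y : Spacetime n) : mink x (spaceReflection n y) = inner ℝ x y := by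
  rw [mink_eq_inner, spaceReflection_spaceReflection]

theorem mink_comm (x y : Spacetime n) : mink x y = mink y x := by
  simp [mink, mul_comm]

theorem mink_add_left (x x' y : Spacetime n) : mink (x + x') y = mink x y + mink x' y := by
  simp [mink_eq_inner, inner_add_left]

theorem mink_add_right (x y y' : Spacetime n) : mink x (y + y') = mink x y + mink x y' := by
  simp [mink_eq_inner, inner_add_right]

theorem mink_smul_right (c : ℝ) (x y : Spacetime n) : mink x (c • y) = c * mink x y := by
  simp [mink_eq_inner, inner_smul_right]

theorem mink_neg_left (x y : Spacetime n) : mink (-x) y = -mink x y := by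
  simp [mink_eq_inner]

theorem mink_neg_right (x y : Spacetime n) : mink x (-y) = -mink x y := by
  simp [mink_eq_inner]

theorem mink_zero_right (x : Spacetime n) : mink x 0 = 0 := by simp [mink_eq_inner]

theorem continuous_mink : Continuous fun z : Spacetime n × Spacetime n => mink z.1 z.2 := by
  simp only [mink_eq_inner]; fun_prop

/-- The kernel `e^{-i x·y} χ(εx, εy)`. -/
def oscKernel (χ : 𝓢(Spacetime n × Spacetime n, ℂ)) (ε : ℝ) (z : Spacetime n × Spacetime n) : ℂ :=
  Complex.exp (-(Complex.I * (mink z.1 z.2 : ℝ))) * χ (ε • z)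

/-- The character `e^{i (x·a + y·b)}`. -/
def planeWave (a b : Spacetime n) (z : Spacetime n × Spacetime n) : ℂ :=
  Complex.exp (Complex.I * (mink z.1 a + mink z.2 b : ℝ))

theorem norm_planeWave (a b : Spacetime n) (z : Spacetime n × Spacetime n) :
    ‖planeWave a b z‖ = 1 := by
  rw [planeWave, mul_comm, Complex.norm_exp_ofReal_mul_I]

theorem norm_oscKernel (χ : 𝓢(Spacetime n × Spacetime n, ℂ)) (ε : ℝ)
    (z : Spacetime n × Spacetime n) : ‖oscKernel χ ε z‖ = ‖χ (ε • z)‖ := by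
  rw [oscKernel, norm_mul, ← mul_neg, ← Complex.ofReal_neg, mul_comm Complex.I,
    Complex.norm_exp_ofReal_mul_I, one_mul]

theorem continuous_planeWave :
    Continuous fun w : (Spacetime n × Spacetime n) × (Spacetime n × Spacetime n) =>
      planeWave w.1.1 w.1.2 w.2 := by
  unfold planeWave
  simp only [mink_eq_inner]
  fun_prop

theorem continuous_oscKernel (χ : 𝓢(Spacetime n × Spacetime n, ℂ)) (ε : ℝ) :
    Continuous (oscKernel χ ε) := by
  have := continuous_mink (n := n)
  have := χ.continuous
  unfold oscKernel
  fun_prop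

theorem integrable_schwartz_prod (χ : 𝓢(Spacetime n × Spacetime n, ℂ)) :
    Integrable χ (volume.prod volume) := by
  have h : (volume.prod volume : Measure (Spacetime n × Spacetime n)).IsAddHaarMeasure :=
    inferInstance
  have h2 : (volume.prod volume : Measure (Spacetime n × Spacetime n)).HasTemperateGrowth :=
    Measure.IsAddHaarMeasure.instHasTemperateGrowth (h := h)
  have h3 := SchwartzMap.integrable (μ := volume.prod volume) (hμ := h2) χ
  exact h3

theorem integrable_oscKernel (χ : 𝓢(Spacetime n × Spacetime n, ℂ)) {ε : ℝ} (hε : 0 < ε) :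
    Integrable (oscKernel χ ε) := by
  refine Integrable.mono (g := fun z => χ (ε • z)) ?_
    (continuous_oscKernel χ ε).aestronglyMeasurable (ae_of_all _ fun z => ?_)
  · rw [Measure.volume_eq_prod]
    exact (integrable_schwartz_prod χ).comp_smul hε.ne'
  · rw [norm_oscKernel]

theorem integrable_oscKernel_mul_planeWave (χ : 𝓢(Spacetime n × Spacetime n, ℂ)) {ε : ℝ}
    (hε : 0 < ε) (a b : Spacetime n) :
    Integrable fun z => oscKernel χ ε z * planeWave a b z := by
  refine Integrable.mono (integrable_oscKernel χ hε)
    ((continuous_oscKernel χ ε).mul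
      (continuous_planeWave.comp (Continuous.prodMk_right (a, b)))).aestronglyMeasurable
    (ae_of_all _ fun z => ?_)
  rw [norm_mul, norm_planeWave, mul_one]

/-- The regularized oscillatory integral of a plane wave. -/
def oscIntegral (χ : 𝓢(Spacetime n × Spacetime n, ℂ)) (ε : ℝ) (a b : Spacetime n) : ℂ :=
  (((2 * Real.pi) ^ (n + 1))⁻¹ : ℂ) * ∫ z, oscKernel χ ε z * planeWave a b z

/-- At `x = b + 2πε R w`, with `R` the spatial reflection, the phase `e^{i(y·b - x·y)}` becomes
`e^{-2πi ⟨εy, w⟩}`. Rescaling `y` by `ε` produces a Fourier transform in the second variable of `χ`.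
-/
theorem inner_oscIntegral (χ : 𝓢(Spacetime n × Spacetime n, ℂ)) {ε : ℝ} (hε : 0 < ε)
    (a b w : Spacetime n) :
    ∫ y, oscKernel χ ε (b + (2 * Real.pi * ε) • spaceReflection n w, y)
        * planeWave a b (b + (2 * Real.pi * ε) • spaceReflection n w, y)
      = ((ε ^ (n + 1))⁻¹ : ℝ) •
        (Complex.exp (Complex.I * (mink (b + (2 * Real.pi * ε) • spaceReflection n w) a : ℝ))
        * 𝓕 (slice χ (ε • (b + (2 * Real.pi * ε) • spaceReflection n w))) w) := by
  rw [SchwartzMap.fourier_coe, Real.fourier_eq', ← integral_const_mul]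
  have h := Measure.integral_comp_smul_of_nonneg (volume : Measure (Spacetime n))
    (fun y => Complex.exp (Complex.I * (mink (b + (2 * Real.pi * ε) • spaceReflection n w) a : ℝ)) *
      (Complex.exp (((-2 * Real.pi * inner ℝ y w : ℝ) : ℂ) * Complex.I) •
        slice χ (ε • (b + (2 * Real.pi * ε) • spaceReflection n w)) y)) ε (hR := hε.le)
  rw [finrank_euclideanSpace_fin] at h
  rw [← h]
  congr 1 with y
  rw [oscKernel, planeWave, slice_apply, smul_eq_mul]
  have e1 : mink (b + (2 * Real.pi * ε) • spaceReflection n w) y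
      = mink y b + 2 * Real.pi * ε * inner ℝ y w := by
    rw [mink_comm, mink_add_right, mink_smul_right, mink_spaceReflection]
  rw [e1, inner_smul_left]
  have e2 : ∀ A B : ℝ, Complex.exp (-(Complex.I * ((B + 2 * Real.pi * ε * inner ℝ y w : ℝ) : ℂ)))
      * Complex.exp (Complex.I * ((A + B : ℝ) : ℂ))
      = Complex.exp (Complex.I * (A : ℝ))
        * Complex.exp (((-2 * Real.pi * (starRingEnd ℝ ε * inner ℝ y w) : ℝ) : ℂ) * Complex.I) := by
    intro A B
    rw [← Complex.exp_add, ← Complex.exp_add]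
    congr 1
    simp only [conj_trivial]
    push_cast
    ring
  rw [← mul_assoc, ← e2 _ (mink y b), Prod.smul_mk]
  ring

theorem oscIntegral_eq (χ : 𝓢(Spacetime n × Spacetime n, ℂ)) {ε : ℝ} (hε : 0 < ε)
    (a b : Spacetime n) :
    oscIntegral χ ε a b = ∫ w,
      Complex.exp (Complex.I * (mink (b + (2 * Real.pi * ε) • spaceReflection n w) a : ℝ))
        * 𝓕 (slice χ (ε • (b + (2 * Real.pi * ε) • spaceReflection n w))) w := by
  have hc : 0 ≤ 2 * Real.pi * ε := by positivity
  have hi := integrable_oscKernel_mul_planeWave χ hε a b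
  rw [Measure.volume_eq_prod] at hi
  rw [oscIntegral, Measure.volume_eq_prod, integral_prod _ hi]
  set G : Spacetime n → ℂ := fun x => ∫ y, oscKernel χ ε (x, y) * planeWave a b (x, y) with hG
  -- The Jacobian `(2πε)^d` cancels both the `ε^{-d}` from the integral over `y` and the prefactor
  -- `(2π)^{-d}`.
  have h1 : ∫ x, G x = ((2 * Real.pi * ε) ^ (n + 1) : ℝ) •
      ∫ w, G (b + (2 * Real.pi * ε) • spaceReflection n w) := by
    rw [(spaceReflection n).measurePreserving.integral_comp
      (spaceReflection n).toHomeomorph.measurableEmbedding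
      (fun w => G (b + (2 * Real.pi * ε) • w)),
      Measure.integral_comp_smul_of_nonneg volume (fun w => G (b + w)) _ (hR := hc),
      finrank_euclideanSpace_fin, integral_add_left_eq_self, smul_smul, mul_inv_cancel₀, one_smul]
    positivity
  rw [h1]
  simp only [hG, inner_oscIntegral χ hε]
  rw [integral_smul, smul_smul, mul_pow _ ε, mul_assoc (_ ^ _), mul_inv_cancel₀ (by positivity), mul_one,
    Complex.real_smul, ← mul_assoc]
  push_cast
  rw [inv_mul_cancel₀, one_mul]
  have : (Real.pi : ℂ) ≠ 0 := by exact_mod_cast Real.pi_ne_zero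
  exact pow_ne_zero _ (mul_ne_zero two_ne_zero this)

theorem exists_oscIntegral_bound (χ : 𝓢(Spacetime n × Spacetime n, ℂ)) :
    ∃ C, ∀ ε, 0 < ε → ∀ a b, ‖oscIntegral χ ε a b‖ ≤ C := by
  obtain ⟨C, hC⟩ := exists_fourier_slice_bound χ (n + 2)
  have hint : Integrable (fun y : Spacetime n => C * (1 + ‖y‖) ^ (-((n : ℝ) + 2))) :=
    (integrable_one_add_norm (by simp)).const_mul C
  refine ⟨∫ w : Spacetime n, C * (1 + ‖w‖) ^ (-((n : ℝ) + 2)), fun ε hε a b => ?_⟩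
  rw [oscIntegral_eq χ hε]
  refine norm_integral_le_of_norm_le hint (ae_of_all _ fun w => ?_)
  rw [norm_mul, mul_comm Complex.I, Complex.norm_exp_ofReal_mul_I, one_mul,
    Real.rpow_neg (by positivity), ← div_eq_mul_inv, le_div_iff₀ (by positivity), mul_comm,
    show (n : ℝ) + 2 = ((n + 2 : ℕ) : ℝ) by push_cast; rfl, Real.rpow_natCast]
  exact hC _ w

/-- After the substitution `ε` sits only inside continuous functions; at `ε = 0` the integral over
`w` is Fourier inversion of `χ(0, ·)` at the origin. -/
theorem tendsto_oscIntegral (χ : 𝓢(Spacetime n × Spacetime n, ℂ)) (a b : Spacetime n) :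
    Tendsto (fun ε => oscIntegral χ ε a b) (𝓝[>] 0)
      (𝓝 (Complex.exp (Complex.I * (mink a b : ℝ)) * χ 0)) := by
  obtain ⟨C, hC⟩ := exists_fourier_slice_bound χ (n + 2)
  have hint : Integrable (fun y : Spacetime n => C * (1 + ‖y‖) ^ (-((n : ℝ) + 2))) :=
    (integrable_one_add_norm (by simp)).const_mul C
  have hlim : Complex.exp (Complex.I * (mink a b : ℝ)) * χ 0
      = ∫ w, Complex.exp (Complex.I * (mink b a : ℝ)) * 𝓕 (slice χ 0) w := by
    rw [integral_const_mul, mink_comm]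
    congr 1
    have h1 : 𝓕⁻ (𝓕 (slice χ 0)) = slice χ 0 := FourierTransform.fourierInv_fourier_eq _
    have h2 : slice χ 0 0 = χ 0 := rfl
    rw [← h2]
    nth_rw 1 [← h1]
    rw [SchwartzMap.fourierInv_coe, Real.fourierInv_eq']
    simp
  -- The rewritten integrand makes sense for all real `ε` and is jointly continuous, so the limit is
  -- its value at `ε = 0`.
  obtain ⟨H, hH⟩ : ∃ H : ℝ × Spacetime n → ℂ, ∀ p, H p =
      Complex.exp (Complex.I * (mink (b + (2 * Real.pi * p.1) • spaceReflection n p.2) a : ℝ))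
      * 𝓕 (slice χ (p.1 • (b + (2 * Real.pi * p.1) • spaceReflection n p.2))) p.2 :=
    ⟨_, fun _ => rfl⟩
  have hcont : Continuous H := by
    rw [funext hH]
    refine Continuous.mul ?_ ((continuous_fourier_slice χ).comp
      (f := fun p : ℝ × Spacetime n =>
        (p.1 • (b + (2 * Real.pi * p.1) • spaceReflection n p.2), p.2)) (by fun_prop))
    simp only [mink_eq_inner]
    fun_prop
  have hbound : ∀ ε w, ‖H (ε, w)‖ ≤ C * (1 + ‖w‖) ^ (-((n : ℝ) + 2)) := by
    intro ε w
    rw [hH, norm_mul, mul_comm Complex.I, Complex.norm_exp_ofReal_mul_I, one_mul,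
      Real.rpow_neg (by positivity), ← div_eq_mul_inv, le_div_iff₀ (by positivity), mul_comm,
      show (n : ℝ) + 2 = ((n + 2 : ℕ) : ℝ) by push_cast; rfl, Real.rpow_natCast]
    exact hC _ w
  have h0 : ∀ w, H (0, w) = Complex.exp (Complex.I * (mink b a : ℝ)) * 𝓕 (slice χ 0) w := by
    intro w; rw [hH]; simp
  rw [hlim, ← funext h0]
  refine Tendsto.congr' (f₁ := fun ε => ∫ w, H (ε, w)) ?_ ?_
  · filter_upwards [self_mem_nhdsWithin] with ε hε
    rw [oscIntegral_eq χ hε]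
    simp only [hH]
  refine tendsto_integral_filter_of_dominated_convergence _ ?_
    (Eventually.of_forall fun ε => ae_of_all _ (hbound ε)) hint (ae_of_all _ fun w => ?_)
  · exact Eventually.of_forall fun ε =>
      (hcont.comp (Continuous.prodMk_right ε)).aestronglyMeasurable
  · exact ((hcont.comp (Continuous.prodMk_left w)).tendsto 0).mono_left
      (nhdsWithin_le_nhds (s := Set.Ioi 0))

end Oscillatory

end WarpedField
end

noncomputable section
namespace WarpedField

set_option linter.unusedSectionVars false

/-! ### Multiplication operators on `L²` -/

section Multiplication

variable {Y : Type*} [MeasurableSpace Y] {ρ : Measure Y}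

/-- Bounded measurable functions. -/
def IsMultiplier (c : Y → ℂ) : Prop := Measurable c ∧ ∃ C, ∀ w, ‖c w‖ ≤ C

theorem IsMultiplier.of_norm_eq_one {c : Y → ℂ} (hm : Measurable c) (h : ∀ w, ‖c w‖ = 1) :
    IsMultiplier c := ⟨hm, 1, fun w => (h w).le⟩

theorem IsMultiplier.mul {c c' : Y → ℂ} (h : IsMultiplier c) (h' : IsMultiplier c') :
    IsMultiplier fun w => c w * c' w := by
  obtain ⟨hm, C, hC⟩ := h
  obtain ⟨hm', C', hC'⟩ := h'
  refine ⟨hm.mul hm', C * C', fun w => ?_⟩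
  rw [norm_mul]
  exact mul_le_mul (hC w) (hC' w) (norm_nonneg _) ((norm_nonneg _).trans (hC w))

theorem IsMultiplier.conj {c : Y → ℂ} (h : IsMultiplier c) :
    IsMultiplier fun w => starRingEnd ℂ (c w) :=
  ⟨Complex.continuous_conj.measurable.comp h.1, h.2.imp fun C hC w => by
    rw [RCLike.norm_conj]; exact hC w⟩

theorem IsMultiplier.comp {Z : Type*} [MeasurableSpace Z] {c : Y → ℂ} (h : IsMultiplier c)
    {ψ : Z → Y} (hψ : Measurable ψ) : IsMultiplier fun z => c (ψ z) :=
  ⟨h.1.comp hψ, h.2.imp fun _ hC z => hC (ψ z)⟩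

theorem memLp_multiplier {c : Y → ℂ} {C : ℝ} (hm : Measurable c) (hC : ∀ w, ‖c w‖ ≤ C)
    (F : Lp ℂ 2 ρ) : MemLp (fun w => c w * F w) 2 ρ :=
  (Lp.memLp F).of_le_mul (hm.aestronglyMeasurable.mul (Lp.aestronglyMeasurable F))
    (c := C) (ae_of_all _ fun w => by
      rw [norm_mul]; exact mul_le_mul_of_nonneg_right (hC w) (norm_nonneg _))

open Classical in
/-- Multiplication with a bounded measurable function on `L²`. -/
def mulOp (c : Y → ℂ) : Lp ℂ 2 ρ →L[ℂ] Lp ℂ 2 ρ :=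
  if h : IsMultiplier c then
    LinearMap.mkContinuous
      { toFun := fun F => (memLp_multiplier h.1 h.2.choose_spec F).toLp
        map_add' := fun F G => by
          rw [← MemLp.toLp_add]
          refine MemLp.toLp_congr _ _ ?_
          filter_upwards [Lp.coeFn_add F G] with z hz
          change c z * (F + G : Lp ℂ 2 ρ) z = c z * F z + c z * G z
          rw [hz, Pi.add_apply, mul_add]
        map_smul' := fun c F => by
          rw [RingHom.id_apply, ← MemLp.toLp_const_smul]
          refine MemLp.toLp_congr _ _ ?_
          filter_upwards [Lp.coeFn_smul c F] with z hz
          simp [hz, mul_left_comm] }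
      h.2.choose fun F => by
        refine Lp.norm_le_mul_norm_of_ae_le_mul ?_
        filter_upwards [MemLp.coeFn_toLp (memLp_multiplier h.1 h.2.choose_spec F)] with w hw
        change ‖((memLp_multiplier h.1 h.2.choose_spec F).toLp : Lp ℂ 2 ρ) w‖ ≤ _
        rw [hw, norm_mul]
        exact mul_le_mul_of_nonneg_right (h.2.choose_spec w) (norm_nonneg _)
  else 0

theorem coeFn_mulOp {c : Y → ℂ} (h : IsMultiplier c) (F : Lp ℂ 2 ρ) :
    mulOp c F =ᵐ[ρ] fun w => c w * F w := by
  rw [mulOp, dif_pos h]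
  exact MemLp.coeFn_toLp (memLp_multiplier h.1 h.2.choose_spec F)

theorem mulOp_mulOp {c c' : Y → ℂ} (h : IsMultiplier c) (h' : IsMultiplier c') (F : Lp ℂ 2 ρ) :
    mulOp c (mulOp c' F) = mulOp (fun w => c w * c' w) F := by
  refine Lp.ext ?_
  filter_upwards [coeFn_mulOp h (mulOp c' F), coeFn_mulOp h' F, coeFn_mulOp (h.mul h') F]
    with w h1 h2 h3
  rw [h1, h2, h3, mul_assoc]

theorem mulOp_one (F : Lp ℂ 2 ρ) : mulOp (fun _ => 1) F = F := by
  refine Lp.ext ?_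
  filter_upwards [coeFn_mulOp (.of_norm_eq_one measurable_const fun _ => norm_one) F] with w h1
  rw [h1, one_mul]

theorem inner_mulOp_left {c : Y → ℂ} (h : IsMultiplier c) (F G : Lp ℂ 2 ρ) :
    inner ℂ (mulOp c F) G = inner ℂ F (mulOp (fun w => starRingEnd ℂ (c w)) G) := by
  rw [L2.inner_def, L2.inner_def]
  refine integral_congr_ae ?_
  filter_upwards [coeFn_mulOp h F, coeFn_mulOp h.conj G] with w h1 h2
  rw [h1, h2]
  simp only [RCLike.inner_apply, map_mul]
  ring

theorem norm_mulOp_le {c : Y → ℂ} (hm : Measurable c) {C : ℝ} (hC : ∀ w, ‖c w‖ ≤ C)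
    (F : Lp ℂ 2 ρ) : ‖mulOp c F‖ ≤ C * ‖F‖ := by
  refine Lp.norm_le_mul_norm_of_ae_le_mul ?_
  filter_upwards [coeFn_mulOp ⟨hm, C, hC⟩ F] with w h1
  rw [h1, norm_mul]
  exact mul_le_mul_of_nonneg_right (hC w) (norm_nonneg _)

/-- Dominated convergence for the square of the `L²` distance, with majorant `(2C|F|)²`. The
hypotheses are only eventual because the bound for the regularized integrals holds for `ε > 0`
alone. -/
theorem tendsto_mulOp {ι : Type*} {l : Filter ι} [l.IsCountablyGenerated] {c : ι → Y → ℂ}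
    {c₀ : Y → ℂ} {C : ℝ} (hm : ∀ᶠ i in l, Measurable (c i)) (hC : ∀ᶠ i in l, ∀ w, ‖c i w‖ ≤ C)
    (hm₀ : Measurable c₀) (hC₀ : ∀ w, ‖c₀ w‖ ≤ C)
    (hlim : ∀ w, Tendsto (fun i => c i w) l (𝓝 (c₀ w))) (F : Lp ℂ 2 ρ) :
    Tendsto (fun i => mulOp (c i) F) l (𝓝 (mulOp c₀ F)) := by
  rw [Lp.tendsto_Lp_iff_tendsto_eLpNorm']
  simp only [eLpNorm_eq_lintegral_rpow_enorm_toReal (p := 2) (by norm_num) (by norm_num)]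
  have hdiff : ∀ᶠ i in l, ∫⁻ w, ‖(mulOp (c i) F) w - (mulOp c₀ F) w‖ₑ ^ (2 : ℝ≥0∞).toReal ∂ρ
      = ∫⁻ w, ‖(c i w - c₀ w) * F w‖ₑ ^ (2 : ℝ≥0∞).toReal ∂ρ := by
    filter_upwards [hm, hC] with i hi hCi
    refine lintegral_congr_ae ?_
    filter_upwards [coeFn_mulOp ⟨hi, C, hCi⟩ F, coeFn_mulOp ⟨hm₀, C, hC₀⟩ F] with w h2 h3
    rw [h2, h3, sub_mul]
  have hF : ∫⁻ w, (‖(2 * C : ℝ)‖ₑ * ‖F w‖ₑ) ^ (2 : ℝ≥0∞).toReal ∂ρ ≠ ∞ := by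
    simp only [ENNReal.mul_rpow_of_nonneg _ _ ENNReal.toReal_nonneg]
    rw [lintegral_const_mul' _ _ (by finiteness)]
    have h1 := Lp.eLpNorm_lt_top F
    rw [eLpNorm_lt_top_iff_lintegral_rpow_enorm_lt_top (by norm_num) (by norm_num)] at h1
    exact ENNReal.mul_ne_top (by finiteness) h1.ne
  have hlim2 : Tendsto (fun i => ∫⁻ w, ‖(c i w - c₀ w) * F w‖ₑ ^ (2 : ℝ≥0∞).toReal ∂ρ) l
      (𝓝 (∫⁻ _, 0 ∂ρ)) := by
    refine tendsto_lintegral_filter_of_dominated_convergence' _ ?_ ?_ hF ?_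
    · filter_upwards [hm] with i hi
      exact (((hi.sub hm₀).aemeasurable.mul
        (Lp.aestronglyMeasurable F).aemeasurable).enorm.pow_const _)
    · filter_upwards [hC] with i hi
      refine ae_of_all _ fun w => ?_
      rw [enorm_mul]
      gcongr
      rw [enorm_le_iff_norm_le]
      refine (norm_sub_le _ _).trans ?_
      rw [Real.norm_of_nonneg (by linarith [(norm_nonneg _).trans (hi w)])]
      linarith [hi w, hC₀ w]
    · refine ae_of_all _ fun w => ?_
      have h1 : Tendsto (fun i => ‖(c i w - c₀ w) * F w‖ₑ ^ (2 : ℝ≥0∞).toReal) l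
          (𝓝 (‖(c₀ w - c₀ w) * F w‖ₑ ^ (2 : ℝ≥0∞).toReal)) :=
        ((((hlim w).sub_const _).mul_const _).enorm).ennrpow_const _
      simpa using h1
  rw [lintegral_zero] at hlim2
  have h2 := (hlim2.congr' (hdiff.mono fun i hi => hi.symm)).ennrpow_const (1 / (2 : ℝ≥0∞).toReal)
  simpa using h2

end Multiplication

/-! ### Oscillatory integrals of multiplication operators -/

section OscillatoryMultiplication

variable {n : ℕ} {Y : Type*} [MeasurableSpace Y] {ρ : Measure Y} [SFinite ρ]
  {a b : Y → Spacetime n}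

theorem isMultiplier_planeWave (ha : Measurable a) (hb : Measurable b)
    (z : Spacetime n × Spacetime n) : IsMultiplier fun w => planeWave (a w) (b w) z := by
  refine .of_norm_eq_one ?_ fun w => norm_planeWave _ _ _
  exact continuous_planeWave.measurable.comp ((ha.prodMk hb).prodMk measurable_const)

theorem isMultiplier_exp_mink (ha : Measurable a) (hb : Measurable b) :
    IsMultiplier fun w => Complex.exp (Complex.I * (mink (a w) (b w) : ℝ)) := by
  refine .of_norm_eq_one ?_ fun w => by rw [mul_comm, Complex.norm_exp_ofReal_mul_I]
  have h1 : Continuous fun z : Spacetime n × Spacetime n =>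
      Complex.exp (Complex.I * (mink z.1 z.2 : ℝ)) := by
    have := continuous_mink (n := n)
    fun_prop
  exact h1.measurable.comp (ha.prodMk hb)

/-- Strong continuity supplies the measurability needed for the Bochner integral of `L²`-valued
functions. -/
theorem continuous_mulOp_planeWave (ha : Measurable a) (hb : Measurable b) (F : Lp ℂ 2 ρ) :
    Continuous fun z => mulOp (fun w => planeWave (a w) (b w) z) F := by
  refine continuous_iff_continuousAt.mpr fun z₀ => ?_
  refine tendsto_mulOp (C := 1) (Eventually.of_forall fun z => (isMultiplier_planeWave ha hb z).1)
    (Eventually.of_forall fun z w => (norm_planeWave _ _ _).le) (isMultiplier_planeWave ha hb z₀).1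
    (fun w => (norm_planeWave _ _ _).le) (fun w => ?_) F
  exact (continuous_planeWave.comp (Continuous.prodMk_right (a w, b w))).tendsto z₀

theorem integrable_oscKernel_smul_mulOp (χ : 𝓢(Spacetime n × Spacetime n, ℂ)) {ε : ℝ}
    (hε : 0 < ε) (ha : Measurable a) (hb : Measurable b) (F : Lp ℂ 2 ρ) :
    Integrable fun z => oscKernel χ ε z • mulOp (fun w => planeWave (a w) (b w) z) F := by
  refine Integrable.mono' ((integrable_oscKernel χ hε).norm.mul_const ‖F‖)
    ((continuous_oscKernel χ ε).smul (continuous_mulOp_planeWave ha hb F)).aestronglyMeasurable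
    (ae_of_all _ fun z => ?_)
  rw [norm_smul]
  gcongr
  simpa using norm_mulOp_le (isMultiplier_planeWave ha hb z).1
    (fun w => (norm_planeWave (a w) (b w) z).le) F

theorem measurable_integral_mul {Z : Type*} [MeasurableSpace Z] {ν : Measure Z} [SFinite ν]
    {k : Z → ℂ} {e : Y → Z → ℂ} (hk : Measurable k) (he : Measurable (Function.uncurry e)) :
    Measurable fun w => ∫ z, k z * e w z ∂ν := by
  have h1 : Measurable (Function.uncurry fun w z => k z * e w z) :=
    (hk.comp measurable_snd).mul he
  exact (h1.stronglyMeasurable.integral_prod_right (ν := ν)).measurable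

theorem measurable_uncurry_planeWave (ha : Measurable a) (hb : Measurable b) :
    Measurable (Function.uncurry fun (w : Y) (z : Spacetime n × Spacetime n) =>
      planeWave (a w) (b w) z) := by
  have h0 : Measurable fun q : Y × (Spacetime n × Spacetime n) => ((a q.1, b q.1), q.2) :=
    ((ha.comp measurable_fst).prodMk (hb.comp measurable_fst)).prodMk measurable_snd
  have h1 := (continuous_planeWave (n := n)).measurable
  have h2 := h1.comp h0
  exact h2

theorem measurable_oscIntegral (χ : 𝓢(Spacetime n × Spacetime n, ℂ)) (ε : ℝ)
    (ha : Measurable a) (hb : Measurable b) :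
    Measurable fun w => oscIntegral χ ε (a w) (b w) := by
  have h1 : Measurable fun w => ∫ z, oscKernel χ ε z * planeWave (a w) (b w) z :=
    measurable_integral_mul (ν := volume) (k := oscKernel χ ε)
      (e := fun w z => planeWave (a w) (b w) z) (continuous_oscKernel χ ε).measurable
      (measurable_uncurry_planeWave ha hb)
  unfold oscIntegral
  exact h1.const_mul _

/-- Paired with a vector `G`, the Bochner integral becomes a double integral of scalars. Fubini
applies because the kernel and `F conj G` are integrable and the plane wave is unimodular. -/
theorem integral_oscKernel_smul_mulOp (χ : 𝓢(Spacetime n × Spacetime n, ℂ)) {ε : ℝ}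
    (hε : 0 < ε) (ha : Measurable a) (hb : Measurable b) (F : Lp ℂ 2 ρ) :
    (((2 * Real.pi) ^ (n + 1))⁻¹ : ℂ) •
        ∫ z, oscKernel χ ε z • mulOp (fun w => planeWave (a w) (b w) z) F
      = mulOp (fun w => oscIntegral χ ε (a w) (b w)) F := by
  obtain ⟨C, hC⟩ := exists_oscIntegral_bound χ
  have hmult : IsMultiplier fun w => oscIntegral χ ε (a w) (b w) :=
    ⟨measurable_oscIntegral χ ε ha hb, C, fun w => hC ε hε _ _⟩
  refine ext_inner_left ℂ fun G => ?_
  rw [inner_smul_right, ← integral_inner (integrable_oscKernel_smul_mulOp χ hε ha hb F)]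
  have h1 : ∀ z, inner ℂ G (oscKernel χ ε z • mulOp (fun w => planeWave (a w) (b w) z) F)
      = ∫ w, oscKernel χ ε z * (planeWave (a w) (b w) z * (F w * starRingEnd ℂ (G w))) ∂ρ := by
    intro z
    rw [inner_smul_right, L2.inner_def, ← integral_const_mul]
    refine integral_congr_ae ?_
    filter_upwards [coeFn_mulOp (isMultiplier_planeWave ha hb z) F] with w hw
    rw [hw, RCLike.inner_apply]
    ring
  have hFG : Integrable (fun w => F w * starRingEnd ℂ (G w)) ρ := by
    have := L2.integrable_inner (𝕜 := ℂ) G F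
    simpa only [RCLike.inner_apply] using this
  have hint : Integrable (Function.uncurry fun (z : Spacetime n × Spacetime n) w =>
      oscKernel χ ε z * (planeWave (a w) (b w) z * (F w * starRingEnd ℂ (G w))))
      (volume.prod ρ) := by
    refine Integrable.mono ((integrable_oscKernel χ hε).mul_prod hFG) ?_
      (ae_of_all _ fun q => ?_)
    · refine AEStronglyMeasurable.mul
        (((continuous_oscKernel χ ε).measurable.comp measurable_fst).aestronglyMeasurable)
        (AEStronglyMeasurable.mul ?_ hFG.aestronglyMeasurable.comp_snd)
      exact (continuous_planeWave.measurable.comp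
        (((ha.comp measurable_snd).prodMk (hb.comp measurable_snd)).prodMk
          measurable_fst)).aestronglyMeasurable
    · simp only [Function.uncurry, norm_mul, norm_planeWave, one_mul]
      exact le_rfl
  simp only [h1]
  rw [integral_integral_swap hint, L2.inner_def, ← integral_const_mul]
  refine integral_congr_ae ?_
  filter_upwards [coeFn_mulOp hmult F] with w hw
  rw [hw, RCLike.inner_apply, oscIntegral, mul_assoc, mul_assoc, ← integral_mul_const]
  congr 2 with z
  ring

theorem tendsto_integral_oscKernel_smul_mulOp {χ : 𝓢(Spacetime n × Spacetime n, ℂ)} (hχ : χ 0 = 1)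
    (ha : Measurable a) (hb : Measurable b) (F : Lp ℂ 2 ρ) :
    Tendsto (fun ε : ℝ => (((2 * Real.pi) ^ (n + 1))⁻¹ : ℂ) •
        ∫ z, oscKernel χ ε z • mulOp (fun w => planeWave (a w) (b w) z) F) (𝓝[>] 0)
      (𝓝 (mulOp (fun w => Complex.exp (Complex.I * (mink (a w) (b w) : ℝ))) F)) := by
  obtain ⟨C, hC⟩ := exists_oscIntegral_bound χ
  refine Tendsto.congr' (f₁ := fun ε => mulOp (fun w => oscIntegral χ ε (a w) (b w)) F) ?_ ?_
  · filter_upwards [self_mem_nhdsWithin] with ε hε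
    exact (integral_oscKernel_smul_mulOp χ hε ha hb F).symm
  refine tendsto_mulOp (C := max C 1)
    (Eventually.of_forall fun ε => measurable_oscIntegral χ ε ha hb) ?_
    (isMultiplier_exp_mink ha hb).1 (fun w => ?_) (fun w => ?_) F
  · filter_upwards [self_mem_nhdsWithin] with ε hε w
    exact (hC ε hε _ _).trans (le_max_left _ _)
  · rw [mul_comm, Complex.norm_exp_ofReal_mul_I]
    exact le_max_right _ _
  · have := tendsto_oscIntegral χ (a w) (b w)
    rwa [hχ, mul_one] at this

end OscillatoryMultiplication

end WarpedField
end

noncomputable section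
namespace WarpedField

/-! ### Totality of product functions in `L²` of a product -/

section TensorDensity

variable {α β : Type*} [MeasurableSpace α] [MeasurableSpace β] {μ : Measure α} {ν : Measure β}

theorem coeFn_tensorLeft [SFinite μ] [SFinite ν] (g : Lp ℂ 2 μ) (F : Lp ℂ 2 ν) :
    tensorLeft g F =ᵐ[μ.prod ν] fun z => g z.1 * F z.2 :=
  MemLp.coeFn_toLp (memLp_tensor g F)

/-- Measurable rectangles form a π-system generating the product σ-algebra, and the sets with
vanishing integral form a λ-system. -/
theorem setIntegral_eq_zero_of_prod {f : α × β → ℂ} {κ : Measure (α × β)} (hf : Integrable f κ)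
    (h : ∀ A B, MeasurableSet A → MeasurableSet B → ∫ z in A ×ˢ B, f z ∂κ = 0)
    {s : Set (α × β)} (hs : MeasurableSet s) : ∫ z in s, f z ∂κ = 0 := by
  induction s, hs using MeasurableSpace.induction_on_inter generateFrom_prod.symm
    isPiSystem_prod with
  | empty => simp
  | basic t ht =>
    obtain ⟨A, hA, B, hB, rfl⟩ := ht
    exact h A B hA hB
  | compl t ht ih =>
    have h1 := integral_add_compl ht hf
    have h2 := h Set.univ Set.univ MeasurableSet.univ MeasurableSet.univ
    rw [Set.univ_prod_univ, setIntegral_univ] at h2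
    rw [ih, zero_add, h2] at h1
    exact h1
  | iUnion f hd hm ih =>
    rw [integral_iUnion hm hd hf.integrableOn]
    simp [ih]

theorem eq_zero_of_inner_tensorLeft_eq_zero [SigmaFinite μ] [SigmaFinite ν]
    {S : Lp ℂ 2 (μ.prod ν)} (h : ∀ g F, inner ℂ (tensorLeft g F) S = 0) : S = 0 := by
  have hrect : ∀ A B, MeasurableSet A → MeasurableSet B → μ A < ∞ → ν B < ∞ →
      ∫ z in A ×ˢ B, S z ∂(μ.prod ν) = 0 := by
    intro A B hA hB hμ hν
    have h1 := h (indicatorConstLp 2 hA hμ.ne 1) (indicatorConstLp 2 hB hν.ne 1)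
    rw [L2.inner_def] at h1
    rw [← integral_indicator (hA.prod hB), ← h1]
    refine integral_congr_ae ?_
    filter_upwards [coeFn_tensorLeft (indicatorConstLp 2 hA hμ.ne (1 : ℂ))
      (indicatorConstLp 2 hB hν.ne (1 : ℂ)),
      Measure.quasiMeasurePreserving_fst.ae (indicatorConstLp_coeFn (p := 2) (hs := hA)
        (hμs := hμ.ne) (c := (1 : ℂ))),
      Measure.quasiMeasurePreserving_snd.ae (indicatorConstLp_coeFn (p := 2) (hs := hB)
        (hμs := hν.ne) (c := (1 : ℂ)))] with z h2 h3 h4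
    rw [h2, h3, h4, RCLike.inner_apply]
    by_cases hzA : z.1 ∈ A <;> by_cases hzB : z.2 ∈ B <;> simp [hzA, hzB, Set.indicator]
  -- An `L²` function is integrable only on sets of finite measure, hence the exhaustion by finite
  -- rectangles.
  have hpiece : ∀ N, ∀ᵐ z ∂((μ.prod ν).restrict (spanningSets μ N ×ˢ spanningSets ν N)),
      S z = 0 := by
    intro N
    have hA := measurableSet_spanningSets μ N
    have hB := measurableSet_spanningSets ν N
    have hfin : (μ.prod ν) (spanningSets μ N ×ˢ spanningSets ν N) < ∞ := by
      rw [Measure.prod_prod]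
      exact ENNReal.mul_lt_top (measure_spanningSets_lt_top μ N) (measure_spanningSets_lt_top ν N)
    have : IsFiniteMeasure ((μ.prod ν).restrict (spanningSets μ N ×ˢ spanningSets ν N)) :=
      ⟨by rwa [Measure.restrict_apply_univ]⟩
    have hint : Integrable S ((μ.prod ν).restrict (spanningSets μ N ×ˢ spanningSets ν N)) :=
      ((Lp.memLp S).restrict _).integrable (by norm_num)
    refine Integrable.ae_eq_zero_of_forall_setIntegral_eq_zero hint fun s hs _ => ?_
    refine setIntegral_eq_zero_of_prod hint (fun A B hA' hB' => ?_) hs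
    rw [Measure.restrict_restrict (hA'.prod hB'), Set.prod_inter_prod]
    exact hrect _ _ (hA'.inter hA) (hB'.inter hB)
      ((measure_mono Set.inter_subset_right).trans_lt (measure_spanningSets_lt_top μ N))
      ((measure_mono Set.inter_subset_right).trans_lt (measure_spanningSets_lt_top ν N))
  have hU : (⋃ N, spanningSets μ N ×ˢ spanningSets ν N) = Set.univ := by
    rw [← Set.univ_prod_univ, ← iUnion_spanningSets μ, ← iUnion_spanningSets ν,
      Set.iUnion_prod_of_monotone (monotone_spanningSets μ) (monotone_spanningSets ν)]
  have hall := (ae_restrict_iUnion_iff _ _).mpr hpiece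
  rw [hU, Measure.restrict_univ] at hall
  refine Lp.ext ?_
  filter_upwards [hall, Lp.coeFn_zero ℂ 2 (μ.prod ν)] with z h1 h2
  rw [h1, h2]; rfl

end TensorDensity

/-! ### Symmetric functions and the prepending map `F ↦ g ⊗ F` -/

section Sectors

variable {n : ℕ} {m : ℝ}

/-- The map `F ↦ g ⊗ F` from `L²(dμᵏ)` to `L²(dμᵏ⁺¹)`. -/
def prependOp (g : OneParticle n m) (k : ℕ) :
    Lp ℂ 2 (shellMeasurePow n m k) →L[ℂ] Lp ℂ 2 (shellMeasurePow n m (k + 1)) :=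
  (Lp.compMeasurePreservingₗᵢ ℂ (MeasurableEquiv.piFinSuccAbove (fun _ => Momentum n) 0)
    (measurePreserving_piFinSuccAbove (fun _ : Fin (k + 1) => shellMeasure n m) 0)
  ).toContinuousLinearMap.comp (tensorLeft g)

theorem createSector_apply (g : OneParticle n m) (k : ℕ) (Ψ : Sector n m k) :
    createSector g k Ψ = ((√(k + 1 : ℝ) : ℝ) : ℂ) •
      (symmetric n m (k + 1)).orthogonalProjectionOnto (prependOp g k Ψ) := rfl

theorem quasiMeasurePreserving_apply (k : ℕ) (i : Fin k) :
    Measure.QuasiMeasurePreserving (fun p : Fin k → Momentum n => p i)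
      (shellMeasurePow n m k) (shellMeasure n m) :=
  Measure.quasiMeasurePreserving_eval (μ := fun _ => shellMeasure n m) i

theorem quasiMeasurePreserving_tail (k : ℕ) :
    Measure.QuasiMeasurePreserving (fun (p : Fin (k + 1) → Momentum n) (i : Fin k) => p i.succ)
      (shellMeasurePow n m (k + 1)) (shellMeasurePow n m k) :=
  Measure.quasiMeasurePreserving_snd.comp
    (measurePreserving_piFinSuccAbove (fun _ : Fin (k + 1) => shellMeasure n m)
      0).quasiMeasurePreserving

theorem coeFn_prependOp (g : OneParticle n m) (k : ℕ) (F : Lp ℂ 2 (shellMeasurePow n m k)) :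
    prependOp g k F =ᵐ[shellMeasurePow n m (k + 1)]
      fun p => g (p 0) * F (fun i => p i.succ) := by
  have h1 := Lp.coeFn_compMeasurePreserving (tensorLeft g F)
    (measurePreserving_piFinSuccAbove (fun _ : Fin (k + 1) => shellMeasure n m) 0)
  have h2 := (measurePreserving_piFinSuccAbove (fun _ : Fin (k + 1) => shellMeasure n m)
    0).quasiMeasurePreserving.ae (coeFn_tensorLeft g F)
  filter_upwards [h1, h2] with p h1 h2
  exact h1.trans h2

theorem norm_prependOp_le (g : OneParticle n m) (k : ℕ) (F : Lp ℂ 2 (shellMeasurePow n m k)) :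
    ‖prependOp g k F‖ ≤ ‖g‖ * ‖F‖ := by
  have h1 : ‖prependOp g k F‖ = ‖tensorLeft (ν := shellMeasurePow n m k) g F‖ :=
    (Lp.compMeasurePreservingₗᵢ ℂ _ (measurePreserving_piFinSuccAbove
      (fun _ : Fin (k + 1) => shellMeasure n m) 0)).norm_map _
  rw [h1]
  change ‖(memLp_tensor g F).toLp‖ ≤ _
  rw [Lp.norm_toLp, eLpNorm_tensor, ENNReal.toReal_mul]
  rfl

theorem prependOp_add (g g' : OneParticle n m) (k : ℕ) (F : Lp ℂ 2 (shellMeasurePow n m k)) :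
    prependOp (g + g') k F = prependOp g k F + prependOp g' k F := by
  refine Lp.ext ?_
  filter_upwards [coeFn_prependOp (g + g') k F, coeFn_prependOp g k F, coeFn_prependOp g' k F,
    Lp.coeFn_add (prependOp g k F) (prependOp g' k F),
    (quasiMeasurePreserving_apply (k + 1) 0).ae (Lp.coeFn_add g g')] with p h1 h2 h3 h4 h5
  rw [h1, h4, Pi.add_apply, h2, h3, h5, Pi.add_apply, add_mul]

theorem prependOp_smul (c : ℂ) (g : OneParticle n m) (k : ℕ)
    (F : Lp ℂ 2 (shellMeasurePow n m k)) :
    prependOp (c • g) k F = c • prependOp g k F := by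
  refine Lp.ext ?_
  filter_upwards [coeFn_prependOp (c • g) k F, coeFn_prependOp g k F,
    Lp.coeFn_smul c (prependOp g k F),
    (quasiMeasurePreserving_apply (k + 1) 0).ae (Lp.coeFn_smul c g)] with p h1 h2 h4 h5
  rw [h1, h4, Pi.smul_apply, h2, h5, Pi.smul_apply, smul_eq_mul, smul_eq_mul, mul_assoc]

theorem measurable_tail (k : ℕ) :
    Measurable fun (p : Fin (k + 1) → Momentum n) (i : Fin k) => p i.succ := by fun_prop

theorem prependOp_mulOp {c : Momentum n → ℂ} (hc : IsMultiplier c) {k : ℕ}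
    {d : (Fin k → Momentum n) → ℂ} (hd : IsMultiplier d) (g : OneParticle n m)
    (F : Lp ℂ 2 (shellMeasurePow n m k)) :
    prependOp (mulOp c g) k (mulOp d F)
      = mulOp (fun p => c (p 0) * d fun i => p i.succ) (prependOp g k F) := by
  refine Lp.ext ?_
  filter_upwards [coeFn_prependOp (mulOp c g) k (mulOp d F), coeFn_prependOp g k F,
    coeFn_mulOp (((hc.comp (measurable_pi_apply 0)).mul (hd.comp (measurable_tail k))))
      (prependOp g k F),
    (quasiMeasurePreserving_apply (k + 1) 0).ae (coeFn_mulOp hc g),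
    (quasiMeasurePreserving_tail k).ae (coeFn_mulOp hd F)] with p h1 h2 h3 h4 h5
  rw [h1, h3, h2, h4, h5]
  ring

theorem prependOp_mulOp_right {k : ℕ} {d : (Fin k → Momentum n) → ℂ} (hd : IsMultiplier d)
    (g : OneParticle n m) (F : Lp ℂ 2 (shellMeasurePow n m k)) :
    prependOp g k (mulOp d F) = mulOp (fun p => d fun i => p i.succ) (prependOp g k F) := by
  have := prependOp_mulOp (.of_norm_eq_one (c := fun _ => 1) measurable_const fun _ => norm_one)
    hd g F
  simpa only [mulOp_one, one_mul] using this

theorem coeFn_permute (k : ℕ) (σ : Equiv.Perm (Fin k)) (F : Lp ℂ 2 (shellMeasurePow n m k)) :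
    permute n m k σ F =ᵐ[shellMeasurePow n m k] fun p => F fun i => p (σ i) :=
  Lp.coeFn_compMeasurePreserving F (measurePreserving_perm n m k σ)

theorem permute_permute (k : ℕ) (σ τ : Equiv.Perm (Fin k)) (F : Lp ℂ 2 (shellMeasurePow n m k)) :
    permute n m k σ (permute n m k τ F) = permute n m k (σ * τ) F := by
  refine Lp.ext ?_
  filter_upwards [coeFn_permute k σ (permute n m k τ F), coeFn_permute k (σ * τ) F,
    (measurePreserving_perm n m k σ).quasiMeasurePreserving.ae (coeFn_permute k τ F)]
    with p h1 h2 h3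
  rw [h1, h2, h3]
  rfl

theorem permute_one (k : ℕ) (F : Lp ℂ 2 (shellMeasurePow n m k)) : permute n m k 1 F = F := by
  refine Lp.ext ?_
  filter_upwards [coeFn_permute k 1 F] with p h1
  rw [h1]; rfl

theorem inner_permute_left (k : ℕ) (σ : Equiv.Perm (Fin k))
    (F G : Lp ℂ 2 (shellMeasurePow n m k)) :
    inner ℂ (permute n m k σ F) G = inner ℂ F (permute n m k σ⁻¹ G) := by
  rw [← LinearIsometry.inner_map_map (permute n m k σ) F, permute_permute, mul_inv_cancel,
    permute_one]

/-- The permutation of `{0, …, k}` which fixes `0` and acts on the other points like `σ`. -/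
def shiftPerm {k : ℕ} (σ : Equiv.Perm (Fin k)) : Equiv.Perm (Fin (k + 1)) :=
  Equiv.Perm.decomposeFin.symm (0, σ)

theorem shiftPerm_zero {k : ℕ} (σ : Equiv.Perm (Fin k)) : shiftPerm σ 0 = 0 := by
  simp [shiftPerm]

theorem shiftPerm_succ {k : ℕ} (σ : Equiv.Perm (Fin k)) (i : Fin k) :
    shiftPerm σ i.succ = (σ i).succ := by
  simp [shiftPerm]

theorem prependOp_permute (g : OneParticle n m) (k : ℕ) (σ : Equiv.Perm (Fin k))
    (F : Lp ℂ 2 (shellMeasurePow n m k)) :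
    prependOp g k (permute n m k σ F) = permute n m (k + 1) (shiftPerm σ) (prependOp g k F) := by
  refine Lp.ext ?_
  filter_upwards [coeFn_prependOp g k (permute n m k σ F),
    coeFn_permute (k + 1) (shiftPerm σ) (prependOp g k F),
    (measurePreserving_perm n m (k + 1) (shiftPerm σ)).quasiMeasurePreserving.ae
      (coeFn_prependOp g k F),
    (quasiMeasurePreserving_tail k).ae (coeFn_permute k σ F)] with p h1 h2 h3 h4
  rw [h1, h2, h3, h4, shiftPerm_zero]
  simp only [shiftPerm_succ]

theorem permute_mulOp {k : ℕ} (σ : Equiv.Perm (Fin k)) {c : (Fin k → Momentum n) → ℂ}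
    (hc : IsMultiplier c) (hσ : ∀ p, c (fun i => p (σ i)) = c p)
    (F : Lp ℂ 2 (shellMeasurePow n m k)) :
    permute n m k σ (mulOp c F) = mulOp c (permute n m k σ F) := by
  refine Lp.ext ?_
  filter_upwards [coeFn_permute k σ (mulOp c F), coeFn_permute k σ F,
    coeFn_mulOp hc (permute n m k σ F),
    (measurePreserving_perm n m k σ).quasiMeasurePreserving.ae (coeFn_mulOp hc F)]
    with p h1 h2 h3 h4
  rw [h1, h3, h2, h4, hσ]

theorem mulOp_mem_symmetric {k : ℕ} {c : (Fin k → Momentum n) → ℂ} (hc : IsMultiplier c)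
    (hsym : ∀ (σ : Equiv.Perm (Fin k)) p, c (fun i => p (σ i)) = c p)
    {F : Lp ℂ 2 (shellMeasurePow n m k)} (hF : F ∈ symmetric n m k) :
    mulOp c F ∈ symmetric n m k := fun σ => by
  rw [permute_mulOp σ hc (hsym σ), hF σ]

/-- The orthogonal projection onto the symmetric functions. -/
abbrev symProj (n : ℕ) (m : ℝ) (k : ℕ) : Lp ℂ 2 (shellMeasurePow n m k) →L[ℂ] Sector n m k :=
  (symmetric n m k).orthogonalProjectionOnto

theorem inner_symProj_left {k : ℕ} (F : Lp ℂ 2 (shellMeasurePow n m k)) (S : Sector n m k) :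
    inner ℂ (symProj n m k F) S = inner ℂ F (S : Lp ℂ 2 (shellMeasurePow n m k)) :=
  Submodule.inner_orthogonalProjectionOnto_eq_of_mem_right S F

/-- A symmetric multiplier and its conjugate both preserve the symmetric subspace, which is
therefore reducing. -/
theorem symProj_mulOp {k : ℕ} {c : (Fin k → Momentum n) → ℂ} (hc : IsMultiplier c)
    (hsym : ∀ (σ : Equiv.Perm (Fin k)) p, c (fun i => p (σ i)) = c p)
    (F : Lp ℂ 2 (shellMeasurePow n m k)) :
    (symProj n m k (mulOp c F) : Lp ℂ 2 (shellMeasurePow n m k))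
      = mulOp c (symProj n m k F : Lp ℂ 2 (shellMeasurePow n m k)) := by
  have hmem := mulOp_mem_symmetric hc hsym (symProj n m k F).2
  have : symProj n m k (mulOp c F) = ⟨_, hmem⟩ := by
    refine ext_inner_right ℂ fun S => ?_
    have hS := mulOp_mem_symmetric hc.conj (fun σ p => by rw [hsym]) S.2
    rw [inner_symProj_left, inner_mulOp_left hc, Submodule.coe_inner]
    change _ = inner ℂ (mulOp c (symProj n m k F : Lp ℂ 2 (shellMeasurePow n m k))) _
    rw [inner_mulOp_left hc]
    exact (inner_symProj_left F ⟨_, hS⟩).symm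
  rw [this]

/-- Prepending intertwines `σ` with `shiftPerm σ`, so its adjoint does too. Only invariance under
permutations fixing the first variable is required, so `S` may be a symmetric function times a
twist. -/
theorem adjoint_prependOp_mem_symmetric (g : OneParticle n m) {k : ℕ}
    {S : Lp ℂ 2 (shellMeasurePow n m (k + 1))}
    (hS : ∀ σ : Equiv.Perm (Fin k), permute n m (k + 1) (shiftPerm σ) S = S) :
    ContinuousLinearMap.adjoint (prependOp g k) S ∈ symmetric n m k := fun σ => by
  refine ext_inner_right ℂ fun F => ?_
  have hinv : ∀ τ : Equiv.Perm (Fin k), (shiftPerm τ)⁻¹ = shiftPerm τ⁻¹ := by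
    intro τ
    rw [inv_eq_iff_mul_eq_one]
    ext i
    refine Fin.cases ?_ (fun j => ?_) i
    · simp [shiftPerm_zero]
    · simp [shiftPerm_succ]
  rw [inner_permute_left, ContinuousLinearMap.adjoint_inner_left, prependOp_permute, ← hinv,
    ← inner_permute_left, hS, ContinuousLinearMap.adjoint_inner_left]

/-- Symmetrizing the last `k` variables beforehand is absorbed by symmetrizing all of them. -/
theorem symProj_prependOp_symProj (g : OneParticle n m) {k : ℕ}
    (F : Lp ℂ 2 (shellMeasurePow n m k)) :
    symProj n m (k + 1) (prependOp g k (symProj n m k F : Lp ℂ 2 (shellMeasurePow n m k)))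
      = symProj n m (k + 1) (prependOp g k F) := by
  refine ext_inner_right ℂ fun S => ?_
  have hS := adjoint_prependOp_mem_symmetric g (fun σ => S.2 (shiftPerm σ))
  rw [inner_symProj_left, inner_symProj_left, ← ContinuousLinearMap.adjoint_inner_right,
    ← ContinuousLinearMap.adjoint_inner_right]
  exact inner_symProj_left F ⟨_, hS⟩

theorem eq_zero_of_inner_prependOp_eq_zero {k : ℕ} {S : Lp ℂ 2 (shellMeasurePow n m (k + 1))}
    (h : ∀ g F, inner ℂ (prependOp g k F) S = 0) : S = 0 := by
  have hmp := measurePreserving_piFinSuccAbove (fun _ : Fin (k + 1) => shellMeasure n m) 0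
  have hmp' := hmp.symm
  set S' := Lp.compMeasurePreservingₗᵢ ℂ _ hmp' S with hS'
  have h1 : Lp.compMeasurePreservingₗᵢ ℂ _ hmp S' = S := by
    refine Lp.ext ?_
    have h2 := Lp.coeFn_compMeasurePreserving S hmp'
    filter_upwards [Lp.coeFn_compMeasurePreserving S' hmp, hmp.quasiMeasurePreserving.ae h2]
      with p h3 h4
    refine h3.trans ?_
    rw [Function.comp_apply]
    refine h4.trans ?_
    rw [Function.comp_apply, MeasurableEquiv.symm_apply_apply]
  have h2 : S' = 0 := by
    refine eq_zero_of_inner_tensorLeft_eq_zero fun g F => ?_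
    rw [← LinearIsometry.inner_map_map (Lp.compMeasurePreservingₗᵢ ℂ _ hmp), h1]
    exact h g F
  rw [← h1, h2, map_zero]

/-- `Fin 0 → Momentum n` is a single point. -/
theorem eq_smul_vacuumSector (Ψ : Sector n m 0) : ∃ c : ℂ, Ψ = c • vacuumSector n m := by
  let F : Lp ℂ 2 (shellMeasurePow n m 0) := Ψ
  refine ⟨F default, Subtype.ext (Lp.ext ?_)⟩
  have h1 : (vacuumSector n m : Lp ℂ 2 (shellMeasurePow n m 0)) =ᵐ[shellMeasurePow n m 0]
      fun _ => 1 := MemLp.coeFn_toLp (memLp_one n m)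
  filter_upwards [Lp.coeFn_smul (F default) (vacuumSector n m : Lp ℂ 2 (shellMeasurePow n m 0)),
    h1] with p h2 h3
  have : p = default := Subsingleton.elim _ _
  subst this
  refine Eq.trans ?_ h2.symm
  rw [Pi.smul_apply, h3, smul_eq_mul, mul_one]

/-- The vectors `P (c · (g ⊗ Ψ))`, with a unimodular function `c` symmetric in the last `k`
variables, are total in the `k + 1`-particle space. -/
theorem eq_zero_of_inner_symProj_mulOp_prependOp {k : ℕ} {c : (Fin (k + 1) → Momentum n) → ℂ}
    (hc : Measurable c) (hc1 : ∀ p, ‖c p‖ = 1)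
    (hsym : ∀ (σ : Equiv.Perm (Fin k)) p, c (fun i => p (shiftPerm σ i)) = c p)
    {S : Sector n m (k + 1)}
    (h : ∀ g, ∀ Ψ : Sector n m k, inner ℂ (symProj n m (k + 1) (mulOp c (prependOp g k Ψ))) S = 0) :
    S = 0 := by
  have hm : IsMultiplier c := .of_norm_eq_one hc hc1
  set S' : Lp ℂ 2 (shellMeasurePow n m (k + 1)) := mulOp (fun w => starRingEnd ℂ (c w)) S with hS'
  have hinv : ∀ σ : Equiv.Perm (Fin k), permute n m (k + 1) (shiftPerm σ) S' = S' := fun σ => by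
    rw [hS', permute_mulOp _ hm.conj (fun p => by rw [hsym]), S.2]
  -- `S' = conj c · S` is symmetric in the last `k` variables, so this adjoint image is itself a
  -- `k`-particle vector. Testing the hypothesis against it gives the square of its norm.
  have h1 : ∀ g, ContinuousLinearMap.adjoint (prependOp g k) S' = 0 := by
    intro g
    have hmem := adjoint_prependOp_mem_symmetric g hinv
    have := h g ⟨_, hmem⟩
    rw [inner_symProj_left, inner_mulOp_left hm, ← ContinuousLinearMap.adjoint_inner_right] at this
    exact inner_self_eq_zero.mp this
  have h2 : S' = 0 := eq_zero_of_inner_prependOp_eq_zero fun g F => by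
    rw [← ContinuousLinearMap.adjoint_inner_right, h1, inner_zero_right]
  have h3 : mulOp c S' = S := by
    rw [hS', mulOp_mulOp hm hm.conj]
    have : (fun w => c w * starRingEnd ℂ (c w)) = fun _ => 1 := by
      funext w
      rw [Complex.mul_conj, Complex.normSq_eq_norm_sq, hc1]; simp
    rw [this, mulOp_one]
  rw [h2, map_zero] at h3
  exact Subtype.ext h3.symm

end Sectors

end WarpedField
end

noncomputable section
namespace WarpedField

/-! ### Fock space and the totality of product vectors -/

section FockBasics

variable {n : ℕ} {m : ℝ}

theorem inner_sector_smul_left {k : ℕ} (c : ℂ) (Ψ Φ : Sector n m k) :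
    inner ℂ (c • Ψ) Φ = starRingEnd ℂ c * inner ℂ Ψ Φ := by
  rw [Submodule.coe_inner, Submodule.coe_inner, Submodule.coe_smul, inner_smul_left]

theorem inner_sector_smul_right {k : ℕ} (c : ℂ) (Ψ Φ : Sector n m k) :
    inner ℂ Ψ (c • Φ) = c * inner ℂ Ψ Φ := by
  rw [Submodule.coe_inner, Submodule.coe_inner, Submodule.coe_smul, inner_smul_right]

/-- The embedding of the `k`-particle space into Fock space. -/
def inSectorCLM (n : ℕ) (m : ℝ) (k : ℕ) : Sector n m k →L[ℂ] Fock n m :=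
  lp.singleContinuousLinearMap ℂ (fun k => Sector n m k) 2 k

theorem inSectorCLM_apply {k : ℕ} (Ψ : Sector n m k) : inSectorCLM n m k Ψ = inSector k Ψ := rfl

/-- The `k`-particle component of a vector in Fock space. -/
def componentCLM (n : ℕ) (m : ℝ) (k : ℕ) : Fock n m →L[ℂ] Sector n m k :=
  lp.evalCLM ℂ (fun k => Sector n m k) 2 k

theorem componentCLM_apply {k : ℕ} (Ψ : Fock n m) : componentCLM n m k Ψ = Ψ k := rfl

theorem inSector_apply_self {k : ℕ} (Ψ : Sector n m k) : inSector k Ψ k = Ψ :=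
  lp.single_apply_self 2 k Ψ

theorem inSector_apply_ne {k j : ℕ} (Ψ : Sector n m k) (h : j ≠ k) : inSector k Ψ j = 0 :=
  lp.single_apply_ne 2 k Ψ h

theorem inSector_injective (k : ℕ) : Function.Injective (inSector (n := n) (m := m) k) :=
  fun Ψ Φ h => by rw [← inSector_apply_self Ψ, h, inSector_apply_self]

theorem norm_inSector {k : ℕ} (Ψ : Sector n m k) : ‖inSector k Ψ‖ = ‖Ψ‖ :=
  lp.norm_single (by norm_num) k Ψ

theorem inner_inSector_left {k : ℕ} (Ψ : Sector n m k) (Φ : Fock n m) :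
    inner ℂ (inSector k Ψ) Φ = inner ℂ Ψ (Φ k) := lp.inner_single_left k Ψ Φ

theorem hasSum_inSector (Ψ : Fock n m) : HasSum (fun k => inSector k (Ψ k)) Ψ :=
  lp.hasSum_single (by norm_num) Ψ

theorem eq_top_of_inSector_mem {W : Submodule ℂ (Fock n m)} (hW : IsClosed (W : Set (Fock n m)))
    (h : ∀ k Ψ, inSector k Ψ ∈ W) : W = ⊤ := by
  refine Submodule.eq_top_iff'.mpr fun Ψ => ?_
  exact hW.mem_of_tendsto (hasSum_inSector Ψ)
    (Eventually.of_forall fun s => Submodule.sum_mem _ fun k _ => h k _)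

theorem ext_inSector {E : Type*} [NormedAddCommGroup E] [NormedSpace ℂ E]
    {A B : Fock n m →L[ℂ] E} (h : ∀ k Ψ, A (inSector k Ψ) = B (inSector k Ψ)) : A = B := by
  have : LinearMap.eqLocus A.toLinearMap B.toLinearMap = ⊤ :=
    eq_top_of_inSector_mem (isClosed_eq A.continuous B.continuous) h
  ext1 Ψ
  have h1 : Ψ ∈ LinearMap.eqLocus A.toLinearMap B.toLinearMap := this ▸ Submodule.mem_top
  exact h1

/-- The sector of `createMany l` is indexed by `l.length`, which need not be `k` definitionally.
Stating the equation in Fock space avoids transport along `hl`; `productVectors` takes the same form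
for this reason. -/
theorem productVector_cons (g : OneParticle n m) {l : List (OneParticle n m)} {k : ℕ}
    (hl : l.length = k) {Ψ : Sector n m k} (h : productVector l = inSector k Ψ) :
    productVector (g :: l) = inSector (k + 1) (createSector g k Ψ) := by
  subst hl
  have : createMany l = Ψ := inSector_injective _ h
  subst this
  rfl

/-- The vectors `a*(h₁) ⋯ a*(h_k) Ω` of the `k`-particle space. -/
def productVectors (n : ℕ) (m : ℝ) (k : ℕ) : Set (Sector n m k) :=
  {Ψ | ∃ l : List (OneParticle n m), l.length = k ∧ productVector l = inSector k Ψ}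

theorem vacuumSector_mem_productVectors : vacuumSector n m ∈ productVectors n m 0 := ⟨[], rfl, rfl⟩

theorem createSector_mem_productVectors (g : OneParticle n m) {k : ℕ} {Ψ : Sector n m k}
    (h : Ψ ∈ productVectors n m k) : createSector g k Ψ ∈ productVectors n m (k + 1) := by
  obtain ⟨l, hl, h⟩ := h
  exact ⟨g :: l, by simp [hl], productVector_cons g hl h⟩

/-- The untwisted case `c = 1` of `eq_zero_of_inner_symProj_mulOp_prependOp`. -/
theorem eq_top_of_createSector_mem {k : ℕ} {W : Submodule ℂ (Sector n m (k + 1))}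
    (hW : IsClosed (W : Set (Sector n m (k + 1)))) (h : ∀ g Ψ, createSector g k Ψ ∈ W) :
    W = ⊤ := by
  have : CompleteSpace W := hW.completeSpace_coe
  rw [← Submodule.orthogonal_eq_bot_iff, Submodule.eq_bot_iff]
  intro S hS
  refine eq_zero_of_inner_symProj_mulOp_prependOp (c := fun _ => 1) measurable_const
    (fun _ => norm_one) (fun _ _ => rfl) fun g Ψ => ?_
  have h1 := hS _ (h g Ψ)
  rw [createSector_apply] at h1
  rw [inner_sector_smul_left, mul_eq_zero] at h1
  rw [mulOp_one]
  refine h1.resolve_left ((map_ne_zero _).mpr ?_)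
  rw [Complex.ofReal_ne_zero]
  positivity

/-- Induction on the particle number for closed subspaces. -/
theorem sector_induction {W : ∀ k, Submodule ℂ (Sector n m k)}
    (hW : ∀ k, IsClosed (W k : Set (Sector n m k))) (h0 : vacuumSector n m ∈ W 0)
    (hs : ∀ k g, ∀ Ψ ∈ W k, createSector g k Ψ ∈ W (k + 1)) (k : ℕ) (Ψ : Sector n m k) :
    Ψ ∈ W k := by
  induction k with
  | zero =>
    obtain ⟨c, rfl⟩ := eq_smul_vacuumSector Ψ
    exact Submodule.smul_mem _ _ h0
  | succ k ih =>
    rw [eq_top_of_createSector_mem (hW (k + 1)) fun g Ψ => hs k g Ψ (ih Ψ)]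
    exact Submodule.mem_top

theorem span_productVectors_dense (k : ℕ) :
    (Submodule.span ℂ (productVectors n m k)).topologicalClosure = ⊤ := by
  refine Submodule.eq_top_iff'.mpr fun Ψ => ?_
  refine sector_induction
    (W := fun k => (Submodule.span ℂ (productVectors n m k)).topologicalClosure)
    (fun k => Submodule.isClosed_topologicalClosure _)
    (Submodule.le_topologicalClosure _ (Submodule.subset_span vacuumSector_mem_productVectors))
    (fun k g Ψ hΨ => ?_) k Ψ
  have hle : Submodule.span ℂ (productVectors n m k)
      ≤ (Submodule.span ℂ (productVectors n m (k + 1))).topologicalClosure.comap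
        (createSector g k).toLinearMap := by
    rw [Submodule.span_le]
    intro Φ hΦ
    exact Submodule.le_topologicalClosure _
      (Submodule.subset_span (createSector_mem_productVectors g hΦ))
  exact Submodule.topologicalClosure_minimal _ hle
    ((Submodule.isClosed_topologicalClosure _).preimage (createSector g k).continuous) hΨ

theorem ext_productVectors {k : ℕ} {E : Type*} [NormedAddCommGroup E] [NormedSpace ℂ E]
    {A B : Sector n m k →L[ℂ] E} (h : ∀ Ψ ∈ productVectors n m k, A Ψ = B Ψ) : A = B := by
  have h1 : Submodule.span ℂ (productVectors n m k)
      ≤ LinearMap.eqLocus A.toLinearMap B.toLinearMap := Submodule.span_le.mpr h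
  have h2 := Submodule.topologicalClosure_minimal _ h1 (isClosed_eq A.continuous B.continuous)
  rw [span_productVectors_dense] at h2
  ext1 Ψ
  exact h2 (Submodule.mem_top (x := Ψ))

theorem denseRange_linearCombination_productVector :
    DenseRange (Finsupp.linearCombination ℂ
      fun l : List (OneParticle n m) => productVector l) := by
  have h1 : (LinearMap.range (Finsupp.linearCombination ℂ
      fun l : List (OneParticle n m) => productVector l)).topologicalClosure = ⊤ := by
    refine eq_top_of_inSector_mem (Submodule.isClosed_topologicalClosure _) fun k Ψ => ?_
    have h2 : Submodule.span ℂ (productVectors n m k) ≤ (LinearMap.range (Finsupp.linearCombination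
        ℂ fun l : List (OneParticle n m) => productVector l)).topologicalClosure.comap
        (inSectorCLM n m k).toLinearMap := by
      rw [Submodule.span_le]
      rintro Φ ⟨l, -, h⟩
      refine Submodule.le_topologicalClosure _ ⟨Finsupp.single l 1, ?_⟩
      rw [Finsupp.linearCombination_single, one_smul]
      exact h
    have h3 := Submodule.topologicalClosure_minimal _ h2
      ((Submodule.isClosed_topologicalClosure _).preimage (inSectorCLM n m k).continuous)
    rw [span_productVectors_dense] at h3
    exact h3 (Submodule.mem_top (x := Ψ))
  have h2 := (Submodule.dense_iff_topologicalClosure_eq_top).mpr h1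
  exact h2

end FockBasics

/-! ### The Gram matrix of the product vectors -/

section Gram

variable {n : ℕ} {m : ℝ}

/-- `F = h₁ ⊗ ⋯ ⊗ h_k`. -/
def IsPureTensor {k : ℕ} (F : Lp ℂ 2 (shellMeasurePow n m k)) (h : Fin k → OneParticle n m) :
    Prop := F =ᵐ[shellMeasurePow n m k] fun p => ∏ i, h i (p i)

theorem IsPureTensor.inner_eq {k : ℕ} {F G : Lp ℂ 2 (shellMeasurePow n m k)}
    {h g : Fin k → OneParticle n m} (hF : IsPureTensor F h) (hG : IsPureTensor G g) :
    inner ℂ F G = ∏ i, inner ℂ (h i) (g i) := by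
  simp only [L2.inner_def]
  rw [← integral_fintype_prod_eq_prod
    (f := fun i (p : Momentum n) => (inner ℂ (h i p) (g i p) : ℂ))]
  refine integral_congr_ae ?_
  filter_upwards [hF, hG] with p h1 h2
  rw [h1, h2]
  simp only [RCLike.inner_apply, map_prod, Finset.prod_mul_distrib]

theorem IsPureTensor.permute_perm {k : ℕ} {F : Lp ℂ 2 (shellMeasurePow n m k)}
    {h : Fin k → OneParticle n m} (hF : IsPureTensor F h) (σ : Equiv.Perm (Fin k)) :
    IsPureTensor (WarpedField.permute n m k σ F) fun i => h (σ⁻¹ i) := by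
  unfold IsPureTensor
  filter_upwards [coeFn_permute k σ F,
    (measurePreserving_perm n m k σ).quasiMeasurePreserving.ae hF] with p h1 h2
  rw [h1, h2]
  refine Eq.trans ?_ (Equiv.prod_comp σ fun i => h (σ⁻¹ i) (p i))
  simp

/-- The average is invariant and has the same inner products with symmetric functions as `F`. -/
theorem symProj_eq_average {k : ℕ} (F : Lp ℂ 2 (shellMeasurePow n m k)) :
    (symProj n m k F : Lp ℂ 2 (shellMeasurePow n m k))
      = ((Nat.factorial k : ℂ))⁻¹ • ∑ σ, permute n m k σ F := by
  have hmem : ((Nat.factorial k : ℂ))⁻¹ • ∑ σ, permute n m k σ F ∈ symmetric n m k := by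
    intro τ
    rw [map_smul, map_sum]
    simp only [permute_permute]
    rw [(Group.mulLeft_bijective τ).sum_comp fun σ => permute n m k σ F]
  have : symProj n m k F = ⟨_, hmem⟩ := by
    refine ext_inner_right ℂ fun S => ?_
    rw [inner_symProj_left, Submodule.coe_inner]
    change _ = inner ℂ (((Nat.factorial k : ℂ))⁻¹ • ∑ σ, permute n m k σ F) _
    rw [inner_smul_left, sum_inner]
    have h1 : ∀ σ, inner ℂ (permute n m k σ F) (S : Lp ℂ 2 (shellMeasurePow n m k))
        = inner ℂ F (S : Lp ℂ 2 (shellMeasurePow n m k)) := fun σ => by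
      rw [inner_permute_left, S.2]
    simp only [h1, Finset.sum_const, Finset.card_univ, Fintype.card_perm, Fintype.card_fin,
      nsmul_eq_mul]
    rw [map_inv₀, map_natCast, inv_mul_cancel_left₀]
    exact_mod_cast Nat.factorial_ne_zero k
  rw [this]

theorem exists_pureTensor {k : ℕ} (h : Fin k → OneParticle n m) :
    ∃ F, IsPureTensor F h ∧ productVector (List.ofFn h)
      = inSector k (((√(Nat.factorial k : ℝ) : ℝ) : ℂ) • symProj n m k F) := by
  induction k with
  | zero =>
    refine ⟨vacuumSector n m, ?_, ?_⟩
    · have h1 : (vacuumSector n m : Lp ℂ 2 (shellMeasurePow n m 0)) =ᵐ[shellMeasurePow n m 0]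
        fun _ => 1 := MemLp.coeFn_toLp (memLp_one n m)
      unfold IsPureTensor
      filter_upwards [h1] with p h1
      rw [h1]; simp
    · rw [symProj, Submodule.orthogonalProjectionOnto_mem_subspace_eq_self]
      simp only [Nat.factorial_zero, Nat.cast_one, Real.sqrt_one, Complex.ofReal_one, one_smul]
      rw [List.ofFn_zero]
      rfl
  | succ k ih =>
    obtain ⟨F, hF, hpv⟩ := ih fun i => h i.succ
    refine ⟨prependOp (h 0) k F, ?_, ?_⟩
    · unfold IsPureTensor
      filter_upwards [coeFn_prependOp (h 0) k F, (quasiMeasurePreserving_tail k).ae hF]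
        with p h1 h2
      rw [h1, h2, Fin.prod_univ_succ]
    · rw [List.ofFn_succ, productVector_cons (h 0) (List.length_ofFn) hpv, map_smul,
        createSector_apply, symProj_prependOp_symProj, smul_smul, Nat.factorial_succ,
        Nat.cast_mul, Real.sqrt_mul (by positivity), Complex.ofReal_mul, Nat.cast_succ]
      ring_nf

/-- For equal lengths the inner product is the permanent of the matrix of one-particle inner
products, and for different lengths it is zero; an isometry changes neither. -/
theorem inner_productVector_map {T : OneParticle n m →L[ℂ] OneParticle n m}
    (hT : ∀ g h, inner ℂ (T g) (T h) = inner ℂ g h) (l l' : List (OneParticle n m)) :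
    inner ℂ (productVector (l.map T)) (productVector (l'.map T))
      = inner ℂ (productVector l) (productVector l') := by
  obtain ⟨k, h, rfl⟩ : ∃ (k : ℕ) (h : Fin k → OneParticle n m), l = List.ofFn h :=
    ⟨_, l.get, (List.ofFn_get l).symm⟩
  obtain ⟨j, g, rfl⟩ : ∃ (k : ℕ) (h : Fin k → OneParticle n m), l' = List.ofFn h :=
    ⟨_, l'.get, (List.ofFn_get l').symm⟩
  rw [List.map_ofFn, List.map_ofFn]
  obtain ⟨F, hF, hpF⟩ := exists_pureTensor h
  obtain ⟨F', hF', hpF'⟩ := exists_pureTensor (T ∘ h)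
  obtain ⟨G, hG, hpG⟩ := exists_pureTensor g
  obtain ⟨G', hG', hpG'⟩ := exists_pureTensor (T ∘ g)
  rw [hpF, hpF', hpG, hpG', inner_inSector_left, inner_inSector_left]
  by_cases hkj : k = j
  · subst hkj
    rw [inSector_apply_self, inSector_apply_self]
    have key : ∀ {F G : Lp ℂ 2 (shellMeasurePow n m k)} {h g : Fin k → OneParticle n m},
        IsPureTensor F h → IsPureTensor G g → inner ℂ (symProj n m k F) (symProj n m k G)
          = ((Nat.factorial k : ℂ))⁻¹ * ∑ σ : Equiv.Perm (Fin k), ∏ i, inner ℂ (h i) (g (σ⁻¹ i)) := by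
      intro F G h g hF hG
      rw [inner_symProj_left, symProj_eq_average, inner_smul_right, inner_sum]
      exact congrArg _ (Finset.sum_congr rfl fun σ _ => hF.inner_eq (hG.permute_perm σ))
    simp only [inner_sector_smul_left, inner_sector_smul_right, key hF hG, key hF' hG', Function.comp_apply, hT]
  · rw [inSector_apply_ne _ hkj, inSector_apply_ne _ hkj, inner_zero_right, inner_zero_right]

/-- The squared norm is the quadratic form of the Gram matrix. This makes `Γ(T)` well defined and
isometric on the span although the product vectors are linearly dependent. -/
theorem norm_linearCombination_congr {ι H : Type*} [NormedAddCommGroup H] [InnerProductSpace ℂ H]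
    {v w : ι → H} (h : ∀ i j, inner ℂ (v i) (v j) = inner ℂ (w i) (w j)) (c : ι →₀ ℂ) :
    ‖Finsupp.linearCombination ℂ v c‖ = ‖Finsupp.linearCombination ℂ w c‖ := by
  have : inner ℂ (Finsupp.linearCombination ℂ v c) (Finsupp.linearCombination ℂ v c)
      = inner ℂ (Finsupp.linearCombination ℂ w c) (Finsupp.linearCombination ℂ w c) := by
    simp only [Finsupp.linearCombination_apply, Finsupp.sum, sum_inner, inner_sum,
      inner_smul_left, inner_smul_right, h]
  rw [inner_self_eq_norm_sq_to_K, inner_self_eq_norm_sq_to_K] at this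
  have h2 : ‖Finsupp.linearCombination ℂ v c‖ ^ 2 = ‖Finsupp.linearCombination ℂ w c‖ ^ 2 := by
    exact_mod_cast this
  exact (pow_left_inj₀ (norm_nonneg _) (norm_nonneg _) two_ne_zero).mp h2

end Gram

/-! ### Second quantization of isometries -/

section SecondQuantization

variable {n : ℕ} {m : ℝ} {T T' : OneParticle n m →L[ℂ] OneParticle n m}

theorem norm_linearCombination_productVector_map (hT : ∀ g h, inner ℂ (T g) (T h) = inner ℂ g h)
    (c : List (OneParticle n m) →₀ ℂ) :
    ‖Finsupp.linearCombination ℂ (fun l : List (OneParticle n m) => productVector (l.map T)) c‖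
      = ‖Finsupp.linearCombination ℂ (fun l : List (OneParticle n m) => productVector l) c‖ :=
  norm_linearCombination_congr (fun l l' => inner_productVector_map hT l l') c

theorem secondQuantization_linearCombination (hT : ∀ g h, inner ℂ (T g) (T h) = inner ℂ g h)
    (c : List (OneParticle n m) →₀ ℂ) :
    secondQuantization T
        (Finsupp.linearCombination ℂ (fun l : List (OneParticle n m) => productVector l) c)
      = Finsupp.linearCombination ℂ
        (fun l : List (OneParticle n m) => productVector (l.map T)) c :=
  LinearMap.extendOfNorm_eq denseRange_linearCombination_productVector
    ⟨1, fun x => by rw [one_mul, norm_linearCombination_productVector_map hT]⟩ c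

theorem secondQuantization_productVector (hT : ∀ g h, inner ℂ (T g) (T h) = inner ℂ g h)
    (l : List (OneParticle n m)) :
    secondQuantization T (productVector l) = productVector (l.map T) := by
  have := secondQuantization_linearCombination hT (Finsupp.single l 1)
  simpa only [Finsupp.linearCombination_single, one_smul] using this

theorem norm_secondQuantization (hT : ∀ g h, inner ℂ (T g) (T h) = inner ℂ g h) (Ψ : Fock n m) :
    ‖secondQuantization T Ψ‖ = ‖Ψ‖ := by
  refine denseRange_linearCombination_productVector.induction_on Ψ
    (isClosed_eq (by fun_prop) (by fun_prop)) fun c => ?_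
  rw [secondQuantization_linearCombination hT, norm_linearCombination_productVector_map hT]

/-- The restriction of `Γ(T)` to the `k`-particle space. -/
def secondQuantizationSector (T : OneParticle n m →L[ℂ] OneParticle n m) (k : ℕ) :
    Sector n m k →L[ℂ] Sector n m k :=
  (componentCLM n m k).comp ((secondQuantization T).comp (inSectorCLM n m k))

theorem secondQuantization_inSector (hT : ∀ g h, inner ℂ (T g) (T h) = inner ℂ g h) {k : ℕ}
    (Ψ : Sector n m k) :
    secondQuantization T (inSector k Ψ) = inSector k (secondQuantizationSector T k Ψ) := by
  have : (secondQuantization T).comp (inSectorCLM n m k)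
      = (inSectorCLM n m k).comp (secondQuantizationSector T k) := by
    refine ext_productVectors fun Φ hΦ => ?_
    obtain ⟨l, rfl, h⟩ := hΦ
    have h1 : secondQuantization T (inSectorCLM n m l.length Φ) = productVector (l.map T) := by
      rw [inSectorCLM_apply, ← h, secondQuantization_productVector hT]
    -- The lengths of `l.map T` and `l` agree only propositionally.
    obtain ⟨Φ', hΦ'⟩ : ∃ Φ' : Sector n m l.length, productVector (l.map T) = inSector _ Φ' := by
      have : ∀ (l' : List (OneParticle n m)) (k : ℕ), l'.length = k →
          ∃ Φ' : Sector n m k, productVector l' = inSector _ Φ' := by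
        rintro l' _ rfl
        exact ⟨_, rfl⟩
      exact this _ _ (by simp)
    rw [inSectorCLM_apply, hΦ'] at h1
    simp only [ContinuousLinearMap.comp_apply, secondQuantizationSector, h1,
      componentCLM_apply, inSector_apply_self, inSectorCLM_apply]
  exact DFunLike.congr_fun this Ψ

theorem secondQuantizationSector_createSector (hT : ∀ g h, inner ℂ (T g) (T h) = inner ℂ g h)
    (g : OneParticle n m) {k : ℕ} (Ψ : Sector n m k) :
    secondQuantizationSector T (k + 1) (createSector g k Ψ)
      = createSector (T g) k (secondQuantizationSector T k Ψ) := by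
  have : (secondQuantizationSector T (k + 1)).comp (createSector g k)
      = (createSector (T g) k).comp (secondQuantizationSector T k) := by
    refine ext_productVectors fun Φ hΦ => ?_
    obtain ⟨l, hl, h⟩ := hΦ
    refine inSector_injective _ ?_
    rw [ContinuousLinearMap.comp_apply, ContinuousLinearMap.comp_apply,
      ← secondQuantization_inSector hT, ← productVector_cons g hl h,
      secondQuantization_productVector hT, List.map_cons]
    refine productVector_cons (T g) (by simpa using hl) ?_
    rw [← secondQuantization_productVector hT, h, secondQuantization_inSector hT]
  exact DFunLike.congr_fun this Ψ

theorem secondQuantizationSector_vacuumSector (hT : ∀ g h, inner ℂ (T g) (T h) = inner ℂ g h) :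
    secondQuantizationSector T 0 (vacuumSector n m) = vacuumSector n m := by
  refine inSector_injective _ ?_
  rw [← secondQuantization_inSector hT]
  exact secondQuantization_productVector hT []

theorem secondQuantization_secondQuantization (hT : ∀ g h, inner ℂ (T g) (T h) = inner ℂ g h)
    (hT' : ∀ g h, inner ℂ (T' g) (T' h) = inner ℂ g h) (h : ∀ g, T (T' g) = g) (Ψ : Fock n m) :
    secondQuantization T (secondQuantization T' Ψ) = Ψ := by
  refine denseRange_linearCombination_productVector.induction_on Ψ
    (isClosed_eq (by fun_prop) (by fun_prop)) fun c => ?_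
  rw [secondQuantization_linearCombination hT']
  simp only [Finsupp.linearCombination_apply, Finsupp.sum, map_sum, map_smul,
    secondQuantization_productVector hT, List.map_map]
  have : ⇑T ∘ ⇑T' = id := funext h
  simp only [this, List.map_id]

end SecondQuantization

end WarpedField
end

noncomputable section
namespace WarpedField

/-! ### Translations as multipliers and modified creation operators -/

section Multipliers

variable {n : ℕ} {m : ℝ}

theorem measurable_onShell : Measurable (onShell m : Momentum n → Spacetime n) := by
  have : Continuous (onShell m : Momentum n → Spacetime n) := by
    unfold onShell
    refine (PiLp.continuous_toLp 2 _).comp (continuous_pi fun i => ?_)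
    refine Fin.cases ?_ (fun j => ?_) i
    · simp only [Fin.cons_zero, energy]; fun_prop
    · simp only [Fin.cons_succ]; fun_prop
  exact this.measurable

/-- The total momentum of `k` particles. -/
def totalMomentum (m : ℝ) {k : ℕ} (p : Fin k → Momentum n) : Spacetime n := ∑ i, onShell m (p i)

theorem measurable_totalMomentum (k : ℕ) :
    Measurable (totalMomentum m : (Fin k → Momentum n) → Spacetime n) := by
  unfold totalMomentum
  exact Finset.measurable_sum _ fun i _ => measurable_onShell.comp (measurable_pi_apply i)

theorem totalMomentum_succ {k : ℕ} (p : Fin (k + 1) → Momentum n) :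
    totalMomentum m p = onShell m (p 0) + totalMomentum m fun i => p i.succ :=
  Fin.sum_univ_succ _

theorem totalMomentum_perm {k : ℕ} (σ : Equiv.Perm (Fin k)) (p : Fin k → Momentum n) :
    totalMomentum m (fun i => p (σ i)) = totalMomentum m p :=
  Equiv.sum_comp σ fun i => onShell m (p i)

/-- The function `e^{i u·(p₁ + ⋯ + p_k)}`. -/
def totalWave (m : ℝ) (u : Spacetime n) {k : ℕ} (p : Fin k → Momentum n) : ℂ :=
  Complex.exp (Complex.I * (mink u (totalMomentum m p) : ℝ))

theorem isMultiplier_totalWave (u : Spacetime n) (k : ℕ) :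
    IsMultiplier (totalWave m u : (Fin k → Momentum n) → ℂ) :=
  isMultiplier_exp_mink measurable_const (measurable_totalMomentum k)

theorem totalWave_perm (u : Spacetime n) {k : ℕ} (σ : Equiv.Perm (Fin k))
    (p : Fin k → Momentum n) : totalWave m u (fun i => p (σ i)) = totalWave m u p := by
  rw [totalWave, totalMomentum_perm, totalWave]

theorem isMultiplier_phase (u : Spacetime n) : IsMultiplier (phase m u : Momentum n → ℂ) :=
  .of_norm_eq_one (measurable_phase m u) (norm_phase m u)

theorem oneParticleTranslation_eq_mulOp (u : Spacetime n) (g : OneParticle n m) :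
    oneParticleTranslation m u g = mulOp (phase m u) g := by
  refine Lp.ext ?_
  filter_upwards [coeFn_mulOp (isMultiplier_phase u) g, MemLp.coeFn_toLp (memLp_phase_mul u g)]
    with p h1 h2
  rw [h1]
  exact h2

theorem inner_oneParticleTranslation (u : Spacetime n) (g h : OneParticle n m) :
    inner ℂ (oneParticleTranslation m u g) (oneParticleTranslation m u h) = inner ℂ g h := by
  have hm := isMultiplier_phase (m := m) u
  rw [oneParticleTranslation_eq_mulOp, oneParticleTranslation_eq_mulOp, inner_mulOp_left hm,
    mulOp_mulOp hm.conj hm]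
  have : (fun w => starRingEnd ℂ (phase m u w) * phase m u w) = fun _ => 1 := by
    funext w
    rw [mul_comm, Complex.mul_conj, Complex.normSq_eq_norm_sq, norm_phase]; simp
  rw [this, mulOp_one]

/-- The restriction of the translation `e^{i u·P}` to the `k`-particle space. -/
def translationSector (m : ℝ) (u : Spacetime n) (k : ℕ) : Sector n m k →L[ℂ] Sector n m k :=
  secondQuantizationSector (oneParticleTranslation m u) k

/-- Both sides are bounded and agree on the vacuum. Creation with `g` multiplies by one more factor
`e^{iu·p₀}` on either side, and the total exponential, being symmetric, commutes with the
projection. -/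
theorem coe_translationSector (u : Spacetime n) (k : ℕ) (Ψ : Sector n m k) :
    (translationSector m u k Ψ : Lp ℂ 2 (shellMeasurePow n m k)) = mulOp (totalWave m u) Ψ.1 := by
  refine sector_induction (W := fun k => LinearMap.eqLocus
    ((symmetric n m k).subtypeL.comp (translationSector m u k)).toLinearMap
    ((mulOp (totalWave m u)).comp (symmetric n m k).subtypeL).toLinearMap)
    (fun k => isClosed_eq (ContinuousLinearMap.continuous _) (ContinuousLinearMap.continuous _))
    ?_ (fun k g Ψ hΨ => ?_) k Ψ
  · change (translationSector m u 0 (vacuumSector n m)).1 = mulOp _ (vacuumSector n m).1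
    have : (totalWave m u : (Fin 0 → Momentum n) → ℂ) = fun _ => 1 := by
      funext p
      simp [totalWave, totalMomentum, mink_zero_right]
    rw [this, mulOp_one, translationSector,
      secondQuantizationSector_vacuumSector (inner_oneParticleTranslation u)]
  · replace hΨ : (translationSector m u k Ψ : Lp ℂ 2 (shellMeasurePow n m k))
      = mulOp (totalWave m u) Ψ.1 := hΨ
    change (translationSector m u (k + 1) (createSector g k Ψ)).1
      = mulOp _ (createSector g k Ψ).1
    have h1 : (totalWave m u : (Fin (k + 1) → Momentum n) → ℂ)
        = fun p => phase m u (p 0) * totalWave m u fun i => p i.succ := by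
      funext p
      rw [totalWave, totalWave, phase, ← Complex.exp_add, totalMomentum_succ, mink_add_right]
      push_cast
      ring_nf
    rw [translationSector,
      secondQuantizationSector_createSector (inner_oneParticleTranslation u),
      ← translationSector, createSector_apply, createSector_apply, hΨ,
      oneParticleTranslation_eq_mulOp,
      prependOp_mulOp (isMultiplier_phase u) (isMultiplier_totalWave u k), ← h1,
      Submodule.coe_smul, Submodule.coe_smul, map_smul,
      symProj_mulOp (isMultiplier_totalWave u (k + 1)) (totalWave_perm u)]

theorem translationSector_translationSector (u v : Spacetime n) (k : ℕ) (Ψ : Sector n m k) :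
    translationSector m u k (translationSector m v k Ψ) = translationSector m (u + v) k Ψ := by
  refine Subtype.ext ?_
  rw [coe_translationSector, coe_translationSector, coe_translationSector,
    mulOp_mulOp (isMultiplier_totalWave u k) (isMultiplier_totalWave v k)]
  congr 1
  congr 1
  funext p
  rw [totalWave, totalWave, totalWave, ← Complex.exp_add, mink_add_left]
  push_cast
  ring_nf

theorem conj_totalWave (u : Spacetime n) {k : ℕ} (p : Fin k → Momentum n) :
    starRingEnd ℂ (totalWave m u p) = totalWave m (-u) p := by
  rw [totalWave, totalWave, ← Complex.exp_conj, map_mul, Complex.conj_I, Complex.conj_ofReal,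
    mink_neg_left]
  push_cast
  ring_nf

theorem inner_translationSector_left (u : Spacetime n) (k : ℕ) (Ψ Φ : Sector n m k) :
    inner ℂ (translationSector m u k Ψ) Φ = inner ℂ Ψ (translationSector m (-u) k Φ) := by
  rw [Submodule.coe_inner, Submodule.coe_inner, coe_translationSector, coe_translationSector,
    inner_mulOp_left (isMultiplier_totalWave u k)]
  simp only [conj_totalWave]

/-- The modified creation operator `Ψ ↦ √(k+1) P_{k+1} (c · (g ⊗ Ψ))`. -/
def createMul {k : ℕ} (c : (Fin (k + 1) → Momentum n) → ℂ) (g : OneParticle n m) :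
    Sector n m k →L[ℂ] Sector n m (k + 1) :=
  ((√(k + 1 : ℝ) : ℝ) : ℂ) • ((symProj n m (k + 1)).comp
    ((mulOp c).comp ((prependOp g k).comp (symmetric n m k).subtypeL)))

theorem createMul_apply {k : ℕ} (c : (Fin (k + 1) → Momentum n) → ℂ) (g : OneParticle n m)
    (Ψ : Sector n m k) : createMul c g Ψ
      = ((√(k + 1 : ℝ) : ℝ) : ℂ) • symProj n m (k + 1) (mulOp c (prependOp g k Ψ)) := rfl

theorem createSector_eq_createMul (g : OneParticle n m) (k : ℕ) :
    createSector g k = createMul (fun _ => 1) g := by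
  ext1 Ψ
  rw [createSector_apply, createMul_apply, mulOp_one]

/-- The natural bound has `√(k+1)`; the cruder linear one is all that temperedness and the Jacobi
criterion need. -/
theorem norm_createMul_le {k : ℕ} {c : (Fin (k + 1) → Momentum n) → ℂ} (hc : Measurable c)
    (hc1 : ∀ p, ‖c p‖ = 1) (g : OneParticle n m) : ‖createMul c g‖ ≤ ‖g‖ * (k + 1) := by
  refine ContinuousLinearMap.opNorm_le_bound _ (by positivity) fun Ψ => ?_
  rw [createMul_apply, norm_smul, Complex.norm_real, Real.norm_of_nonneg (Real.sqrt_nonneg _)]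
  have h1 : ‖symProj n m (k + 1) (mulOp c (prependOp g k Ψ))‖ ≤ ‖g‖ * ‖Ψ‖ := by
    refine (Submodule.norm_orthogonalProjectionOnto_apply_le _ _).trans ?_
    refine (norm_mulOp_le hc (fun p => (hc1 p).le) _).trans ?_
    rw [one_mul]
    exact norm_prependOp_le g k _
  have h2 : √(k + 1 : ℝ) ≤ k + 1 := by
    rw [Real.sqrt_le_left (by positivity)]
    nlinarith [(Nat.cast_nonneg k : (0 : ℝ) ≤ k)]
  calc √(k + 1 : ℝ) * ‖symProj n m (k + 1) (mulOp c (prependOp g k Ψ))‖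
      ≤ (k + 1) * (‖g‖ * ‖Ψ‖) := by gcongr
    _ = ‖g‖ * (k + 1) * ‖Ψ‖ := by ring

theorem createMul_add {k : ℕ} (c : (Fin (k + 1) → Momentum n) → ℂ) (g h : OneParticle n m) :
    createMul c (g + h) = createMul c g + createMul c h := by
  ext1 Ψ
  rw [add_apply, createMul_apply, createMul_apply, createMul_apply,
    prependOp_add, map_add, map_add, smul_add]

theorem createMul_smul {k : ℕ} (c : (Fin (k + 1) → Momentum n) → ℂ) (a : ℂ)
    (g : OneParticle n m) : createMul c (a • g) = a • createMul c g := by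
  ext1 Ψ
  rw [smul_apply, createMul_apply, createMul_apply,
    prependOp_smul, map_smul, map_smul, smul_comm]

theorem adjoint_createMul_apply {k : ℕ} {c : (Fin (k + 1) → Momentum n) → ℂ}
    (hc : IsMultiplier c) (g : OneParticle n m) (Φ : Sector n m (k + 1)) :
    ContinuousLinearMap.adjoint (createMul c g) Φ = ((√(k + 1 : ℝ) : ℝ) : ℂ) •
      symProj n m k (ContinuousLinearMap.adjoint (prependOp g k)
        (mulOp (fun p => starRingEnd ℂ (c p)) Φ.1)) := by
  refine ext_inner_left ℂ fun Ψ => ?_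
  rw [ContinuousLinearMap.adjoint_inner_right, createMul_apply, inner_sector_smul_left,
    inner_sector_smul_right, inner_symProj_left, inner_mulOp_left hc, Complex.conj_ofReal,
    ← ContinuousLinearMap.adjoint_inner_right]
  congr 1
  exact (Submodule.inner_orthogonalProjectionOnto_eq_of_mem_left _ _).symm

/-- The function `e^{i (u·(p₀ + ⋯ + p_k) + v·(p₁ + ⋯ + p_k))}`. -/
def sandwichWave (m : ℝ) (u v : Spacetime n) {k : ℕ} (p : Fin (k + 1) → Momentum n) : ℂ :=
  totalWave m u p * totalWave m v fun i => p i.succ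

/-- The right translation multiplies in the last `k` variables before symmetrization. The left one
is symmetric and passes through the projection, so both merge into one multiplier. -/
theorem translationSector_createSector_translationSector (u v : Spacetime n)
    (g : OneParticle n m) (k : ℕ) (Ψ : Sector n m k) :
    translationSector m u (k + 1) (createSector g k (translationSector m v k Ψ))
      = createMul (sandwichWave m u v) g Ψ := by
  refine Subtype.ext ?_
  rw [coe_translationSector, createSector_apply, createMul_apply, Submodule.coe_smul,
    Submodule.coe_smul, map_smul, coe_translationSector,
    prependOp_mulOp_right (isMultiplier_totalWave v k),
    ← symProj_mulOp (isMultiplier_totalWave u (k + 1)) (totalWave_perm u),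
    mulOp_mulOp (isMultiplier_totalWave u (k + 1))
      ((isMultiplier_totalWave v k).comp (measurable_tail k))]
  rfl

/-- The adjoint of the creation formula, with the two translations interchanged and inverted. -/
theorem translationSector_annihilateSector_translationSector (u v : Spacetime n)
    (g : OneParticle n m) (k : ℕ) (Φ : Sector n m (k + 1)) :
    translationSector m u k (annihilateSector g k (translationSector m v (k + 1) Φ))
      = ContinuousLinearMap.adjoint (createMul (sandwichWave m (-v) (-u)) g) Φ := by
  refine ext_inner_left ℂ fun Ψ => ?_
  rw [ContinuousLinearMap.adjoint_inner_right, ← translationSector_createSector_translationSector,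
    inner_translationSector_left, neg_neg, ← ContinuousLinearMap.adjoint_inner_right,
    inner_translationSector_left, neg_neg]
  rfl

end Multipliers

/-! ### Fields as block Jacobi operators -/

section Jacobi

variable {n : ℕ} {m : ℝ}

/-- The operator `A + B^*` on the `k`-particle space, where `A` and `B` raise the particle number
by one. -/
def fieldOp (A B : ∀ k, Sector n m k →L[ℂ] Sector n m (k + 1)) :
    ∀ k, Sector n m k →L[ℂ] Fock n m
  | 0 => (inSectorCLM n m 1).comp (A 0)
  | k + 1 => (inSectorCLM n m (k + 2)).comp (A (k + 1))
      + (inSectorCLM n m k).comp (ContinuousLinearMap.adjoint (B k))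

theorem fieldOp_zero (A B : ∀ k, Sector n m k →L[ℂ] Sector n m (k + 1)) (Ψ : Sector n m 0) :
    fieldOp A B 0 Ψ = inSector 1 (A 0 Ψ) := rfl

theorem fieldOp_succ (A B : ∀ k, Sector n m k →L[ℂ] Sector n m (k + 1)) (k : ℕ)
    (Ψ : Sector n m (k + 1)) : fieldOp A B (k + 1) Ψ
      = inSector (k + 2) (A (k + 1) Ψ) + inSector k (ContinuousLinearMap.adjoint (B k) Ψ) := rfl

theorem fieldOp_mem_finiteParticle (A B : ∀ k, Sector n m k →L[ℂ] Sector n m (k + 1)) (k : ℕ)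
    (Ψ : Sector n m k) : fieldOp A B k Ψ ∈ finiteParticle n m := by
  have h : ∀ j (Φ : Sector n m j), inSector j Φ ∈ finiteParticle n m := fun j Φ =>
    ⟨j + 1, fun i hi => inSector_apply_ne Φ (by omega)⟩
  cases k with
  | zero => exact h _ _
  | succ k => exact Submodule.add_mem _ (h _ _) (h _ _)

/-- `A + B^*` is the formal adjoint of `B + A^*`. -/
theorem inner_fieldOp (A B : ∀ k, Sector n m k →L[ℂ] Sector n m (k + 1)) {k : ℕ}
    (Ψ : Sector n m k) (Ξ : Fock n m) :
    inner ℂ (fieldOp A B k Ψ) Ξ = inner ℂ Ψ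
      (ContinuousLinearMap.adjoint (A k) (Ξ (k + 1)))
      + match k with
        | 0 => 0
        | j + 1 => inner ℂ Ψ (B j (Ξ j)) := by
  cases k with
  | zero =>
    rw [fieldOp_zero, inner_inSector_left, ContinuousLinearMap.adjoint_inner_right, add_zero]
  | succ k =>
    rw [fieldOp_succ, inner_add_left, inner_inSector_left, inner_inSector_left,
      ContinuousLinearMap.adjoint_inner_right, ContinuousLinearMap.adjoint_inner_left]

end Jacobi

end WarpedField
end

noncomputable section
namespace WarpedField

/-! ### Conjugation with `Γ(V)` -/

section Conjugation

variable {n : ℕ} {m : ℝ} (V : OneParticle n m ≃ₗᵢ[ℂ] OneParticle n m)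

/-- The restriction of `Γ(V)` to the `k`-particle space. -/
def gammaSector (k : ℕ) : Sector n m k →L[ℂ] Sector n m k :=
  secondQuantizationSector (V : OneParticle n m →L[ℂ] OneParticle n m) k

theorem inner_coe_linearIsometryEquiv (g h : OneParticle n m) :
    inner ℂ ((V : OneParticle n m →L[ℂ] OneParticle n m) g)
      ((V : OneParticle n m →L[ℂ] OneParticle n m) h) = inner ℂ g h := V.inner_map_map g h

theorem secondQuantization_coe_inSector {k : ℕ} (Ψ : Sector n m k) :
    secondQuantization (V : OneParticle n m →L[ℂ] OneParticle n m) (inSector k Ψ)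
      = inSector k (gammaSector V k Ψ) :=
  secondQuantization_inSector (inner_coe_linearIsometryEquiv V) Ψ

theorem gammaSector_createSector (g : OneParticle n m) {k : ℕ} (Ψ : Sector n m k) :
    gammaSector V (k + 1) (createSector g k Ψ) = createSector (V g) k (gammaSector V k Ψ) :=
  secondQuantizationSector_createSector (inner_coe_linearIsometryEquiv V) g Ψ

theorem gammaSector_symm_gammaSector {k : ℕ} (Ψ : Sector n m k) :
    gammaSector V.symm k (gammaSector V k Ψ) = Ψ := by
  refine inSector_injective k ?_
  rw [← secondQuantization_coe_inSector, ← secondQuantization_coe_inSector]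
  exact secondQuantization_secondQuantization (inner_coe_linearIsometryEquiv V.symm)
    (inner_coe_linearIsometryEquiv V) (fun g => V.symm_apply_apply g) _

theorem gammaSector_gammaSector_symm {k : ℕ} (Ψ : Sector n m k) :
    gammaSector V k (gammaSector V.symm k Ψ) = Ψ := by
  have := gammaSector_symm_gammaSector V.symm Ψ
  rwa [LinearIsometryEquiv.symm_symm] at this

theorem norm_gammaSector {k : ℕ} (Ψ : Sector n m k) : ‖gammaSector V k Ψ‖ = ‖Ψ‖ := by
  rw [← norm_inSector, ← secondQuantization_coe_inSector,
    norm_secondQuantization (inner_coe_linearIsometryEquiv V), norm_inSector]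

/-- `Γ(V)` as a unitary operator on the `k`-particle space. -/
def gammaEquiv (k : ℕ) : Sector n m k ≃ₗᵢ[ℂ] Sector n m k where
  toLinearEquiv := LinearEquiv.ofLinearMap (gammaSector V k).toLinearMap
    (gammaSector V.symm k).toLinearMap
    (LinearMap.ext fun Ψ => gammaSector_gammaSector_symm V Ψ)
    (LinearMap.ext fun Ψ => gammaSector_symm_gammaSector V Ψ)
  norm_map' := norm_gammaSector V

theorem gammaEquiv_apply {k : ℕ} (Ψ : Sector n m k) : gammaEquiv V k Ψ = gammaSector V k Ψ := rfl

theorem inner_gammaSector_left {k : ℕ} (Ψ Φ : Sector n m k) :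
    inner ℂ (gammaSector V k Ψ) Φ = inner ℂ Ψ (gammaSector V.symm k Φ) := by
  rw [← (gammaEquiv V k).inner_map_map Ψ, gammaEquiv_apply, gammaEquiv_apply,
    gammaSector_gammaSector_symm]

theorem adjoint_gammaSector (k : ℕ) :
    ContinuousLinearMap.adjoint (gammaSector V k) = gammaSector V.symm k := by
  ext1 Φ
  refine ext_inner_left ℂ fun Ψ => ?_
  rw [ContinuousLinearMap.adjoint_inner_right, inner_gammaSector_left]

/-- The operator `Γ(V⁻¹) A Γ(V)`. -/
def conjGamma {k j : ℕ} (A : Sector n m k →L[ℂ] Sector n m j) : Sector n m k →L[ℂ] Sector n m j :=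
  (gammaSector V.symm j).comp (A.comp (gammaSector V k))

theorem conjGamma_apply {k j : ℕ} (A : Sector n m k →L[ℂ] Sector n m j) (Ψ : Sector n m k) :
    conjGamma V A Ψ = gammaSector V.symm j (A (gammaSector V k Ψ)) := rfl

theorem adjoint_conjGamma {k j : ℕ} (A : Sector n m k →L[ℂ] Sector n m j) :
    ContinuousLinearMap.adjoint (conjGamma V A) = conjGamma V (ContinuousLinearMap.adjoint A) := by
  rw [conjGamma, ContinuousLinearMap.adjoint_comp, ContinuousLinearMap.adjoint_comp,
    adjoint_gammaSector, adjoint_gammaSector, LinearIsometryEquiv.symm_symm, conjGamma,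
    ContinuousLinearMap.comp_assoc]

/-- From `Γ(V) a*(g) = a*(V g) Γ(V)`. Hence conjugation with `Γ(V)` reduces the field with `X` to
the field with `P`, at the price of replacing `g` by `V g`. -/
theorem conjGamma_createSector (g : OneParticle n m) (k : ℕ) :
    conjGamma V (createSector (V g) k) = createSector g k := by
  ext1 Ψ
  rw [conjGamma_apply, ← gammaSector_createSector, gammaSector_symm_gammaSector]

theorem conjGamma_annihilateSector (g : OneParticle n m) (k : ℕ) :
    conjGamma V (annihilateSector (V g) k) = annihilateSector g k := by
  rw [annihilateSector, ← adjoint_conjGamma, conjGamma_createSector, annihilateSector]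

theorem norm_conjGamma_le {k j : ℕ} (A : Sector n m k →L[ℂ] Sector n m j) :
    ‖conjGamma V A‖ ≤ ‖A‖ := by
  refine ContinuousLinearMap.opNorm_le_bound _ A.opNorm_nonneg fun Ψ => ?_
  rw [conjGamma_apply, norm_gammaSector, ← norm_gammaSector V Ψ]
  exact A.le_opNorm _

theorem conjGamma_add {k j : ℕ} (A B : Sector n m k →L[ℂ] Sector n m j) :
    conjGamma V (A + B) = conjGamma V A + conjGamma V B := by
  ext1 Ψ
  rw [add_apply, conjGamma_apply, conjGamma_apply, conjGamma_apply, add_apply, map_add]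

theorem conjGamma_smul {k j : ℕ} (c : ℂ) (A : Sector n m k →L[ℂ] Sector n m j) :
    conjGamma V (c • A) = c • conjGamma V A := by
  ext1 Ψ
  rw [smul_apply, conjGamma_apply, conjGamma_apply, smul_apply, map_smul]

theorem conjGamma_conjGamma {k j i : ℕ} (A : Sector n m j →L[ℂ] Sector n m i)
    (B : Sector n m k →L[ℂ] Sector n m j) (Ψ : Sector n m k) :
    conjGamma V A (conjGamma V B Ψ) = conjGamma V (A.comp B) Ψ := by
  rw [conjGamma_apply, conjGamma_apply, gammaSector_gammaSector_symm]
  rfl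

/-- The unitary group generated by `X` on the `k`-particle space. -/
def groupXSector (y : Spacetime n) (k : ℕ) : Sector n m k →L[ℂ] Sector n m k :=
  conjGamma V (translationSector m y k)

theorem groupX_inSector (y : Spacetime n) {k : ℕ} (Ψ : Sector n m k) :
    groupX V y (inSector k Ψ) = inSector k (groupXSector V y k Ψ) := by
  change secondQuantization _ (translation m y (secondQuantization _ (inSector k Ψ))) = _
  rw [secondQuantization_coe_inSector, translation,
    secondQuantization_inSector (inner_oneParticleTranslation y)]
  exact secondQuantization_coe_inSector V.symm _

theorem groupXSector_groupXSector (u v : Spacetime n) (k : ℕ) (Ψ : Sector n m k) :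
    groupXSector V u k (groupXSector V v k Ψ) = groupXSector V (u + v) k Ψ := by
  rw [groupXSector, groupXSector, conjGamma_conjGamma, groupXSector, conjGamma_apply,
    conjGamma_apply, ContinuousLinearMap.comp_apply, translationSector_translationSector]

theorem adjoint_groupXSector (u : Spacetime n) (k : ℕ) :
    ContinuousLinearMap.adjoint (groupXSector V u k) = groupXSector V (-u) k := by
  rw [groupXSector, adjoint_conjGamma]
  congr 1
  ext1 Φ
  refine ext_inner_left ℂ fun Ψ => ?_
  rw [ContinuousLinearMap.adjoint_inner_right, inner_translationSector_left]

theorem groupX_component (u : Spacetime n) (Ψ : Fock n m) (k : ℕ) :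
    groupX V u Ψ k = groupXSector V u k (Ψ k) := by
  have : (componentCLM n m k).comp (groupX V u)
      = (groupXSector V u k).comp (componentCLM n m k) := by
    refine ext_inSector fun j Φ => ?_
    simp only [ContinuousLinearMap.comp_apply, componentCLM_apply, groupX_inSector]
    by_cases h : k = j
    · subst h
      rw [inSector_apply_self, inSector_apply_self]
    · rw [inSector_apply_ne _ h, inSector_apply_ne _ h, map_zero]
  exact DFunLike.congr_fun this Ψ

theorem inner_inSector_groupX (u : Spacetime n) {k : ℕ} (Ψ : Sector n m k) (Φ : Fock n m) :
    inner ℂ (inSector k Ψ) (groupX V u Φ) = inner ℂ (inSector k (groupXSector V (-u) k Ψ)) Φ := by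
  rw [inner_inSector_left, inner_inSector_left, groupX_component,
    ← ContinuousLinearMap.adjoint_inner_left, adjoint_groupXSector]

theorem groupXSector_createSector_groupXSector (u v : Spacetime n) (g : OneParticle n m) (k : ℕ)
    (Ψ : Sector n m k) :
    groupXSector V u (k + 1) (createSector g k (groupXSector V v k Ψ))
      = conjGamma V (createMul (sandwichWave m u v) (V g)) Ψ := by
  rw [← conjGamma_createSector V g k, groupXSector, groupXSector, conjGamma_conjGamma,
    conjGamma_conjGamma, conjGamma_apply, conjGamma_apply, ContinuousLinearMap.comp_apply,
    ContinuousLinearMap.comp_apply, translationSector_createSector_translationSector]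

theorem groupXSector_annihilateSector_groupXSector (u v : Spacetime n) (g : OneParticle n m)
    (k : ℕ) (Ψ : Sector n m (k + 1)) :
    groupXSector V u k (annihilateSector g k (groupXSector V v (k + 1) Ψ))
      = conjGamma V (ContinuousLinearMap.adjoint
        (createMul (sandwichWave m (-v) (-u)) (V g))) Ψ := by
  rw [← conjGamma_annihilateSector V g k, groupXSector, groupXSector, conjGamma_conjGamma,
    conjGamma_conjGamma, conjGamma_apply, conjGamma_apply, ContinuousLinearMap.comp_apply,
    ContinuousLinearMap.comp_apply, translationSector_annihilateSector_translationSector]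

/-- The vector `e^{iu·X} (A + B^*) e^{iv·X} Ψ` for creation operators `A`, `B`. -/
theorem groupX_fieldOp_groupX (u v : Spacetime n) (g h : OneParticle n m) (k : ℕ)
    (Ψ : Sector n m k) :
    groupX V u (fieldOp (createSector g) (createSector h) k (groupXSector V v k Ψ))
      = fieldOp (fun k => conjGamma V (createMul (k := k) (sandwichWave m u v) (V g)))
        (fun k => conjGamma V (createMul (k := k) (sandwichWave m (-v) (-u)) (V h))) k Ψ := by
  cases k with
  | zero =>
    rw [fieldOp_zero, fieldOp_zero, groupX_inSector, groupXSector_createSector_groupXSector]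
  | succ k =>
    rw [fieldOp_succ, fieldOp_succ, map_add, groupX_inSector, groupX_inSector,
      groupXSector_createSector_groupXSector, adjoint_conjGamma]
    congr 2
    exact groupXSector_annihilateSector_groupXSector V u v h k Ψ

end Conjugation

/-! ### The free field on fixed particle numbers -/

section FreeField

variable {n : ℕ} {m : ℝ} [Fact (0 < m)]

theorem fieldComponent_inSector (f : 𝓢(Spacetime n, ℂ)) {k : ℕ} (Ψ : Sector n m k) :
    fieldComponent f (inSector k Ψ)
      = fieldOp (createSector (plusVec n m f)) (createSector (minusConjVec n m f)) k Ψ := by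
  have hc : ∀ j, createSector (plusVec n m f) j (inSector k Ψ j)
      = (inSector (k + 1) (createSector (plusVec n m f) k Ψ) : Fock n m) (j + 1) := by
    intro j
    by_cases h : j = k
    · subst h
      rw [inSector_apply_self, inSector_apply_self]
    · rw [inSector_apply_ne _ h, inSector_apply_ne _ (by omega), map_zero]
  cases k with
  | zero =>
    rw [fieldOp_zero]
    funext j
    cases j with
    | zero =>
      rw [fieldComponent, inSector_apply_ne _ (by omega), map_zero,
        inSector_apply_ne _ (by omega)]
    | succ j =>
      rw [fieldComponent, inSector_apply_ne _ (by omega), map_zero, zero_add, hc]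
  | succ k =>
    have ha : ∀ j, annihilateSector (minusConjVec n m f) j (inSector (k + 1) Ψ (j + 1))
        = (inSector k (annihilateSector (minusConjVec n m f) k Ψ) : Fock n m) j := by
      intro j
      by_cases h : j = k
      · subst h
        rw [inSector_apply_self, inSector_apply_self]
      · rw [inSector_apply_ne _ (show j + 1 ≠ k + 1 by omega), inSector_apply_ne _ h, map_zero]
    rw [fieldOp_succ]
    funext j
    rw [lp.coeFn_add, Pi.add_apply]
    cases j with
    | zero =>
      rw [fieldComponent, ha, inSector_apply_ne _ (show 0 ≠ k + 2 by omega), zero_add]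
      rfl
    | succ j =>
      rw [fieldComponent, ha, hc]
      exact add_comm _ _

theorem inSector_mem_freeField_domain (f : 𝓢(Spacetime n, ℂ)) {k : ℕ} (Ψ : Sector n m k) :
    inSector k Ψ ∈ (freeField f : Fock n m →ₗ.[ℂ] Fock n m).domain := by
  change Memℓp (fieldComponent f (inSector k Ψ)) 2
  rw [fieldComponent_inSector]
  exact lp.memℓp _

theorem freeField_inSector (f : 𝓢(Spacetime n, ℂ)) {k : ℕ} (Ψ : Sector n m k) :
    (freeField f : Fock n m →ₗ.[ℂ] Fock n m) ⟨inSector k Ψ, inSector_mem_freeField_domain f Ψ⟩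
      = fieldOp (createSector (plusVec n m f)) (createSector (minusConjVec n m f)) k Ψ :=
  lp.ext (fieldComponent_inSector f Ψ)

theorem applyOrZero_freeField_inSector (f : 𝓢(Spacetime n, ℂ)) {k : ℕ} (Ψ : Sector n m k) :
    applyOrZero (freeField f : Fock n m →ₗ.[ℂ] Fock n m) (inSector k Ψ)
      = fieldOp (createSector (plusVec n m f)) (createSector (minusConjVec n m f)) k Ψ := by
  rw [applyOrZero_of_mem _ (inSector_mem_freeField_domain f Ψ), freeField_inSector]

/-- Conjugation flips the sign in the exponential. Thus `f ↦ conj f` exchanges the roles of creation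
and annihilation, and for real `f` the two one-particle vectors coincide. -/
theorem minusConjVec_eq (f : 𝓢(Spacetime n, ℂ)) :
    minusConjVec n m f = plusVec n m (conjTest f) := by
  refine MemLp.toLp_congr _ _ (ae_of_all _ fun p => ?_)
  change starRingEnd ℂ (minusFun m f p) = plusFun m (conjTest f) p
  rw [minusFun, plusFun, ← integral_conj]
  congr 1 with x
  change _ = starRingEnd ℂ (f x) * _
  rw [map_mul, ← Complex.exp_conj, map_neg, map_mul, Complex.conj_I, Complex.conj_ofReal]
  ring_nf

theorem conjTest_conjTest (f : 𝓢(Spacetime n, ℂ)) : conjTest (conjTest f) = f := by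
  ext x
  exact Complex.conj_conj (f x)

/-- `Ξ` ranges over the whole natural domain: the left factor has `k` particles, so only finitely
many components of `Ξ` enter. -/
theorem inner_freeField (f : 𝓢(Spacetime n, ℂ)) {k : ℕ} (Ψ : Sector n m k)
    (Ξ : (freeField f : Fock n m →ₗ.[ℂ] Fock n m).domain) :
    inner ℂ (inSector k Ψ) (freeField f Ξ)
      = inner ℂ (fieldOp (createSector (minusConjVec n m f)) (createSector (plusVec n m f)) k Ψ)
        (Ξ : Fock n m) := by
  rw [inner_inSector_left, inner_fieldOp]
  change inner ℂ Ψ (fieldComponent f Ξ.1 k) = _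
  cases k with
  | zero => rw [fieldComponent, add_zero]; rfl
  | succ k => rw [fieldComponent, inner_add_right]; rfl

end FreeField

end WarpedField
end

noncomputable section
namespace WarpedField

set_option linter.unusedSectionVars false

/-! ### Oscillatory limits of creation and annihilation operators -/

section Oscillatory

variable {n : ℕ} {W W' : Type*} [NormedAddCommGroup W] [NormedSpace ℂ W] [CompleteSpace W]
  [NormedAddCommGroup W'] [NormedSpace ℂ W'] [CompleteSpace W']

/-- The oscillatory integral `(2π)^{-d} ∬ dx dy e^{-i x·y} o(x, y)` exists and has the value `w`. -/
structure HasOscLimit (o : Spacetime n × Spacetime n → W) (w : W) : Prop where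
  integrable : ∀ χ : 𝓢(Spacetime n × Spacetime n, ℂ), ∀ ε : ℝ, 0 < ε →
    Integrable fun z => oscKernel χ ε z • o z
  tendsto : ∀ χ : 𝓢(Spacetime n × Spacetime n, ℂ), χ 0 = 1 →
    Tendsto (fun ε : ℝ => (((2 * Real.pi) ^ (n + 1))⁻¹ : ℂ) • ∫ z, oscKernel χ ε z • o z)
      (𝓝[>] 0) (𝓝 w)

/-- Bounded operators commute with the Bochner integral and with the limit. Everything thereby
reduces to multiplication operators, and matrix elements are covered as well. -/
theorem HasOscLimit.map {o : Spacetime n × Spacetime n → W} {w : W} (h : HasOscLimit o w)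
    (L : W →L[ℂ] W') : HasOscLimit (fun z => L (o z)) (L w) where
  integrable χ ε hε := by
    simpa only [map_smul] using L.integrable_comp (h.integrable χ ε hε)
  tendsto χ hχ := by
    refine ((L.continuous.tendsto w).comp (h.tendsto χ hχ)).congr' ?_
    filter_upwards [self_mem_nhdsWithin] with ε hε
    simp only [Function.comp_apply, map_smul, ← L.integral_comp_comm (h.integrable χ ε hε)]

theorem HasOscLimit.add {o o' : Spacetime n × Spacetime n → W} {w w' : W} (h : HasOscLimit o w)
    (h' : HasOscLimit o' w') : HasOscLimit (fun z => o z + o' z) (w + w') where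
  integrable χ ε hε := by
    simp only [smul_add]
    exact (h.integrable χ ε hε).add (h'.integrable χ ε hε)
  tendsto χ hχ := by
    refine ((h.tendsto χ hχ).add (h'.tendsto χ hχ)).congr' ?_
    filter_upwards [self_mem_nhdsWithin] with ε hε
    rw [← smul_add, ← integral_add (h.integrable χ ε hε) (h'.integrable χ ε hε)]
    simp only [smul_add]

theorem HasOscLimit.unique {o : Spacetime n × Spacetime n → W} {w w' : W} (h : HasOscLimit o w)
    (h' : HasOscLimit o w') : w = w' := by
  obtain ⟨χ, hχ⟩ := exists_cutoff n
  exact tendsto_nhds_unique (h.tendsto χ hχ) (h'.tendsto χ hχ)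

variable {m : ℝ}

theorem hasOscLimit_mulOp {k : ℕ} {a b : (Fin k → Momentum n) → Spacetime n} (ha : Measurable a)
    (hb : Measurable b) (F : Lp ℂ 2 (shellMeasurePow n m k)) :
    HasOscLimit (fun z => mulOp (fun p => planeWave (a p) (b p) z) F)
      (mulOp (fun p => Complex.exp (Complex.I * (mink (a p) (b p) : ℝ))) F) where
  integrable χ _ hε := integrable_oscKernel_smul_mulOp χ hε ha hb F
  tendsto _ hχ := tendsto_integral_oscKernel_smul_mulOp hχ ha hb F

theorem hasOscLimit_createMul {k : ℕ} {a b : (Fin (k + 1) → Momentum n) → Spacetime n}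
    (ha : Measurable a) (hb : Measurable b) (g : OneParticle n m) (Ψ : Sector n m k) :
    HasOscLimit (fun z => createMul (fun p => planeWave (a p) (b p) z) g Ψ)
      (createMul (fun p => Complex.exp (Complex.I * (mink (a p) (b p) : ℝ))) g Ψ) :=
  (hasOscLimit_mulOp ha hb (prependOp g k Ψ.1)).map
    (((√(k + 1 : ℝ) : ℝ) : ℂ) • symProj n m (k + 1))

/-- The conjugate is there because the adjoint conjugates the multiplier once more, leaving the
plane wave itself acting on `Φ`. -/
theorem hasOscLimit_adjoint_createMul {k : ℕ} {a b : (Fin (k + 1) → Momentum n) → Spacetime n}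
    (ha : Measurable a) (hb : Measurable b) (g : OneParticle n m) (Φ : Sector n m (k + 1)) :
    HasOscLimit (fun z => ContinuousLinearMap.adjoint
        (createMul (fun p => starRingEnd ℂ (planeWave (a p) (b p) z)) g) Φ)
      (ContinuousLinearMap.adjoint
        (createMul (fun p => starRingEnd ℂ (Complex.exp (Complex.I * (mink (a p) (b p) : ℝ)))) g)
        Φ) := by
  have h := (hasOscLimit_mulOp ha hb Φ.1).map
    ((((√(k + 1 : ℝ) : ℝ) : ℂ) • symProj n m k).comp
      (ContinuousLinearMap.adjoint (prependOp g k)))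
  simp only [adjoint_createMul_apply (isMultiplier_planeWave ha hb _).conj,
    adjoint_createMul_apply (isMultiplier_exp_mink ha hb).conj, Complex.conj_conj]
  exact h

end Oscillatory

/-! ### The deformed field on fixed particle numbers -/

section Deformed

variable {n : ℕ} {m : ℝ} {θ : Matrix (Fin (n + 1)) (Fin (n + 1)) ℝ}

theorem mink_act_self (hθ : IsLorentzSkew θ) (p : Spacetime n) : mink (act θ p) p = 0 := by
  have := hθ p p
  rw [mink_comm p] at this
  linarith

theorem measurable_act (θ : Matrix (Fin (n + 1)) (Fin (n + 1)) ℝ) : Measurable (act θ) :=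
  (Matrix.toEuclideanLin θ).continuous_of_finiteDimensional.measurable

variable (m θ) in
/-- The function `e^{-i (θp₀)·(p₁ + ⋯ + p_k)}`. -/
def twist {k : ℕ} (p : Fin (k + 1) → Momentum n) : ℂ :=
  Complex.exp (Complex.I *
    (mink (-act θ (onShell m (p 0))) (totalMomentum m fun i => p i.succ) : ℝ))

theorem measurable_act_head (k : ℕ) :
    Measurable fun p : Fin (k + 1) → Momentum n => act θ (onShell m (p 0)) :=
  (measurable_act θ).comp (measurable_onShell.comp (measurable_pi_apply 0))

theorem measurable_totalMomentum_tail (k : ℕ) :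
    Measurable fun p : Fin (k + 1) → Momentum n => totalMomentum m fun i => p i.succ :=
  (measurable_totalMomentum k).comp (measurable_tail k)

theorem isMultiplier_twist (k : ℕ) :
    IsMultiplier (twist m θ : (Fin (k + 1) → Momentum n) → ℂ) :=
  isMultiplier_exp_mink (measurable_act_head k).neg (measurable_totalMomentum_tail k)

theorem norm_twist {k : ℕ} (p : Fin (k + 1) → Momentum n) : ‖twist m θ p‖ = 1 := by
  rw [twist, mul_comm, Complex.norm_exp_ofReal_mul_I]

/-- Since `θp₀·p₀ = 0`, it does not matter whether `p₀` is included in the total momentum. This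
identifies the limits of the creation and annihilation parts. -/
theorem twist_eq_conj (hθ : IsLorentzSkew θ) {k : ℕ} (p : Fin (k + 1) → Momentum n) :
    twist m θ p = starRingEnd ℂ (Complex.exp (Complex.I *
      (mink (act θ (onShell m (p 0))) (totalMomentum m p) : ℝ))) := by
  rw [twist, ← Complex.exp_conj, map_mul, Complex.conj_I, Complex.conj_ofReal, totalMomentum_succ,
    mink_add_right, mink_act_self hθ, zero_add, mink_neg_left]
  push_cast
  ring_nf

theorem twist_shiftPerm {k : ℕ} (σ : Equiv.Perm (Fin k)) (p : Fin (k + 1) → Momentum n) :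
    twist m θ (fun i => p (shiftPerm σ i)) = twist m θ p := by
  simp only [twist, shiftPerm_zero, shiftPerm_succ]
  rw [totalMomentum_perm σ fun i => p i.succ]

/-- The contributions of `θx` in the last `k` momenta cancel; what is left is `θx·p₀ = -x·θp₀` and
`y·(p₁+⋯+p_k)`. -/
theorem sandwichWave_eq_planeWave (hθ : IsLorentzSkew θ) {k : ℕ} (z : Spacetime n × Spacetime n) :
    (sandwichWave m (act θ z.1) (-act θ z.1 + z.2) : (Fin (k + 1) → Momentum n) → ℂ)
      = fun p => planeWave (-act θ (onShell m (p 0))) (totalMomentum m fun i => p i.succ) z := by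
  funext p
  rw [sandwichWave, totalWave, totalWave, ← Complex.exp_add, planeWave, totalMomentum_succ,
    mink_add_right, hθ, mink_add_left, mink_neg_left, mink_neg_right]
  push_cast
  ring_nf

/-- For annihilation `e^{iy·X}` acts before a particle is removed, so `y` is paired with the total
momentum including `p₀`. -/
theorem sandwichWave_eq_conj_planeWave (hθ : IsLorentzSkew θ) {k : ℕ}
    (z : Spacetime n × Spacetime n) :
    (sandwichWave m (-z.2 + act θ z.1) (-act θ z.1) : (Fin (k + 1) → Momentum n) → ℂ)
      = fun p => starRingEnd ℂ (planeWave (act θ (onShell m (p 0))) (totalMomentum m p) z) := by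
  funext p
  rw [sandwichWave, totalWave, totalWave, ← Complex.exp_add, planeWave, ← Complex.exp_conj,
    map_mul, Complex.conj_I, Complex.conj_ofReal, totalMomentum_succ, mink_add_right,
    mink_add_left, mink_add_left, mink_neg_left, mink_neg_left, mink_neg_left, mink_add_right,
    hθ z.1 (onShell m (p 0))]
  push_cast
  ring_nf

variable (V : OneParticle n m ≃ₗᵢ[ℂ] OneParticle n m)

variable (θ) in
/-- The deformed creation operator. -/
def dcreate (g : OneParticle n m) (k : ℕ) : Sector n m k →L[ℂ] Sector n m (k + 1) :=
  conjGamma V (createMul (twist m θ) (V g))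

theorem norm_dcreate_le (g : OneParticle n m) (k : ℕ) : ‖dcreate θ V g k‖ ≤ ‖g‖ * (k + 1) := by
  refine (norm_conjGamma_le V _).trans ?_
  rw [← V.norm_map g]
  exact norm_createMul_le (isMultiplier_twist k).1 norm_twist _

theorem dcreate_add (g h : OneParticle n m) (k : ℕ) :
    dcreate θ V (g + h) k = dcreate θ V g k + dcreate θ V h k := by
  rw [dcreate, map_add, createMul_add, conjGamma_add, dcreate, dcreate]

theorem dcreate_smul (c : ℂ) (g : OneParticle n m) (k : ℕ) :
    dcreate θ V (c • g) k = c • dcreate θ V g k := by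
  rw [dcreate, map_smul, createMul_smul, conjGamma_smul, dcreate]

theorem dcreate_zero_right (g : OneParticle n m) : dcreate θ V g 0 = createSector g 0 := by
  have : (twist m θ : (Fin 1 → Momentum n) → ℂ) = fun _ => 1 := by
    funext p
    simp [twist, totalMomentum, mink_zero_right]
  rw [dcreate, this, ← createSector_eq_createMul, conjGamma_createSector]

theorem hasOscLimit_conjGamma_createMul (hθ : IsLorentzSkew θ) (g : OneParticle n m) (k : ℕ)
    (Ψ : Sector n m k) :
    HasOscLimit (fun z => conjGamma V
      (createMul (sandwichWave m (act θ z.1) (-act θ z.1 + z.2)) (V g)) Ψ)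
      (dcreate θ V g k Ψ) := by
  have h := (hasOscLimit_createMul (a := fun p => -act θ (onShell m (p 0)))
    (b := fun p => totalMomentum m fun i => p i.succ) (measurable_act_head k).neg
    (measurable_totalMomentum_tail k) (V g) (gammaSector V k Ψ)).map (gammaSector V.symm (k + 1))
  simp only [sandwichWave_eq_planeWave hθ]
  exact h

theorem hasOscLimit_adjoint_conjGamma_createMul (hθ : IsLorentzSkew θ) (g : OneParticle n m)
    (k : ℕ) (Ψ : Sector n m (k + 1)) :
    HasOscLimit (fun z => ContinuousLinearMap.adjoint (conjGamma V
      (createMul (k := k) (sandwichWave m (-z.2 + act θ z.1) (-act θ z.1)) (V g))) Ψ)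
      (ContinuousLinearMap.adjoint (dcreate θ V g k) Ψ) := by
  have h := (hasOscLimit_adjoint_createMul (a := fun p => act θ (onShell m (p 0)))
    (b := totalMomentum m) (measurable_act_head k) (measurable_totalMomentum (k + 1)) (V g)
    (gammaSector V (k + 1) Ψ)).map (gammaSector V.symm k)
  simp only [sandwichWave_eq_conj_planeWave hθ, dcreate, funext (twist_eq_conj hθ),
    adjoint_conjGamma]
  exact h

variable [Fact (0 < m)]

variable (θ) in
/-- The deformed field on the `k`-particle space. -/
def dfield (f : 𝓢(Spacetime n, ℂ)) (k : ℕ) : Sector n m k →L[ℂ] Fock n m :=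
  fieldOp (dcreate θ V (plusVec n m f)) (dcreate θ V (minusConjVec n m f)) k

theorem orbit_inSector (f : 𝓢(Spacetime n, ℂ)) {k : ℕ} (Ψ : Sector n m k)
    (z : Spacetime n × Spacetime n) : orbit θ V f (inSector k Ψ) z.1 z.2
      = fieldOp (fun k => conjGamma V
          (createMul (k := k) (sandwichWave m (act θ z.1) (-act θ z.1 + z.2)) (V (plusVec n m f))))
        (fun k => conjGamma V (createMul (k := k) (sandwichWave m (-z.2 + act θ z.1) (-act θ z.1))
          (V (minusConjVec n m f)))) k Ψ := by
  rw [orbit, groupX_inSector, groupX_inSector, groupXSector_groupXSector,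
    applyOrZero_freeField_inSector, groupX_fieldOp_groupX, neg_add_rev, neg_neg]

/-- The central computation: the oscillatory integral replaces the creation operators by their
twisted versions, separately in the sectors `k + 1` and `k - 1`. -/
theorem isWarped_inSector (hθ : IsLorentzSkew θ) (f : 𝓢(Spacetime n, ℂ)) {k : ℕ}
    (Ψ : Sector n m k) : IsWarped θ V f (inSector k Ψ) (dfield θ V f k Ψ) := by
  have h : HasOscLimit (fun z => orbit θ V f (inSector k Ψ) z.1 z.2) (dfield θ V f k Ψ) := by
    simp only [orbit_inSector]
    cases k with
    | zero =>
      exact (hasOscLimit_conjGamma_createMul V hθ (plusVec n m f) 0 Ψ).map (inSectorCLM n m 1)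
    | succ k =>
      exact ((hasOscLimit_conjGamma_createMul V hθ (plusVec n m f) (k + 1) Ψ).map
        (inSectorCLM n m (k + 2))).add
        ((hasOscLimit_adjoint_conjGamma_createMul V hθ (minusConjVec n m f) k Ψ).map
          (inSectorCLM n m k))
  refine ⟨fun x y => ?_, h.integrable, h.tendsto⟩
  rw [groupX_inSector, groupX_inSector]
  exact inSector_mem_freeField_domain f _

theorem IsWarped.hasOscLimit {f : 𝓢(Spacetime n, ℂ)} {Ψ Φ : Fock n m}
    (h : IsWarped θ V f Ψ Φ) : HasOscLimit (fun z => orbit θ V f Ψ z.1 z.2) Φ :=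
  ⟨h.integrable, h.tendsto⟩

theorem groupX_groupX (u v : Spacetime n) (Ψ : Fock n m) :
    groupX V u (groupX V v Ψ) = groupX V (u + v) Ψ := by
  refine lp.ext (funext fun k => ?_)
  rw [groupX_component, groupX_component, groupX_component, groupXSector_groupXSector]

theorem adjoint_groupX (u : Spacetime n) :
    ContinuousLinearMap.adjoint (groupX V u) = groupX V (-u) := by
  refine ext_inSector fun k Ψ => ext_inner_right ℂ fun Φ => ?_
  rw [ContinuousLinearMap.adjoint_inner_left, inner_inSector_groupX, groupX_inSector]

theorem inner_groupX_right (u : Spacetime n) (Ψ Φ : Fock n m) :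
    inner ℂ Ψ (groupX V u Φ) = inner ℂ (groupX V (-u) Ψ) Φ := by
  rw [← ContinuousLinearMap.adjoint_inner_left, adjoint_groupX]

theorem inner_orbit (f : 𝓢(Spacetime n, ℂ)) {k : ℕ} (Ψ : Sector n m k) {Φ : Fock n m}
    (z : Spacetime n × Spacetime n)
    (h : groupX V (-act θ z.1) (groupX V z.2 Φ)
      ∈ (freeField f : Fock n m →ₗ.[ℂ] Fock n m).domain) :
    inner ℂ (inSector k Ψ) (orbit θ V f Φ z.1 z.2)
      = inner ℂ (fieldOp
        (fun k => conjGamma V (createMul (k := k) (sandwichWave m (-z.2 + act θ z.1) (-act θ z.1))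
          (V (minusConjVec n m f))))
        (fun k => conjGamma V
          (createMul (k := k) (sandwichWave m (act θ z.1) (-act θ z.1 + z.2)) (V (plusVec n m f))))
        k Ψ) Φ := by
  rw [orbit, inner_inSector_groupX, applyOrZero_of_mem _ h, inner_freeField, inner_groupX_right,
    inner_groupX_right, groupX_groupX, neg_neg, groupX_fieldOp_groupX, neg_neg, neg_add_rev,
    neg_neg]

/-- `Φ` is any vector of the maximal domain, perhaps with infinitely many components. Moving the
integrand onto `Ψ` leaves at most two components of `Φ`, where the limit is known, and uniqueness of
the limit identifies the two values. -/
theorem inner_of_isWarped (hθ : IsLorentzSkew θ) {f : 𝓢(Spacetime n, ℂ)} {k : ℕ}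
    (Ψ : Sector n m k) {Φ Φ' : Fock n m} (h : IsWarped θ V f Φ Φ') :
    inner ℂ (inSector k Ψ) Φ' = inner ℂ (dfield θ V (conjTest f) k Ψ) Φ := by
  have h1 := (h.hasOscLimit V).map (innerSL ℂ (inSector k Ψ))
  simp only [innerSL_apply_apply, inner_orbit V f Ψ _ (h.mem_domain _ _), inner_fieldOp] at h1
  refine h1.unique ?_
  rw [dfield, inner_fieldOp, minusConjVec_eq, minusConjVec_eq, conjTest_conjTest]
  have h2 := (hasOscLimit_adjoint_conjGamma_createMul V hθ (plusVec n m (conjTest f)) k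
    (Φ (k + 1))).map (innerSL ℂ Ψ)
  cases k with
  | zero => simpa only [add_zero, innerSL_apply_apply] using h2
  | succ k =>
    exact h2.add ((hasOscLimit_conjGamma_createMul V hθ (plusVec n m f) k (Φ k)).map
      (innerSL ℂ Ψ))

theorem IsWarped.exists_deformedField_eq {f : 𝓢(Spacetime n, ℂ)} {Ψ Φ : Fock n m}
    (h : IsWarped θ V f Ψ Φ) :
    ∃ h : Ψ ∈ (deformedField θ V f).domain, deformedField θ V f ⟨Ψ, h⟩ = Φ := by
  obtain ⟨y, hy, hy'⟩ := (deformedField θ V f).mem_graph_iff.mp (mem_graph_deformedField.mpr h)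
  obtain ⟨y, hΨ⟩ := y
  subst hy
  exact ⟨hΨ, hy'⟩

theorem isWarped_deformedField {f : 𝓢(Spacetime n, ℂ)} (Ψ : (deformedField θ V f).domain) :
    IsWarped θ V f Ψ (deformedField θ V f Ψ) :=
  mem_graph_deformedField.mp ((deformedField θ V f).mem_graph Ψ)

end Deformed

end WarpedField
end

noncomputable section
namespace WarpedField

/-! ### Density of the finite particle vectors -/

section FiniteParticle

variable {n : ℕ} {m : ℝ}

theorem inSector_mem_finiteParticle {k : ℕ} (Ψ : Sector n m k) :
    inSector k Ψ ∈ finiteParticle n m :=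
  ⟨k + 1, fun _ hi => inSector_apply_ne Ψ (by omega)⟩

theorem eq_sum_inSector {Ψ : Fock n m} {N : ℕ} (hN : ∀ k, N ≤ k → Ψ k = 0) :
    Ψ = ∑ k ∈ Finset.range N, inSector k (Ψ k) := by
  refine (hasSum_inSector Ψ).unique (hasSum_sum_of_ne_finset_zero fun k hk => ?_)
  rw [hN k (by simpa using hk)]
  exact (inSectorCLM n m k).map_zero

theorem dense_finiteParticle : Dense (finiteParticle n m : Set (Fock n m)) := by
  rw [Submodule.dense_iff_topologicalClosure_eq_top]
  exact eq_top_of_inSector_mem (Submodule.isClosed_topologicalClosure _) fun k Ψ =>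
    Submodule.le_topologicalClosure _ (inSector_mem_finiteParticle Ψ)

end FiniteParticle

/-! ### Continuous dependence on the test function -/

section Tempered

variable {n : ℕ} {m : ℝ} [hm : Fact (0 < m)]

/-- A fixed `L²` majorant: the restriction of a Schwartz function to the mass shell is bounded by a
seminorm times this function. -/
theorem memLp_one_add_norm_rpow :
    MemLp (fun p : Momentum n => (((1 + ‖p‖) ^ (-((n : ℝ) + 1)) : ℝ) : ℂ)) 2
      (shellMeasure n m) := by
  refine MemLp.of_measure_le_smul ENNReal.ofReal_ne_top (shellMeasure_le n hm.out) ?_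
  have hcont : Continuous fun p : Momentum n => (((1 + ‖p‖) ^ (-((n : ℝ) + 1)) : ℝ) : ℂ) :=
    Complex.continuous_ofReal.comp ((continuous_const.add continuous_norm).rpow_const
      fun p => Or.inl (add_pos_of_pos_of_nonneg one_pos (norm_nonneg p)).ne')
  rw [memLp_two_iff_integrable_sq_norm hcont.aestronglyMeasurable]
  refine (integrable_one_add_norm (r := (n : ℝ) + 1) (by simp)).mono'
    (hcont.norm.pow 2).aestronglyMeasurable (ae_of_all _ fun p => ?_)
  have h4 : (1 + ‖p‖) ^ (-((n : ℝ) + 1)) ≤ 1 :=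
    Real.rpow_le_one_of_one_le_of_nonpos (by linarith [norm_nonneg p]) (by linarith)
  have h5 : 0 ≤ (1 + ‖p‖) ^ (-((n : ℝ) + 1)) := by positivity
  rw [Complex.norm_real, Real.norm_of_nonneg h5, Real.norm_of_nonneg (by positivity)]
  nlinarith

/-- The restriction of a Schwartz function to a multiple of the mass shell. -/
def shellRestrict {c : ℝ} (hc : c ≠ 0) : 𝓢(Spacetime n, ℂ) →L[ℂ] OneParticle n m :=
  SchwartzMap.mkCLMtoNormedSpace (fun g => (memLp_onShell hm.out g hc).toLp)
    (fun _ _ => rfl) (fun _ _ => rfl) (by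
      set b := min |c| 1 with hb
      have hb0 : 0 < b := lt_min (abs_pos.mpr hc) one_pos
      refine ⟨Finset.Iic (n + 1, 0), 2 ^ (n + 1) * (b ^ (n + 1))⁻¹
        * ‖(memLp_one_add_norm_rpow (n := n) (m := m)).toLp‖, by positivity, fun g => ?_⟩
      set S := (Finset.Iic (n + 1, 0)).sup
        (schwartzSeminormFamily ℂ (Spacetime n) ℂ) g with hS
      have hS0 : 0 ≤ S := apply_nonneg _ _
      have hg : ∀ x, (1 + ‖x‖) ^ (n + 1) * ‖g x‖ ≤ 2 ^ (n + 1) * S := fun x => by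
        rw [← norm_iteratedFDeriv_zero (𝕜 := ℝ)]
        exact SchwartzMap.one_add_le_sup_seminorm_apply (𝕜 := ℂ) (m := (n + 1, 0))
          (k := n + 1) (n := 0) le_rfl le_rfl g x
      have key : ‖(memLp_onShell hm.out g hc).toLp‖ ≤ (2 ^ (n + 1) * S * (b ^ (n + 1))⁻¹)
          * ‖(memLp_one_add_norm_rpow (n := n) (m := m)).toLp‖ := by
        refine Lp.norm_le_mul_norm_of_ae_le_mul ?_
        filter_upwards [(memLp_onShell hm.out g hc).coeFn_toLp,
          (memLp_one_add_norm_rpow (n := n) (m := m)).coeFn_toLp] with p h1 h2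
        rw [h1, h2, Complex.norm_real, Real.norm_of_nonneg (by positivity),
          Real.rpow_neg (by positivity)]
        have h3 : (1 + ‖p‖) ^ ((n : ℝ) + 1) = (1 + ‖p‖) ^ (n + 1) := by
          rw [← Real.rpow_natCast]; norm_num
        have h4 : b * (1 + ‖p‖) ≤ 1 + ‖c • onShellDual m p‖ := by
          rw [norm_smul, Real.norm_eq_abs, mul_add, mul_one]
          exact add_le_add (min_le_right _ _) (mul_le_mul (min_le_left _ _)
            (norm_le_onShellDual m p) (norm_nonneg _) (abs_nonneg _))
        have h5 : (b * (1 + ‖p‖)) ^ (n + 1) * ‖g (c • onShellDual m p)‖ ≤ 2 ^ (n + 1) * S :=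
          le_trans (by gcongr) (hg _)
        rw [h3, mul_assoc, ← mul_inv, ← mul_pow, ← div_eq_mul_inv, le_div_iff₀ (by positivity),
          mul_comm]
        exact h5
      refine key.trans_eq ?_
      ring)

theorem shellRestrict_apply {c : ℝ} (hc : c ≠ 0) (g : 𝓢(Spacetime n, ℂ)) :
    (shellRestrict hc g : OneParticle n m) = (memLp_onShell hm.out g hc).toLp := rfl

theorem plusVec_eq_shellRestrict (f : 𝓢(Spacetime n, ℂ)) :
    plusVec n m f = shellRestrict (neg_ne_zero.mpr (inv_ne_zero Real.two_pi_pos.ne')) (𝓕 f) := by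
  rw [shellRestrict_apply, plusVec]
  exact MemLp.toLp_congr _ _ (ae_of_all _ fun p => plusFun_eq m f p)

/-- The vector itself is antilinear in `f`; only its norm can be compared with the linear
restriction map, and only the norm enters the estimates. -/
theorem norm_minusConjVec_eq (f : 𝓢(Spacetime n, ℂ)) :
    ‖minusConjVec n m f‖
      = ‖(shellRestrict (inv_ne_zero Real.two_pi_pos.ne') (𝓕 f) : OneParticle n m)‖ := by
  rw [shellRestrict_apply, minusConjVec, Lp.norm_toLp, Lp.norm_toLp]
  congr 1
  refine eLpNorm_congr_norm_ae (ae_of_all _ fun p => ?_)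
  rw [RCLike.norm_conj, minusFun_eq]

theorem plusVec_add (f g : 𝓢(Spacetime n, ℂ)) :
    plusVec n m (f + g) = plusVec n m f + plusVec n m g := by
  simp only [plusVec_eq_shellRestrict, FourierTransform.fourier_add, map_add]

theorem plusVec_smul (c : ℂ) (f : 𝓢(Spacetime n, ℂ)) :
    plusVec n m (c • f) = c • plusVec n m f := by
  simp only [plusVec_eq_shellRestrict, FourierTransform.fourier_smul, map_smul]

theorem conjTest_add (f g : 𝓢(Spacetime n, ℂ)) : conjTest (f + g) = conjTest f + conjTest g :=
  map_add _ f g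

theorem conjTest_smul (c : ℂ) (f : 𝓢(Spacetime n, ℂ)) :
    conjTest (c • f) = starRingEnd ℂ c • conjTest f := by
  ext x
  exact map_mul (starRingEnd ℂ) c (f x)

theorem minusConjVec_add (f g : 𝓢(Spacetime n, ℂ)) :
    minusConjVec n m (f + g) = minusConjVec n m f + minusConjVec n m g := by
  simp only [minusConjVec_eq, conjTest_add, plusVec_add]

theorem minusConjVec_smul (c : ℂ) (f : 𝓢(Spacetime n, ℂ)) :
    minusConjVec n m (c • f) = starRingEnd ℂ c • minusConjVec n m f := by
  simp only [minusConjVec_eq, conjTest_smul, plusVec_smul]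

theorem continuous_norm_plusVec : Continuous fun f : 𝓢(Spacetime n, ℂ) => ‖plusVec n m f‖ := by
  simp only [plusVec_eq_shellRestrict]
  exact ((shellRestrict _).continuous.comp
    (FourierTransform.fourierCLM ℂ 𝓢(Spacetime n, ℂ)).continuous).norm

theorem continuous_norm_minusConjVec :
    Continuous fun f : 𝓢(Spacetime n, ℂ) => ‖minusConjVec n m f‖ := by
  simp only [norm_minusConjVec_eq]
  exact ((shellRestrict _).continuous.comp
    (FourierTransform.fourierCLM ℂ 𝓢(Spacetime n, ℂ)).continuous).norm

variable {θ : Matrix (Fin (n + 1)) (Fin (n + 1)) ℝ} (V : OneParticle n m ≃ₗᵢ[ℂ] OneParticle n m)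

theorem dfield_add (f g : 𝓢(Spacetime n, ℂ)) (k : ℕ) (Ψ : Sector n m k) :
    dfield θ V (f + g) k Ψ = dfield θ V f k Ψ + dfield θ V g k Ψ := by
  cases k with
  | zero =>
    rw [dfield, dfield, dfield, fieldOp_zero, fieldOp_zero, fieldOp_zero, plusVec_add, dcreate_add,
      add_apply]
    exact map_add (inSectorCLM n m 1) _ _
  | succ k =>
    rw [dfield, dfield, dfield, fieldOp_succ, fieldOp_succ, fieldOp_succ, plusVec_add, dcreate_add,
      add_apply, minusConjVec_add, dcreate_add, map_add, add_apply]
    simp only [← inSectorCLM_apply, map_add]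
    abel

theorem dfield_smul (c : ℂ) (f : 𝓢(Spacetime n, ℂ)) (k : ℕ) (Ψ : Sector n m k) :
    dfield θ V (c • f) k Ψ = c • dfield θ V f k Ψ := by
  cases k with
  | zero =>
    rw [dfield, dfield, fieldOp_zero, fieldOp_zero, plusVec_smul, dcreate_smul, smul_apply]
    exact map_smul (inSectorCLM n m 1) _ _
  | succ k =>
    rw [dfield, dfield, fieldOp_succ, fieldOp_succ, plusVec_smul, dcreate_smul, smul_apply,
      minusConjVec_smul, dcreate_smul, map_smulₛₗ, Complex.conj_conj, smul_apply]
    simp only [← inSectorCLM_apply, map_smul, smul_add]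

theorem norm_dfield_le (f : 𝓢(Spacetime n, ℂ)) (k : ℕ) (Ψ : Sector n m k) :
    ‖dfield θ V f k Ψ‖ ≤ (‖plusVec n m f‖ + ‖minusConjVec n m f‖) * ((k + 1) * ‖Ψ‖) := by
  have hc : ‖inSector (k + 1) (dcreate θ V (plusVec n m f) k Ψ)‖
      ≤ ‖plusVec n m f‖ * ((k + 1) * ‖Ψ‖) := by
    rw [norm_inSector, ← mul_assoc]
    exact (ContinuousLinearMap.le_opNorm _ _).trans
      (mul_le_mul_of_nonneg_right (norm_dcreate_le V _ k) (norm_nonneg Ψ))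
  cases k with
  | zero =>
    refine hc.trans ?_
    gcongr
    exact le_add_of_nonneg_right (norm_nonneg _)
  | succ k =>
    have ha : ‖inSector k (ContinuousLinearMap.adjoint (dcreate θ V (minusConjVec n m f) k) Ψ)‖
        ≤ ‖minusConjVec n m f‖ * ((k + 1) * ‖Ψ‖) := by
      rw [norm_inSector, ← mul_assoc]
      refine (ContinuousLinearMap.le_opNorm _ _).trans
        (mul_le_mul_of_nonneg_right ?_ (norm_nonneg Ψ))
      rw [LinearIsometryEquiv.norm_map]
      exact norm_dcreate_le V _ k
    rw [dfield, fieldOp_succ, add_mul]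
    refine (norm_add_le _ _).trans (add_le_add hc (ha.trans ?_))
    push_cast
    gcongr
    linarith

/-- The vector-valued distribution `f ↦ φ_{θ,X}(f) Ψ` for `Ψ` in the `k`-particle space. -/
def dfieldCLM (θ : Matrix (Fin (n + 1)) (Fin (n + 1)) ℝ) (k : ℕ) (Ψ : Sector n m k) :
    𝓢(Spacetime n, ℂ) →L[ℂ] Fock n m where
  toFun f := dfield θ V f k Ψ
  map_add' f g := dfield_add V f g k Ψ
  map_smul' c f := dfield_smul V c f k Ψ
  cont := by
    let T : 𝓢(Spacetime n, ℂ) →ₗ[ℂ] Fock n m :=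
      { toFun := fun f => dfield θ V f k Ψ
        map_add' := fun f g => dfield_add V f g k Ψ
        map_smul' := fun c f => dfield_smul V c f k Ψ }
    refine continuous_of_continuousAt_zero T ?_
    rw [ContinuousAt, map_zero]
    refine squeeze_zero_norm (norm_dfield_le V · k Ψ) ?_
    have h : Continuous fun f : 𝓢(Spacetime n, ℂ) =>
        (‖plusVec n m f‖ + ‖minusConjVec n m f‖) * ((k + 1) * ‖Ψ‖) :=
      (continuous_norm_plusVec.add continuous_norm_minusConjVec).mul_const _
    have h0 := h.tendsto 0
    have h1 : plusVec n m (0 : 𝓢(Spacetime n, ℂ)) = 0 := by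
      simpa using plusVec_smul (m := m) (0 : ℂ) (0 : 𝓢(Spacetime n, ℂ))
    have h2 : minusConjVec n m (0 : 𝓢(Spacetime n, ℂ)) = 0 := by
      simpa using minusConjVec_smul (m := m) (0 : ℂ) (0 : 𝓢(Spacetime n, ℂ))
    simpa [h1, h2] using h0

end Tempered

/-! ### Domain, adjoint and essential self-adjointness of the deformed field -/

section FieldOnFiniteParticle

variable {n : ℕ} {m : ℝ} [Fact (0 < m)] {θ : Matrix (Fin (n + 1)) (Fin (n + 1)) ℝ}
  (V : OneParticle n m ≃ₗᵢ[ℂ] OneParticle n m)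

theorem isWarped_sum (hθ : IsLorentzSkew θ) (f : 𝓢(Spacetime n, ℂ)) (Ψ : Fock n m) (N : ℕ) :
    IsWarped θ V f (∑ k ∈ Finset.range N, inSector k (Ψ k))
      (∑ k ∈ Finset.range N, dfield θ V f k (Ψ k)) := by
  induction N with
  | zero => exact IsWarped.zero θ V f
  | succ N ih =>
    rw [Finset.sum_range_succ, Finset.sum_range_succ]
    exact ih.add (isWarped_inSector V hθ f (Ψ N))

theorem isWarped_of_eq_zero (hθ : IsLorentzSkew θ) (f : 𝓢(Spacetime n, ℂ)) {Ψ : Fock n m} {N : ℕ}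
    (hN : ∀ k, N ≤ k → Ψ k = 0) :
    IsWarped θ V f Ψ (∑ k ∈ Finset.range N, dfield θ V f k (Ψ k)) := by
  have := isWarped_sum V hθ f Ψ N
  rwa [← eq_sum_inSector hN] at this

theorem exists_forall_isWarped (hθ : IsLorentzSkew θ) {Ψ : Fock n m}
    (hΨ : Ψ ∈ finiteParticle n m) :
    ∃ N, ∀ f, IsWarped θ V f Ψ (∑ k ∈ Finset.range N, dfield θ V f k (Ψ k)) := by
  obtain ⟨N, hN⟩ := hΨ
  exact ⟨N, fun f => isWarped_of_eq_zero V hθ f hN⟩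

theorem finiteParticle_le_domain (hθ : IsLorentzSkew θ) (f : 𝓢(Spacetime n, ℂ)) :
    finiteParticle n m ≤ (deformedField θ V f).domain := fun _ hΨ =>
  ((exists_forall_isWarped V hθ hΨ).choose_spec f).exists_deformedField_eq V |>.choose

theorem IsWarped.deformedField_eq {f : 𝓢(Spacetime n, ℂ)} {Ψ : (deformedField θ V f).domain}
    {Φ : Fock n m} (h : IsWarped θ V f Ψ Φ) : deformedField θ V f Ψ = Φ :=
  (h.exists_deformedField_eq V).choose_spec

theorem deformedField_mem_finiteParticle (hθ : IsLorentzSkew θ) (f : 𝓢(Spacetime n, ℂ))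
    (Ψ : (deformedField θ V f).domain) (hΨ : (Ψ : Fock n m) ∈ finiteParticle n m) :
    deformedField θ V f Ψ ∈ finiteParticle n m := by
  obtain ⟨N, hN⟩ := exists_forall_isWarped V hθ hΨ
  rw [(hN f).deformedField_eq V]
  exact Submodule.sum_mem _ fun k _ => fieldOp_mem_finiteParticle _ _ k _

theorem deformedField_vacuum (hθ : IsLorentzSkew θ) (f : 𝓢(Spacetime n, ℂ)) :
    ∃ (h : vacuum n m ∈ (deformedField θ V f).domain) (h₀ : vacuum n m ∈ (freeField f).domain),
      deformedField θ V f ⟨vacuum n m, h⟩ = freeField f ⟨vacuum n m, h₀⟩ := by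
  obtain ⟨h, hv⟩ := (isWarped_inSector V hθ f (vacuumSector n m)).exists_deformedField_eq V
  refine ⟨h, inSector_mem_freeField_domain f _, hv.trans ?_⟩
  refine Eq.trans ?_ (freeField_inSector f (vacuumSector n m)).symm
  rw [dfield, fieldOp_zero, fieldOp_zero, dcreate_zero_right]

theorem exists_deformedField_clm (hθ : IsLorentzSkew θ) {Ψ : Fock n m}
    (hΨ : Ψ ∈ finiteParticle n m) :
    ∃ T : 𝓢(Spacetime n, ℂ) →L[ℂ] Fock n m, ∀ f : 𝓢(Spacetime n, ℂ),
      ∃ h : Ψ ∈ (deformedField θ V f).domain, deformedField θ V f ⟨Ψ, h⟩ = T f := by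
  obtain ⟨N, hN⟩ := exists_forall_isWarped V hθ hΨ
  refine ⟨∑ k ∈ Finset.range N, dfieldCLM V θ k (Ψ k), fun f => ?_⟩
  rw [sum_apply]
  exact (hN f).exists_deformedField_eq V

theorem inner_deformedField_right (hθ : IsLorentzSkew θ) (f : 𝓢(Spacetime n, ℂ))
    (Ψ : (deformedField θ V (conjTest f)).domain) (hΨ : (Ψ : Fock n m) ∈ finiteParticle n m)
    (Φ : (deformedField θ V f).domain) :
    inner ℂ (Ψ : Fock n m) (deformedField θ V f Φ)
      = inner ℂ (deformedField θ V (conjTest f) Ψ) (Φ : Fock n m) := by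
  obtain ⟨Ψ, hd⟩ := Ψ
  obtain ⟨N, hN⟩ := hΨ
  have h1 := isWarped_of_eq_zero V hθ (conjTest f) hN
  replace hN := eq_sum_inSector hN
  simp only at hN h1
  rw [IsWarped.deformedField_eq V (Ψ := ⟨Ψ, hd⟩) h1]
  change inner ℂ Ψ _ = _
  rw [sum_inner, hN, sum_inner]
  refine Finset.sum_congr rfl fun k _ => ?_
  rw [inner_of_isWarped V hθ _ (isWarped_deformedField V Φ), ← hN]

theorem dense_deformedField_domain (hθ : IsLorentzSkew θ) (f : 𝓢(Spacetime n, ℂ)) :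
    Dense ((deformedField θ V f).domain : Set (Fock n m)) :=
  dense_finiteParticle.mono (finiteParticle_le_domain V hθ f)

theorem adjoint_deformedField (hθ : IsLorentzSkew θ) (f : 𝓢(Spacetime n, ℂ)) {Ψ : Fock n m}
    (hΨ : Ψ ∈ finiteParticle n m) :
    ∃ (h : Ψ ∈ (LinearPMap.adjoint (deformedField θ V f)).domain)
      (h' : Ψ ∈ (deformedField θ V (conjTest f)).domain),
      LinearPMap.adjoint (deformedField θ V f) ⟨Ψ, h⟩
        = deformedField θ V (conjTest f) ⟨Ψ, h'⟩ := by
  have h' := finiteParticle_le_domain V hθ (conjTest f) hΨ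
  have key := fun Φ => (inner_deformedField_right V hθ f ⟨Ψ, h'⟩ hΨ Φ).symm
  exact ⟨LinearPMap.mem_adjoint_domain_of_exists _ ⟨_, key⟩, h',
    LinearPMap.adjoint_apply_eq (dense_deformedField_domain V hθ f) _ key⟩

theorem isEssentiallySelfAdjoint_deformedField (hθ : IsLorentzSkew θ) {f : 𝓢(Spacetime n, ℂ)}
    (hf : ∀ x, (f x).im = 0) :
    IsEssentiallySelfAdjoint ((deformedField θ V f).domRestrict (finiteParticle n m)) := by
  have hconj : conjTest f = f := by
    ext x
    exact Complex.conj_eq_iff_im.mpr (hf x)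
  have happ : ∀ x : ((deformedField θ V f).domRestrict (finiteParticle n m)).domain,
      (deformedField θ V f).domRestrict (finiteParticle n m) x
        = deformedField θ V f ⟨x.1, x.2.2⟩ := fun x => LinearPMap.domRestrict_apply rfl
  have hin := inner_deformedField_right V hθ f
  rw [hconj] at hin
  refine isEssentiallySelfAdjoint_of_deficiency ?_ (fun x y => ?_) fun c hc hc0 Ψ hΨ => ?_
  · refine dense_finiteParticle.mono fun Ψ hΨ => ?_
    exact ⟨hΨ, finiteParticle_le_domain V hθ f hΨ⟩
  · rw [happ, happ]
    exact (hin ⟨x.1, x.2.2⟩ x.2.1 ⟨y.1, y.2.2⟩).symm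
  · have hcomp : ∀ k (Φ : Sector n m k),
        inner ℂ (dfield θ V f k Φ) Ψ = inner ℂ Φ (c • Ψ k) := fun k Φ => by
      have hD := inSector_mem_finiteParticle Φ
      have h1 := hΨ ⟨inSector k Φ, hD, finiteParticle_le_domain V hθ f hD⟩
      rw [happ, IsWarped.deformedField_eq V (Ψ := ⟨inSector k Φ, _⟩)
        (isWarped_inSector V hθ f Φ)] at h1
      exact h1.trans (inner_inSector_left Φ (c • Ψ))
    -- For real `f` the field has the form `A + A*`, as the Jacobi criterion requires.
    have hm' : minusConjVec n m f = plusVec n m f := by rw [minusConjVec_eq, hconj]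
    refine eq_zero_of_jacobi_eigenvector (dcreate θ V (plusVec n m f)) (C := ‖plusVec n m f‖)
      (norm_dcreate_le V _) hc hc0 Ψ ?_ fun k => ?_
    · refine ext_inner_left ℂ fun Φ => ?_
      rw [← hcomp, dfield, inner_fieldOp, add_zero]
    · refine ext_inner_left ℂ fun Φ => ?_
      rw [← hcomp, dfield, inner_fieldOp, inner_add_right, hm']

end FieldOnFiniteParticle

end WarpedField
end

noncomputable section
namespace WarpedField

/-! ### Uniqueness of holomorphic functions from boundary values -/

section BoundaryUniqueness

open Complex

/-- A function on a square, holomorphic inside and continuous up to the boundary, vanishes if it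
vanishes on one of the sides. -/
theorem eqOn_zero_of_eq_zero_on_side {G : ℂ → ℂ} {a : ℝ} (ha : 0 < a)
    (hG : DiffContOnCl ℂ G (Set.Ioo (-a) a ×ℂ Set.Ioo 0 (2 * a)))
    (h0 : ∀ x ∈ Set.Icc (-a) a, G (x : ℂ) = 0) :
    ∀ z ∈ Set.Ioo (-a) a ×ℂ Set.Ioo 0 (2 * a), G z = 0 := by
  set U : Set ℂ := Set.Ioo (-a) a ×ℂ Set.Ioo 0 (2 * a) with hU
  have hUo : IsOpen U := isOpen_Ioo.reProdIm isOpen_Ioo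
  have hUc : Convex ℝ U := ((convex_Ioo (-a) a).linear_preimage Complex.reLm).inter
    ((convex_Ioo 0 (2 * a)).linear_preimage Complex.imLm)
  have hcl : closure U = Set.Icc (-a) a ×ℂ Set.Icc 0 (2 * a) := by
    rw [hU, closure_reProdIm, closure_Ioo (by linarith), closure_Ioo (by linarith)]
  have hbd : Bornology.IsBounded U :=
    (Metric.isBounded_Ioo _ _).reProdIm (Metric.isBounded_Ioo _ _)
  -- The quarter turn about the centre `ia` of the square.
  let R : ℂ → ℂ := fun z => I * z + (a + I * a)
  have hre : ∀ z, (R z).re = a - z.im := fun z => by simp [R]; ring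
  have him : ∀ z, (R z).im = z.re + a := fun z => by simp [R]
  have hRU : Set.MapsTo R U U := fun z hz => by
    obtain ⟨⟨h1, h2⟩, h3, h4⟩ := hz
    refine ⟨⟨?_, ?_⟩, ?_, ?_⟩ <;> simp only [hre, him] <;> linarith
  have hRd : Differentiable ℂ R := (differentiable_id.const_mul I).add_const _
  have hcomp : ∀ {F : ℂ → ℂ}, DiffContOnCl ℂ F U → DiffContOnCl ℂ (fun z => F (R z)) U :=
    fun hF => hF.comp hRd.diffContOnCl hRU
  have han : ∀ {F : ℂ → ℂ}, DiffContOnCl ℂ F U → AnalyticOnNhd ℂ F U :=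
    fun hF => hF.differentiableOn.analyticOnNhd hUo
  have hinv : ∀ {F : ℂ → ℂ}, (∀ z ∈ U, F (R z) = 0) → ∀ z ∈ U, F z = 0 := fun hF z hz => by
    have h4 : R (R (R (R z))) = z := by
      apply Complex.ext <;> simp only [hre, him] <;> ring
    rw [← h4]
    exact hF _ (hRU (hRU (hRU hz)))
  have hG1 := hcomp hG
  have hG2 := hcomp hG1
  have hG3 := hcomp hG2
  -- On each side one of the four rotated copies of `G` vanishes, so the product vanishes on the
  -- whole boundary, hence inside by the maximum principle. Then one factor vanishes identically,
  -- and the rotations carry this back to `G`.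
  have hprod : ∀ z ∈ U, G z * (G (R z) * (G (R (R z)) * G (R (R (R z))))) = 0 := by
    refine Complex.eqOn_of_eqOn_frontier hbd (hG.smul (hG1.smul (hG2.smul hG3)))
      diffContOnCl_const (g := fun _ => 0) fun z hz => ?_
    have hside : ∀ w : ℂ, w.im = 0 → w.re ∈ Set.Icc (-a) a → G w = 0 := fun w hw hw' => by
      have : w = (w.re : ℂ) := Complex.ext rfl (by simp [hw])
      rw [this]
      exact h0 _ hw'
    have hzc : z ∈ closure U := frontier_subset_closure hz
    rw [hcl] at hzc
    obtain ⟨⟨h1, h2⟩, h3, h4⟩ := hzc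
    have hnot : z ∉ U := fun h => (hUo.frontier_eq ▸ hz).2 h
    change G z * (G (R z) * (G (R (R z)) * G (R (R (R z))))) = 0
    by_cases c1 : z.im = 0
    · rw [hside z c1 ⟨h1, h2⟩, zero_mul]
    by_cases c2 : z.re = -a
    · rw [hside (R z), zero_mul, mul_zero]
      · rw [him, c2]; ring
      · rw [hre]; exact ⟨by linarith, by linarith⟩
    by_cases c3 : z.im = 2 * a
    · rw [hside (R (R z)), zero_mul, mul_zero, mul_zero]
      · rw [him, hre, c3]; ring
      · rw [hre, him]; exact ⟨by linarith, by linarith⟩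
    by_cases c4 : z.re = a
    · rw [hside (R (R (R z))), mul_zero, mul_zero, mul_zero]
      · rw [him, hre, him, c4]; ring
      · rw [hre, him, hre]; exact ⟨by linarith, by linarith⟩
    exact absurd ⟨⟨lt_of_le_of_ne h1 (Ne.symm c2), lt_of_le_of_ne h2 c4⟩,
      lt_of_le_of_ne h3 (Ne.symm c1), lt_of_le_of_ne h4 c3⟩ hnot
  have hpre := hUc.isPreconnected
  have hG3a := han hG3
  have hG2a := han hG2
  have hG1a := han hG1
  rcases (han hG).eq_zero_or_eq_zero_of_mul_eq_zero (hG1a.mul (hG2a.mul hG3a)) hprod hpre with h | h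
  · exact h
  rcases hG1a.eq_zero_or_eq_zero_of_mul_eq_zero (hG2a.mul hG3a) h hpre with h | h
  · exact hinv h
  rcases hG2a.eq_zero_or_eq_zero_of_mul_eq_zero hG3a h hpre with h | h
  · exact hinv (F := G) (hinv (F := fun z => G (R z)) h)
  · exact hinv (F := G) (hinv (F := fun z => G (R z)) (hinv (F := fun z => G (R (R z))) h))

/-- A function on the closed upper half plane, holomorphic inside and continuous up to the boundary,
vanishes if it vanishes on a real interval. -/
theorem eq_zero_of_eq_zero_on_interval {G : ℂ → ℂ} (hd : DifferentiableOn ℂ G {z | 0 < z.im})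
    (hc : ContinuousOn G {z | 0 ≤ z.im}) {δ : ℝ} (hδ : 0 < δ)
    (h0 : ∀ x : ℝ, |x| < δ → G x = 0) {z : ℂ} (hz : 0 < z.im) : G z = 0 := by
  -- Halving keeps the closed side of the square inside the open interval.
  set a := δ / 2 with ha
  have ha0 : 0 < a := by positivity
  have hopen : IsOpen {z : ℂ | 0 < z.im} := isOpen_lt continuous_const continuous_im
  have hsq := eqOn_zero_of_eq_zero_on_side (G := G) ha0 (DiffContOnCl.mk
    (hd.mono fun w hw => hw.2.1) (hc.mono ?_)) fun x hx => h0 x ?_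
  · have hpre : IsPreconnected {z : ℂ | 0 < z.im} := (convex_halfSpace_im_gt 0).isPreconnected
    have hmem : I * a ∈ {z : ℂ | 0 < z.im} := by simpa using ha0
    refine (hd.analyticOnNhd hopen).eqOn_zero_of_preconnected_of_eventuallyEq_zero hpre hmem ?_ hz
    have hUo : IsOpen (Set.Ioo (-a) a ×ℂ Set.Ioo 0 (2 * a)) := isOpen_Ioo.reProdIm isOpen_Ioo
    filter_upwards [hUo.mem_nhds (show I * a ∈ _ from
      ⟨by simp [ha0], by simp [ha0]⟩)] with w hw using hsq w hw
  · rw [closure_reProdIm, closure_Ioo (by linarith), closure_Ioo (by linarith)]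
    exact fun w hw => hw.2.1
  · exact (abs_le.mpr hx).trans_lt (by linarith)

end BoundaryUniqueness

/-! ### Holomorphic integrals and Fourier injectivity -/

section Laplace

variable {Y : Type*} [MeasurableSpace Y] {ρ : Measure Y}

/-- Holomorphy of `z ↦ ∫ k e^{zψ} dρ`. -/
theorem differentiableOn_integral_mul_exp {k ψ : Y → ℂ} (hk : AEStronglyMeasurable k ρ)
    (hψ : Measurable ψ) {U : Set ℂ} (hU : IsOpen U) {b b' : Y → ℝ} (hb : Integrable b ρ)
    (hb' : Integrable b' ρ)
    (h : ∀ z ∈ U, ∀ p, ‖k p * Complex.exp (z * ψ p)‖ ≤ b p)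
    (h' : ∀ z ∈ U, ∀ p, ‖k p * (ψ p * Complex.exp (z * ψ p))‖ ≤ b' p) :
    DifferentiableOn ℂ (fun z => ∫ p, k p * Complex.exp (z * ψ p) ∂ρ) U := by
  intro z hz
  have hmeas : ∀ z : ℂ, AEStronglyMeasurable (fun p => k p * Complex.exp (z * ψ p)) ρ := fun z =>
    hk.mul (Complex.measurable_exp.comp (hψ.const_mul z)).aestronglyMeasurable
  refine (hasDerivAt_integral_of_dominated_loc_of_deriv_le (𝕜 := ℂ) (hU.mem_nhds hz)
    (Eventually.of_forall hmeas) (hb.mono' (hmeas z) (ae_of_all _ (h z hz)))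
    (F' := fun z p => k p * (ψ p * Complex.exp (z * ψ p))) ?_
    (ae_of_all _ fun p z hz => h' z hz p) hb'
    (ae_of_all _ fun p z _ => ?_)).2.differentiableAt.differentiableWithinAt
  · exact hk.mul (hψ.mul (Complex.measurable_exp.comp (hψ.const_mul z))).aestronglyMeasurable
  · have := ((hasDerivAt_mul_const (x := z) (ψ p)).cexp).const_mul (k p)
    rwa [mul_comm (ψ p)]

/-- If the Fourier transform of an integrable function vanishes then so does the function. -/
theorem ae_eq_zero_of_fourier_eq_zero {E : Type*} [NormedAddCommGroup E] [InnerProductSpace ℝ E]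
    [FiniteDimensional ℝ E] [MeasurableSpace E] [BorelSpace E] {k : E → ℂ} (hk : Integrable k)
    (h : ∀ v : E, ∫ p, k p * Complex.exp (-(Complex.I * (inner ℝ p v : ℝ))) = 0) :
    ∀ᵐ p, k p = 0 := by
  have hF : 𝓕 k = 0 := by
    funext w
    rw [Real.fourier_eq', Pi.zero_apply, ← h ((2 * Real.pi) • w)]
    congr 1 with p
    rw [inner_smul_right, smul_eq_mul, mul_comm]
    congr 2
    push_cast
    ring
  refine ae_eq_zero_of_integral_contDiff_smul_eq_zero hk.locallyIntegrable fun g hg hgs => ?_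
  let g' : 𝓢(E, ℂ) := (hgs.comp_left (g := fun r : ℝ => (r : ℂ)) (by simp)).toSchwartzMap
    (Complex.ofRealCLM.contDiff.comp hg)
  let φ : 𝓢(E, ℂ) := 𝓕⁻ g'
  -- The exchange formula `∫ 𝓕φ · k = ∫ φ · 𝓕k`, with `φ` the inverse transform of the test function
  -- `g`.
  have h1 := VectorFourier.integral_fourierIntegral_smul_eq_flip (L := innerₗ E)
    Real.continuous_fourierChar continuous_inner (f := ⇑φ) (g := k)
    (φ.integrable (μ := volume)) hk
  have h2 : VectorFourier.fourierIntegral Real.fourierChar volume (innerₗ E) ⇑φ = g' := by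
    change 𝓕 ⇑φ = g'
    rw [← SchwartzMap.fourier_coe, FourierTransform.fourier_fourierInv_eq]
  have h3 : VectorFourier.fourierIntegral Real.fourierChar volume (innerₗ E).flip k = 0 := by
    rw [flip_innerₗ]
    exact hF
  rw [h2, h3] at h1
  simp only [Pi.zero_apply, smul_zero, integral_zero] at h1
  refine Eq.trans (integral_congr_ae (ae_of_all _ fun x => ?_)) h1
  exact Complex.real_smul

end Laplace

end WarpedField
end

noncomputable section
namespace WarpedField

/-! ### Vanishing from small translations on the mass shell -/

section OneParticleUniqueness

variable {n : ℕ} {m : ℝ}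

theorem continuous_energy : Continuous (energy m : Momentum n → ℝ) := by
  unfold energy; fun_prop

theorem norm_le_energy (p : Momentum n) : ‖p‖ ≤ energy m p :=
  Real.le_sqrt_of_sq_le (by nlinarith [sq_nonneg m])

theorem energy_nonneg (p : Momentum n) : 0 ≤ energy m p := Real.sqrt_nonneg _

theorem energy_pos [hm : Fact (0 < m)] (p : Momentum n) : 0 < energy m p :=
  Real.sqrt_pos.mpr (by have := hm.out; positivity)

theorem mul_exp_neg_mul_le {s : ℝ} (hs : 0 < s) (x : ℝ) : x * Real.exp (-(s * x)) ≤ s⁻¹ := by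
  rw [Real.exp_neg, ← div_eq_mul_inv, div_le_iff₀ (Real.exp_pos _)]
  have := Real.add_one_le_exp (s * x)
  rw [inv_mul_eq_div, le_div_iff₀ hs]
  linarith

theorem norm_exp_mul_I_mul (z : ℂ) (x : ℝ) :
    ‖Complex.exp (z * (Complex.I * (x : ℝ)))‖ = Real.exp (-(z.im * x)) := by
  rw [Complex.norm_exp]
  congr 1
  simp

/-- Positivity of the energy makes the time dependence the boundary value of a function holomorphic
in the upper half plane. It vanishes there, in particular at `z = i`, where `e^{izω} = e^{-ω}`. -/
theorem integral_time_eq_zero {k : Momentum n → ℂ} (hk : Integrable k (shellMeasure n m)) {r : ℝ}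
    (hr : 0 < r) (h : ∀ t : ℝ, |t| < r →
      ∫ p, k p * Complex.exp (t * (Complex.I * (energy m p : ℝ))) ∂shellMeasure n m = 0) :
    ∫ p, k p * Complex.exp (-(energy m p : ℝ)) ∂shellMeasure n m = 0 := by
  have hω : Measurable fun p : Momentum n => Complex.I * (energy m p : ℂ) :=
    (Complex.measurable_ofReal.comp continuous_energy.measurable).const_mul _
  have hle : ∀ z : ℂ, 0 ≤ z.im → ∀ p : Momentum n,
      ‖k p * Complex.exp (z * (Complex.I * (energy m p : ℝ)))‖ ≤ ‖k p‖ := fun z hz p => by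
    rw [norm_mul, norm_exp_mul_I_mul]
    refine mul_le_of_le_one_right (norm_nonneg _) (Real.exp_le_one_iff.mpr ?_)
    exact neg_nonpos.mpr (mul_nonneg hz (energy_nonneg p))
  have hd : DifferentiableOn ℂ (fun z : ℂ =>
      ∫ p, k p * Complex.exp (z * (Complex.I * (energy m p : ℝ))) ∂shellMeasure n m)
      {z | 0 < z.im} := fun z hz => by
    have hz' : 0 < z.im := hz
    -- On the half plane `Im w > s` the factor `ω` from differentiation is absorbed by the
    -- exponential at the cost of `s⁻¹`.
    set s := z.im / 2
    have hs : 0 < s := by positivity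
    have hU : IsOpen {w : ℂ | s < w.im} := isOpen_lt continuous_const Complex.continuous_im
    have hzU : z ∈ {w : ℂ | s < w.im} := show z.im / 2 < z.im by linarith
    refine ((differentiableOn_integral_mul_exp hk.1 hω hU hk.norm (hk.norm.const_mul s⁻¹)
      (fun w hw => hle w (hs.trans hw).le) fun w hw p => ?_).differentiableAt
        (hU.mem_nhds hzU)).differentiableWithinAt
    rw [norm_mul, norm_mul, norm_exp_mul_I_mul, norm_mul, Complex.norm_I, one_mul,
      Complex.norm_real, Real.norm_of_nonneg (energy_nonneg p), mul_comm]
    refine mul_le_mul_of_nonneg_right (le_trans ?_ (mul_exp_neg_mul_le hs (energy m p)))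
      (norm_nonneg _)
    have : s * energy m p ≤ w.im * energy m p :=
      mul_le_mul_of_nonneg_right (le_of_lt hw) (energy_nonneg p)
    exact mul_le_mul_of_nonneg_left (Real.exp_le_exp.mpr (neg_le_neg this)) (energy_nonneg p)
  have hc : ContinuousOn (fun z : ℂ =>
      ∫ p, k p * Complex.exp (z * (Complex.I * (energy m p : ℝ))) ∂shellMeasure n m)
      {z | 0 ≤ z.im} := by
    refine continuousOn_of_dominated (bound := fun p => ‖k p‖) (fun z _ => ?_)
      (fun z hz => ae_of_all _ (hle z hz)) hk.norm (ae_of_all _ fun p => ?_)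
    · exact hk.1.mul (Complex.measurable_exp.comp (hω.const_mul z)).aestronglyMeasurable
    · fun_prop
  have h0 := eq_zero_of_eq_zero_on_interval hd hc hr h (z := Complex.I) (by simp)
  rw [← h0]
  congr 1 with p
  rw [← mul_assoc, Complex.I_mul_I, neg_one_mul]

/-- Since `|p| ≤ ω`, the damping `e^{-ω}` makes the integral analytic along the line through `v`, so
vanishing near the origin propagates to `v`. -/
theorem integral_space_eq_zero {k : Momentum n → ℂ} (hk : Integrable k (shellMeasure n m)) {r : ℝ}
    (hr : 0 < r) (h : ∀ v : Momentum n, ‖v‖ < r →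
      ∫ p, k p * Complex.exp (-(energy m p : ℝ)) *
        Complex.exp (-(Complex.I * (inner ℝ p v : ℝ))) ∂shellMeasure n m = 0)
    (v : Momentum n) :
    ∫ p, k p * Complex.exp (-(energy m p : ℝ)) *
      Complex.exp (-(Complex.I * (inner ℝ p v : ℝ))) ∂shellMeasure n m = 0 := by
  -- In the strip `|Im z| < c` the growth is at most `e^{ω/2}`, half of the damping. The `+ 1`
  -- covers `v = 0`.
  set c := (2 * (‖v‖ + 1))⁻¹ with hc
  have hc0 : 0 < c := by positivity
  have hcv : c * ‖v‖ ≤ 1 / 2 := by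
    rw [hc, inv_mul_eq_div, div_le_div_iff₀ (by positivity) (by positivity)]
    linarith
  have hq : ∀ p : Momentum n, |inner ℝ p (-v)| ≤ ‖v‖ * energy m p := fun p => by
    rw [inner_neg_right, abs_neg, mul_comm]
    exact (abs_real_inner_le_norm p v).trans
      (mul_le_mul_of_nonneg_right (norm_le_energy p) (norm_nonneg _))
  have hmω : Measurable fun p : Momentum n => Complex.exp (-(energy m p : ℝ)) :=
    Complex.measurable_exp.comp
      (Complex.measurable_ofReal.comp continuous_energy.measurable).neg
  have hmψ : Measurable fun p : Momentum n => Complex.I * ((inner ℝ p (-v) : ℝ) : ℂ) := by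
    have : Continuous fun p : Momentum n => Complex.I * ((inner ℝ p (-v) : ℝ) : ℂ) := by fun_prop
    exact this.measurable
  set U : Set ℂ := Complex.im ⁻¹' Set.Ioo (-c) c with hU
  have hUo : IsOpen U := isOpen_Ioo.preimage Complex.continuous_im
  have hUc : IsPreconnected U :=
    ((convex_Ioo (-c) c).linear_preimage Complex.imLm).isPreconnected
  have hexp : ∀ z ∈ U, ∀ p : Momentum n,
      ‖Complex.exp (-(energy m p : ℝ)) * Complex.exp (z * (Complex.I * (inner ℝ p (-v) : ℝ)))‖
        ≤ Real.exp (-((1 / 2) * energy m p)) := fun z hz p => by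
    rw [norm_mul, norm_exp_mul_I_mul, Complex.norm_exp, ← Real.exp_add]
    refine Real.exp_le_exp.mpr ?_
    have h1 : -(z.im * inner ℝ p (-v)) ≤ c * (‖v‖ * energy m p) := by
      refine (neg_le_abs _).trans ?_
      rw [abs_mul]
      exact mul_le_mul (abs_le.mpr ⟨hz.1.le, hz.2.le⟩) (hq p) (abs_nonneg _) hc0.le
    have h2 : c * (‖v‖ * energy m p) ≤ 1 / 2 * energy m p := by
      rw [← mul_assoc]
      exact mul_le_mul_of_nonneg_right hcv (energy_nonneg p)
    simp only [Complex.neg_re, Complex.ofReal_re]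
    linarith
  have hd : DifferentiableOn ℂ (fun z : ℂ =>
      ∫ p, k p * Complex.exp (-(energy m p : ℝ)) *
        Complex.exp (z * (Complex.I * (inner ℝ p (-v) : ℝ))) ∂shellMeasure n m) U := by
    refine differentiableOn_integral_mul_exp (hk.1.mul hmω.aestronglyMeasurable) hmψ hUo hk.norm
      (hk.norm.const_mul (‖v‖ * (1 / 2)⁻¹)) (fun z hz p => ?_) fun z hz p => ?_
    · rw [Pi.mul_apply, mul_assoc, norm_mul]
      refine mul_le_of_le_one_right (norm_nonneg _) ((hexp z hz p).trans ?_)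
      exact Real.exp_le_one_iff.mpr (by have := energy_nonneg (m := m) p; linarith)
    · rw [Pi.mul_apply, mul_assoc, mul_left_comm (Complex.exp _) (Complex.I * _), norm_mul, mul_comm,
        norm_mul]
      refine mul_le_mul_of_nonneg_right ?_ (norm_nonneg _)
      rw [norm_mul, Complex.norm_I, one_mul, Complex.norm_real, Real.norm_eq_abs]
      calc |inner ℝ p (-v)| * _
          ≤ (‖v‖ * energy m p) * Real.exp (-((1 / 2) * energy m p)) :=
            mul_le_mul (hq p) (hexp z hz p) (norm_nonneg _) ((abs_nonneg _).trans (hq p))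
        _ ≤ ‖v‖ * (1 / 2)⁻¹ := by
            rw [mul_assoc]
            exact mul_le_mul_of_nonneg_left (mul_exp_neg_mul_le (by norm_num) _) (norm_nonneg _)
  have hmem : ∀ x : ℝ, (x : ℂ) ∈ U := fun x => by simp [hU, hc0]
  have hfreq : ∃ᶠ z in 𝓝[≠] (0 : ℂ), ∫ p, k p * Complex.exp (-(energy m p : ℝ)) *
        Complex.exp (z * (Complex.I * (inner ℝ p (-v) : ℝ))) ∂shellMeasure n m = 0 := by
    have ht : Tendsto (fun x : ℝ => (x : ℂ)) (𝓝[>] 0) (𝓝[≠] 0) := by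
      refine tendsto_nhdsWithin_iff.mpr ⟨?_, ?_⟩
      · exact (Complex.continuous_ofReal.tendsto' 0 0 (by simp)).mono_left nhdsWithin_le_nhds
      · filter_upwards [self_mem_nhdsWithin] with x hx
        exact Complex.ofReal_ne_zero.mpr (ne_of_gt hx)
    refine ht.frequently (Eventually.frequently ?_)
    have hsmall : ∀ᶠ x in 𝓝[>] (0 : ℝ), ‖x • v‖ < r := by
      have : Tendsto (fun x : ℝ => ‖x • v‖) (𝓝[>] 0) (𝓝 0) := by
        have h1 : Continuous fun x : ℝ => ‖x • v‖ := by fun_prop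
        exact (h1.tendsto' 0 0 (by simp)).mono_left nhdsWithin_le_nhds
      exact this.eventually (gt_mem_nhds hr)
    filter_upwards [hsmall] with x hx
    rw [← h (x • v) hx]
    congr 1 with p
    rw [inner_smul_right, inner_neg_right]
    push_cast
    ring_nf
  have hz := (hd.analyticOnNhd hUo).eqOn_zero_of_preconnected_of_frequently_eq_zero hUc
    (by simpa using hmem 0) hfreq (by simpa using hmem 1 : (1 : ℂ) ∈ U)
  refine Eq.trans ?_ hz
  congr 1 with p
  rw [inner_neg_right]
  push_cast
  ring_nf

theorem measurable_shellDensity :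
    Measurable fun p : Momentum n => ENNReal.ofReal (1 / (2 * energy m p)) :=
  ENNReal.measurable_ofReal.comp
    (measurable_const.div (continuous_energy.measurable.const_mul 2))

variable [hm : Fact (0 < m)]

/-- Apply the time argument to `k e^{-ip·v}` for each small `v`, then the space argument. The
Fourier transform of `k e^{-ω}` times the density is then zero, and both factors are nowhere zero.
-/
theorem ae_eq_zero_of_integral_eq_zero {k : Momentum n → ℂ} (hk : Integrable k (shellMeasure n m))
    {r : ℝ} (hr : 0 < r)
    (h : ∀ (t : ℝ) (v : Momentum n), |t| < r → ‖v‖ < r →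
      ∫ p, k p * Complex.exp (Complex.I * (energy m p * t - inner ℝ p v : ℝ)) ∂shellMeasure n m
        = 0) :
    ∀ᵐ p ∂shellMeasure n m, k p = 0 := by
  have hm1 : ∀ v : Momentum n,
      Measurable fun p : Momentum n => Complex.exp (-(Complex.I * (inner ℝ p v : ℝ))) := fun v => by
    have : Continuous fun p : Momentum n =>
      Complex.exp (-(Complex.I * (inner ℝ p v : ℝ))) := by fun_prop
    exact this.measurable
  have hn1 : ∀ (v : Momentum n) p, ‖Complex.exp (-(Complex.I * (inner ℝ p v : ℝ)))‖ = 1 :=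
    fun v p => by
      rw [← mul_neg, ← Complex.ofReal_neg, mul_comm, Complex.norm_exp_ofReal_mul_I]
  have h1 : ∀ v : Momentum n, ‖v‖ < r → ∫ p, k p * Complex.exp (-(energy m p : ℝ)) *
      Complex.exp (-(Complex.I * (inner ℝ p v : ℝ))) ∂shellMeasure n m = 0 := fun v hv => by
    have hk' : Integrable (fun p => k p * Complex.exp (-(Complex.I * (inner ℝ p v : ℝ))))
        (shellMeasure n m) :=
      hk.mono (hk.1.mul (hm1 v).aestronglyMeasurable) (ae_of_all _ fun p => by
        rw [norm_mul, hn1, mul_one])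
    rw [← integral_time_eq_zero hk' hr fun t ht => ?_]
    · congr 1 with p
      ring
    · rw [← h t v ht hv]
      congr 1 with p
      rw [mul_assoc, ← Complex.exp_add]
      congr 2
      push_cast
      ring
  have h2 := integral_space_eq_zero hk hr h1
  have hmω : Measurable fun p : Momentum n => Complex.exp (-(energy m p : ℝ)) :=
    Complex.measurable_exp.comp
      (Complex.measurable_ofReal.comp continuous_energy.measurable).neg
  have hk2 : Integrable (fun p => k p * Complex.exp (-(energy m p : ℝ))) (shellMeasure n m) :=
    hk.mono (hk.1.mul hmω.aestronglyMeasurable) (ae_of_all _ fun p => by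
      rw [norm_mul, Complex.norm_exp]
      refine mul_le_of_le_one_right (norm_nonneg _) (Real.exp_le_one_iff.mpr ?_)
      simpa using energy_nonneg p)
  rw [shellMeasure, integrable_withDensity_iff_integrable_smul' measurable_shellDensity
    (ae_of_all _ fun p => ENNReal.ofReal_lt_top)] at hk2
  have h3 := ae_eq_zero_of_fourier_eq_zero hk2 fun v => by
    have := h2 v
    rw [shellMeasure, integral_withDensity_eq_integral_toReal_smul measurable_shellDensity
      (ae_of_all _ fun p => ENNReal.ofReal_lt_top)] at this
    simpa only [smul_mul_assoc] using this
  refine (withDensity_absolutelyContinuous volume _).ae_le ?_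
  filter_upwards [h3] with p hp
  have hpos : 0 < 1 / (2 * energy m p) := by have := energy_pos (m := m) p; positivity
  rw [ENNReal.toReal_ofReal hpos.le, smul_eq_zero_iff_right hpos.ne'] at hp
  exact (mul_eq_zero.mp hp).resolve_right (Complex.exp_ne_zero _)

end OneParticleUniqueness

/-! ### Totality of localized one-particle vectors -/

section OneParticleDensity

variable {n : ℕ} {m : ℝ}

/-- The space-time point with time `t` and position `v`. -/
def spacetimePoint (t : ℝ) (v : Momentum n) : Spacetime n :=
  WithLp.toLp 2 (Fin.cons t fun i => v i)

theorem mink_onShell_spacetimePoint (p : Momentum n) (t : ℝ) (v : Momentum n) :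
    mink (onShell m p) (spacetimePoint t v) = energy m p * t - inner ℝ p v := by
  simp [mink, onShell, spacetimePoint, PiLp.inner_apply, mul_comm]

theorem norm_spacetimePoint_le (t : ℝ) (v : Momentum n) : ‖spacetimePoint t v‖ ≤ |t| + ‖v‖ := by
  have h1 : ‖spacetimePoint t v‖ ^ 2 = t ^ 2 + ‖v‖ ^ 2 := by
    rw [EuclideanSpace.norm_sq_eq, EuclideanSpace.norm_sq_eq, Fin.sum_univ_succ]
    simp [spacetimePoint]
  refine abs_le_of_sq_le_sq' ?_ (by positivity) |>.2
  rw [h1, ← sq_abs t]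
  nlinarith [abs_nonneg t, norm_nonneg v]

theorem plusFun_compSubConst (f : 𝓢(Spacetime n, ℂ)) (a : Spacetime n) (p : Momentum n) :
    plusFun m (SchwartzMap.compSubConstCLM ℝ a f) p
      = plusFun m f p * Complex.exp (Complex.I * (mink (onShell m p) a : ℝ)) := by
  rw [plusFun, plusFun, ← integral_mul_const,
    ← integral_sub_right_eq_self (fun x => f x * Complex.exp (Complex.I *
      (mink (onShell m p) x : ℝ)) * Complex.exp (Complex.I * (mink (onShell m p) a : ℝ))) a]
  congr 1 with x
  rw [SchwartzMap.compSubConstCLM_apply, mul_assoc, ← Complex.exp_add, sub_eq_add_neg x a,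
    mink_add_right, mink_neg_right]
  congr 2
  push_cast
  ring

/-- No single bump is claimed to have a nowhere vanishing transform. For each `p`, a bump
concentrated where `e^{ip·x}` is nearly constant has non-zero transform at `p`, so a sequence of
shrinking bumps suffices. -/
theorem exists_bump_plusFun_ne_zero (m : ℝ) (x₀ : Spacetime n) {R : ℝ} (hR : 0 < R) :
    ∃ f : ℕ → 𝓢(Spacetime n, ℂ), (∀ j x, f j x ≠ 0 → x ∈ Metric.closedBall x₀ R) ∧
      ∀ p, ∃ j, plusFun m (f j) p ≠ 0 := by
  let b : ℕ → ContDiffBump x₀ := fun j =>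
    ⟨R / (j + 1) / 2, R / (j + 1), by positivity, half_lt_self (by positivity)⟩
  have hs : ∀ j, HasCompactSupport fun x => ((b j x : ℝ) : ℂ) := fun j =>
    (b j).hasCompactSupport.comp_left (g := fun r : ℝ => (r : ℂ)) (by simp)
  refine ⟨fun j => (hs j).toSchwartzMap (Complex.ofRealCLM.contDiff.comp (b j).contDiff),
    fun j x hx => ?_, fun p => ?_⟩
  · have h1 : x ∈ Function.support (b j) := fun h => hx (by
      change ((b j x : ℝ) : ℂ) = 0
      rw [h, Complex.ofReal_zero])
    rw [(b j).support_eq] at h1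
    refine Metric.closedBall_subset_closedBall ?_ (Metric.ball_subset_closedBall h1)
    exact div_le_self hR.le (by linarith [(Nat.cast_nonneg j : (0 : ℝ) ≤ j)])
  · set e : Spacetime n → ℂ := fun x => Complex.exp (Complex.I * (mink (onShell m p) x : ℝ)) with he
    have hec : Continuous e := by
      have : Continuous fun x : Spacetime n => mink (onShell m p) x := by
        simp only [mink_eq_inner]; fun_prop
      fun_prop
    have hen : ∀ x, ‖e x‖ = 1 := fun x => by
      rw [he]; simp only; rw [mul_comm, Complex.norm_exp_ofReal_mul_I]
    obtain ⟨δ, hδ, hball⟩ := Metric.continuousAt_iff.mp (hec.continuousAt (x := x₀)) (1 / 2)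
      (by norm_num)
    obtain ⟨j, hj⟩ := exists_nat_gt (R / δ)
    refine ⟨j, fun h0 => ?_⟩
    have h0' : ∫ x, ((b j x : ℝ) : ℂ) * e x = 0 := h0
    have hbi : Integrable (b j) := (b j).integrable
    have hbi' : Integrable fun x => ((b j x : ℝ) : ℂ) := hbi.ofReal
    have hei : Integrable fun x => ((b j x : ℝ) : ℂ) * e x :=
      hbi'.mono (hbi'.1.mul hec.aestronglyMeasurable) (ae_of_all _ fun x => by
        rw [norm_mul, hen, mul_one])
    have hpos : 0 < ∫ x, b j x := (b j).integral_pos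
    -- If the transform vanished, this integral would have modulus `∫ b`, whereas the small
    -- oscillation of `e` on the support bounds it by `½ ∫ b`.
    have h1 : ∫ x, ((b j x : ℝ) : ℂ) * (e x₀ - e x) = (∫ x, b j x : ℝ) * e x₀ := by
      simp only [mul_sub]
      rw [integral_sub (hbi'.mul_const _) hei, h0', sub_zero, integral_mul_const,
        integral_complex_ofReal]
    have h2 : ‖∫ x, ((b j x : ℝ) : ℂ) * (e x₀ - e x)‖ ≤ ∫ x, b j x * (1 / 2) := by
      refine norm_integral_le_of_norm_le (hbi.mul_const _) (ae_of_all _ fun x => ?_)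
      rw [norm_mul, Complex.norm_real, Real.norm_of_nonneg (b j).nonneg]
      by_cases hx : b j x = 0
      · rw [hx, zero_mul, zero_mul]
      · refine mul_le_mul_of_nonneg_left ?_ (b j).nonneg
        have h3 : x ∈ Metric.ball x₀ (R / (j + 1)) := by
          rw [← (b j).support_eq]; exact hx
        rw [norm_sub_rev, ← dist_eq_norm]
        refine (hball (lt_of_lt_of_le h3 ?_)).le
        rw [div_le_iff₀ (by positivity)]
        rw [div_lt_iff₀ hδ] at hj
        nlinarith
    rw [h1, norm_mul, hen, mul_one, Complex.norm_real, Real.norm_of_nonneg hpos.le,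
      integral_mul_const] at h2
    linarith

variable [hm : Fact (0 < m)]

theorem inner_plusVec (h : OneParticle n m) (f : 𝓢(Spacetime n, ℂ)) :
    inner ℂ h (plusVec n m f) = ∫ p, starRingEnd ℂ (h p) * plusFun m f p ∂shellMeasure n m := by
  rw [L2.inner_def]
  refine integral_congr_ae ?_
  filter_upwards [MemLp.coeFn_toLp (show MemLp (plusFun m f) 2 (shellMeasure n m) from by
    simp only [funext (plusFun_eq m f)]
    exact memLp_onShell hm.out _ (neg_ne_zero.mpr (inv_ne_zero (by positivity))))] with p hp
  change inner ℂ (h p) (plusVec n m f p) = _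
  rw [plusVec, hp, RCLike.inner_apply, mul_comm]

theorem integrable_conj_mul_plusFun (h : OneParticle n m) (f : 𝓢(Spacetime n, ℂ)) :
    Integrable (fun p => starRingEnd ℂ (h p) * plusFun m f p) (shellMeasure n m) := by
  have h1 := L2.integrable_inner (𝕜 := ℂ) h (plusVec n m f)
  refine h1.congr ?_
  filter_upwards [MemLp.coeFn_toLp (show MemLp (plusFun m f) 2 (shellMeasure n m) from by
    simp only [funext (plusFun_eq m f)]
    exact memLp_onShell hm.out _ (neg_ne_zero.mpr (inv_ne_zero (by positivity))))] with p hp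
  rw [plusVec, hp, RCLike.inner_apply, mul_comm]

/-- The one-particle vectors `f⁺` with `f` supported in a fixed non-empty open set are total. -/
theorem topologicalClosure_span_plusVec {O : Set (Spacetime n)} (hO : IsOpen O)
    (hne : O.Nonempty) :
    (Submodule.span ℂ {g : OneParticle n m |
      ∃ f : 𝓢(Spacetime n, ℂ), tsupport f ⊆ O ∧ plusVec n m f = g}).topologicalClosure = ⊤ := by
  rw [Submodule.topologicalClosure_eq_top_iff, Submodule.eq_bot_iff]
  intro h hh
  replace hh : ∀ f : 𝓢(Spacetime n, ℂ), tsupport f ⊆ O → inner ℂ h (plusVec n m f) = 0 :=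
    fun f hf => by
      refine Submodule.inner_left_of_mem_orthogonal (Submodule.subset_span ?_) hh
      exact ⟨f, hf, rfl⟩
  obtain ⟨x₀, hx₀⟩ := hne
  obtain ⟨R, hR, hRO⟩ := Metric.isOpen_iff.mp hO x₀ hx₀
  -- Half of the radius is used for the bumps; the other half leaves room for translations with
  -- `|t|, ‖v‖ < R/4`.
  obtain ⟨f, hfs, hfn⟩ := exists_bump_plusFun_ne_zero m x₀ (half_pos hR)
  have hz : ∀ j, ∀ᵐ p ∂shellMeasure n m, starRingEnd ℂ (h p) * plusFun m (f j) p = 0 := fun j => by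
    refine ae_eq_zero_of_integral_eq_zero (integrable_conj_mul_plusFun h (f j))
      (r := R / 4) (by positivity) fun t v ht hv => ?_
    set a := spacetimePoint t v with ha
    have hna : ‖a‖ < R / 2 := (norm_spacetimePoint_le t v).trans_lt (by linarith)
    have hsupp : tsupport (SchwartzMap.compSubConstCLM ℝ a (f j)) ⊆ O := by
      have h1 : tsupport (SchwartzMap.compSubConstCLM ℝ a (f j))
          ⊆ Metric.closedBall x₀ (R / 2 + ‖a‖) := by
        refine closure_minimal (fun x hx => ?_) Metric.isClosed_closedBall
        have h2 := hfs j (x - a) hx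
        rw [mem_closedBall_iff_norm] at h2 ⊢
        calc ‖x - x₀‖ = ‖(x - a - x₀) + a‖ := by congr 1; abel
          _ ≤ ‖x - a - x₀‖ + ‖a‖ := norm_add_le _ _
          _ ≤ _ := by gcongr
      exact h1.trans ((Metric.closedBall_subset_ball (by linarith)).trans hRO)
    have h3 := hh _ hsupp
    rw [inner_plusVec] at h3
    rw [← h3]
    congr 1 with p
    rw [plusFun_compSubConst, ha, mink_onShell_spacetimePoint, mul_assoc]
  refine (Lp.eq_zero_iff_ae_eq_zero).mpr ?_
  filter_upwards [ae_all_iff.mpr hz] with p hp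
  obtain ⟨j, hj⟩ := hfn p
  have := (mul_eq_zero.mp (hp j)).resolve_right hj
  rwa [map_eq_zero] at this

end OneParticleDensity

end WarpedField
end

noncomputable section
namespace WarpedField

/-! ### The Reeh–Schlieder property -/

section ReehSchlieder

variable {n : ℕ} {m : ℝ} {θ : Matrix (Fin (n + 1)) (Fin (n + 1)) ℝ}
  (V : OneParticle n m ≃ₗᵢ[ℂ] OneParticle n m)

/-- The map `g ↦ a*_θ(g) Ψ`. -/
def dcreateCLM (θ : Matrix (Fin (n + 1)) (Fin (n + 1)) ℝ) {k : ℕ} (Ψ : Sector n m k) :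
    OneParticle n m →L[ℂ] Sector n m (k + 1) :=
  LinearMap.mkContinuous
    { toFun := fun g => dcreate θ V g k Ψ
      map_add' := fun g h => by rw [dcreate_add, add_apply]
      map_smul' := fun c g => by rw [dcreate_smul, smul_apply, RingHom.id_apply] }
    ((k + 1) * ‖Ψ‖) fun g => by
      refine (ContinuousLinearMap.le_opNorm (dcreate θ V g k) Ψ).trans ?_
      rw [mul_comm, mul_comm ((k + 1 : ℝ)), mul_assoc, mul_comm ((k + 1 : ℝ))]
      exact mul_le_mul_of_nonneg_left (norm_dcreate_le V g k) (norm_nonneg Ψ)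

/-- The vectors `a*_θ(g) Ψ` are total in the `(k + 1)`-particle space. -/
theorem eq_top_of_dcreate_mem {k : ℕ} {W : Submodule ℂ (Sector n m (k + 1))}
    (hW : IsClosed (W : Set (Sector n m (k + 1)))) (h : ∀ g Ψ, dcreate θ V g k Ψ ∈ W) :
    W = ⊤ := by
  have : CompleteSpace W := hW.completeSpace_coe
  rw [← Submodule.orthogonal_eq_bot_iff, Submodule.eq_bot_iff]
  intro Φ hΦ
  have h0 : gammaSector V (k + 1) Φ = 0 := by
    refine eq_zero_of_inner_symProj_mulOp_prependOp (isMultiplier_twist (m := m) (θ := θ) k).1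
      norm_twist twist_shiftPerm fun g Ψ => ?_
    -- These arguments undo the conjugation with `Γ(V)`, so that the totality statement with the
    -- bare twist applies.
    have h1 := hΦ _ (h (V.symm g) (gammaSector V.symm k Ψ))
    rw [dcreate, conjGamma_apply, inner_gammaSector_left, LinearIsometryEquiv.symm_symm,
      LinearIsometryEquiv.apply_symm_apply, gammaSector_gammaSector_symm, createMul_apply,
      inner_sector_smul_left, mul_eq_zero] at h1
    refine h1.resolve_left ?_
    rw [Complex.conj_ofReal, Complex.ofReal_eq_zero]
    exact (Real.sqrt_pos.mpr (by positivity)).ne'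
  rw [← gammaSector_symm_gammaSector V Φ, h0, map_zero]

/-- The vectors with less than `N` particles. -/
def particleLT (n : ℕ) (m : ℝ) (N : ℕ) : Submodule ℂ (Fock n m) :=
  ⨅ k ≥ N, LinearMap.ker (componentCLM n m k).toLinearMap

theorem mem_particleLT {N : ℕ} {Ψ : Fock n m} :
    Ψ ∈ particleLT n m N ↔ ∀ k, N ≤ k → Ψ k = 0 := by
  simp only [particleLT, Submodule.mem_iInf]
  rfl

variable [Fact (0 < m)]

theorem eq_top_of_dcreate_plusVec_mem {O : Set (Spacetime n)} (hO : IsOpen O) (hne : O.Nonempty)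
    {k : ℕ} {W : Submodule ℂ (Sector n m (k + 1))}
    (hW : IsClosed (W : Set (Sector n m (k + 1))))
    (h : ∀ f : 𝓢(Spacetime n, ℂ), tsupport f ⊆ O → ∀ Ψ, dcreate θ V (plusVec n m f) k Ψ ∈ W) :
    W = ⊤ := by
  refine eq_top_of_dcreate_mem V (θ := θ) hW fun g Ψ => ?_
  have h1 := Submodule.topologicalClosure_minimal
    (Submodule.span ℂ {g : OneParticle n m |
      ∃ f : 𝓢(Spacetime n, ℂ), tsupport f ⊆ O ∧ plusVec n m f = g})
    (t := W.comap (dcreateCLM V θ Ψ).toLinearMap)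
    (Submodule.span_le.mpr ?_) (hW.preimage (dcreateCLM V θ Ψ).continuous)
  · rw [topologicalClosure_span_plusVec hO hne] at h1
    exact h1 (Submodule.mem_top (x := g))
  · rintro _ ⟨f, hf, rfl⟩
    exact h f hf Ψ

variable (θ) in
/-- The span of the vectors `φ_{θ,X}(f₁) ⋯ φ_{θ,X}(f_k) Ω` with test functions supported in `O`. -/
def localSpan (O : Set (Spacetime n)) : Submodule ℂ (Fock n m) :=
  Submodule.span ℂ {Ψ | IsLocalMonomial θ V O Ψ}

theorem exists_isWarped_of_mem_localSpan (hθ : IsLorentzSkew θ) {O : Set (Spacetime n)}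
    {f : 𝓢(Spacetime n, ℂ)} (hf : tsupport f ⊆ O) {Ψ : Fock n m} (hΨ : Ψ ∈ localSpan θ V O) :
    ∃ Φ ∈ localSpan θ V O, IsWarped θ V f Ψ Φ := by
  induction hΨ using Submodule.span_induction with
  | mem Ψ h =>
    have hD : Ψ ∈ finiteParticle n m := by
      induction h with
      | vacuum => exact inSector_mem_finiteParticle _
      | apply f hf Ψ _ ih => exact deformedField_mem_finiteParticle V hθ f Ψ ih
    have hd := finiteParticle_le_domain V hθ f hD
    exact ⟨_, Submodule.subset_span (IsLocalMonomial.apply f hf ⟨Ψ, hd⟩ h),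
      isWarped_deformedField V ⟨Ψ, hd⟩⟩
  | zero => exact ⟨0, Submodule.zero_mem _, IsWarped.zero θ V f⟩
  | add Ψ Φ _ _ h h' =>
    obtain ⟨Ψ', hΨ', hw⟩ := h
    obtain ⟨Φ', hΦ', hw'⟩ := h'
    exact ⟨_, Submodule.add_mem _ hΨ' hΦ', hw.add hw'⟩
  | smul c Ψ _ h =>
    obtain ⟨Ψ', hΨ', hw⟩ := h
    exact ⟨_, Submodule.smul_mem _ c hΨ', hw.smul c⟩

variable (θ) in
/-- The deformed field on vectors with less than `N` particles, as a bounded operator. -/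
def fieldBelow (f : 𝓢(Spacetime n, ℂ)) (N : ℕ) : Fock n m →L[ℂ] Fock n m :=
  ∑ k ∈ Finset.range N, (dfield θ V f k).comp (componentCLM n m k)

theorem fieldBelow_apply (f : 𝓢(Spacetime n, ℂ)) (N : ℕ) (Ψ : Fock n m) :
    fieldBelow θ V f N Ψ = ∑ k ∈ Finset.range N, dfield θ V f k (Ψ k) := by
  rw [fieldBelow, sum_apply]
  rfl

theorem fieldBelow_inSector (f : 𝓢(Spacetime n, ℂ)) (k : ℕ) (Ψ : Sector n m k) :
    fieldBelow θ V f (k + 1) (inSector k Ψ) = dfield θ V f k Ψ := by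
  rw [fieldBelow_apply, Finset.sum_eq_single k, inSector_apply_self]
  · intro j _ hj
    rw [inSector_apply_ne Ψ hj, map_zero]
  · intro h
    simp at h

theorem dfield_mem_particleLT (f : 𝓢(Spacetime n, ℂ)) {k N : ℕ} (hk : k < N) (Ψ : Sector n m k) :
    dfield θ V f k Ψ ∈ particleLT n m (N + 1) := by
  have h : ∀ j (Φ : Sector n m j), j < N + 1 → inSector j Φ ∈ particleLT n m (N + 1) :=
    fun j Φ hj => mem_particleLT.mpr fun i hi => inSector_apply_ne Φ (by omega)
  cases k with
  | zero => exact h _ _ (by omega)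
  | succ k => exact Submodule.add_mem _ (h _ _ (by omega)) (h _ _ (by omega))

/-- On vectors with less than `N` particles the unbounded field agrees with the bounded operator
`fieldBelow`. Keeping track of the particle number is what allows the field to be applied to limits.
-/
theorem fieldBelow_mem (hθ : IsLorentzSkew θ) {O : Set (Spacetime n)} {f : 𝓢(Spacetime n, ℂ)}
    (hf : tsupport f ⊆ O) {N : ℕ} {Ψ : Fock n m} (hΨ : Ψ ∈ localSpan θ V O ⊓ particleLT n m N) :
    fieldBelow θ V f N Ψ ∈ localSpan θ V O ⊓ particleLT n m (N + 1) := by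
  refine ⟨?_, ?_⟩
  · obtain ⟨Φ, hΦ, hw⟩ := exists_isWarped_of_mem_localSpan V hθ hf hΨ.1
    have h1 := isWarped_of_eq_zero V hθ f (mem_particleLT.mp hΨ.2)
    rwa [fieldBelow_apply, (h1.hasOscLimit V).unique (hw.hasOscLimit V)]
  · rw [fieldBelow_apply]
    exact Submodule.sum_mem _ fun k hk =>
      dfield_mem_particleLT V f (Finset.mem_range.mp hk) _

/-- Induction on `N`: applying the field to the highest sector already reached gives a creation part
one sector higher and an annihilation part in a sector already contained in the closure. The former
alone thus lies in the closure, and such vectors are total. -/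
theorem inSector_mem_topologicalClosure (hθ : IsLorentzSkew θ) {O : Set (Spacetime n)}
    (hO : IsOpen O) (hne : O.Nonempty) (N : ℕ) :
    ∀ j < N, ∀ Ψ : Sector n m j,
      inSector j Ψ ∈ (localSpan θ V O ⊓ particleLT n m N).topologicalClosure := by
  induction N with
  | zero => exact fun j hj => absurd hj (Nat.not_lt_zero j)
  | succ N ih =>
    have hmono : (localSpan θ V O ⊓ particleLT n m N).topologicalClosure
        ≤ (localSpan θ V O ⊓ particleLT n m (N + 1)).topologicalClosure :=
      Submodule.topologicalClosure_mono (inf_le_inf_left _ fun Ψ hΨ =>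
        mem_particleLT.mpr fun k hk => mem_particleLT.mp hΨ k (by omega))
    intro j hj Ψ
    rcases Nat.lt_succ_iff_lt_or_eq.mp hj with hj | rfl
    · exact hmono (ih j hj Ψ)
    cases j with
    | zero =>
      refine Submodule.le_topologicalClosure _ ⟨?_, ?_⟩
      · obtain ⟨c, hc⟩ := eq_smul_vacuumSector Ψ
        rw [hc]
        have : inSector 0 (c • vacuumSector n m) = c • vacuum n m :=
          (inSectorCLM n m 0).map_smul c _
        rw [this]
        exact Submodule.smul_mem _ c (Submodule.subset_span IsLocalMonomial.vacuum)
      · exact mem_particleLT.mpr fun i hi => inSector_apply_ne Ψ (by omega)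
    | succ k =>
      have hcl := Submodule.isClosed_topologicalClosure
        (localSpan θ V O ⊓ particleLT n m (k + 1 + 1))
      have htop := eq_top_of_dcreate_plusVec_mem V (θ := θ) hO hne
        (W := (localSpan θ V O ⊓ particleLT n m (k + 1 + 1)).topologicalClosure.comap
          (inSectorCLM n m (k + 1)).toLinearMap)
        (hcl.preimage (inSectorCLM n m (k + 1)).continuous) fun f hf Φ => ?_
      · have h1 : Ψ ∈ (⊤ : Submodule ℂ (Sector n m (k + 1))) := Submodule.mem_top
        rw [← htop] at h1
        exact h1
      · have h1 : dfield θ V f k Φ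
            ∈ (localSpan θ V O ⊓ particleLT n m (k + 1 + 1)).topologicalClosure := by
          rw [← fieldBelow_inSector]
          exact map_mem_closure (fieldBelow θ V f (k + 1)).continuous (ih k (by omega) Φ)
            fun _ h => fieldBelow_mem V hθ hf h
        change inSector (k + 1) (dcreate θ V (plusVec n m f) k Φ)
          ∈ (localSpan θ V O ⊓ particleLT n m (k + 1 + 1)).topologicalClosure
        cases k with
        | zero => exact h1
        | succ k =>
          rw [dfield, fieldOp_succ] at h1
          -- The annihilation part has two particles fewer than the creation part and is removed by
          -- the induction hypothesis.
          exact (Submodule.add_mem_iff_left _ (hmono (ih k (by omega) _))).mp h1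

theorem dense_localSpan (hθ : IsLorentzSkew θ) {O : Set (Spacetime n)} (hO : IsOpen O)
    (hne : O.Nonempty) : Dense (localSpan θ V O : Set (Fock n m)) := by
  rw [Submodule.dense_iff_topologicalClosure_eq_top]
  refine eq_top_of_inSector_mem (Submodule.isClosed_topologicalClosure _) fun k Ψ => ?_
  exact Submodule.topologicalClosure_mono inf_le_left
    (inSector_mem_topologicalClosure V hθ hO hne (k + 1) k (Nat.lt_succ_self k) Ψ)

end ReehSchlieder

end WarpedField
end

theorem mainTheorem3 (n : ℕ) (hn : 1 ≤ n) (m : ℝ) [Fact (0 < m)]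
    (θ : Matrix (Fin (n + 1)) (Fin (n + 1)) ℝ) (hθ : WarpedField.IsLorentzSkew θ)
    (V : WarpedField.OneParticle n m ≃ₗᵢ[ℂ] WarpedField.OneParticle n m) :
    -- a) domain, invariance, and action on the vacuum
    (Dense (WarpedField.finiteParticle n m : Set (WarpedField.Fock n m)) ∧
      ∀ f : 𝓢(WarpedField.Spacetime n, ℂ),
        WarpedField.finiteParticle n m ≤ (WarpedField.deformedField θ V f).domain ∧
        (∀ Ψ : (WarpedField.deformedField θ V f).domain,
          (Ψ : WarpedField.Fock n m) ∈ WarpedField.finiteParticle n m →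
            WarpedField.deformedField θ V f Ψ ∈ WarpedField.finiteParticle n m) ∧
        ∃ (h : WarpedField.vacuum n m ∈ (WarpedField.deformedField θ V f).domain)
          (h₀ : WarpedField.vacuum n m ∈ (WarpedField.freeField f).domain),
          WarpedField.deformedField θ V f ⟨WarpedField.vacuum n m, h⟩
            = WarpedField.freeField f ⟨WarpedField.vacuum n m, h₀⟩) ∧
    -- b) temperedness
    (∀ Ψ ∈ WarpedField.finiteParticle n m,
      ∃ T : 𝓢(WarpedField.Spacetime n, ℂ) →L[ℂ] WarpedField.Fock n m,
        ∀ f : 𝓢(WarpedField.Spacetime n, ℂ),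
          ∃ h : Ψ ∈ (WarpedField.deformedField θ V f).domain,
            WarpedField.deformedField θ V f ⟨Ψ, h⟩ = T f) ∧
    -- c) adjoint and essential self-adjointness
    (∀ f : 𝓢(WarpedField.Spacetime n, ℂ),
      (∀ Ψ ∈ WarpedField.finiteParticle n m,
        ∃ (h : Ψ ∈ (LinearPMap.adjoint (WarpedField.deformedField θ V f)).domain)
          (h' : Ψ ∈ (WarpedField.deformedField θ V (WarpedField.conjTest f)).domain),
          LinearPMap.adjoint (WarpedField.deformedField θ V f) ⟨Ψ, h⟩
            = WarpedField.deformedField θ V (WarpedField.conjTest f) ⟨Ψ, h'⟩) ∧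
      ((∀ x, (f x).im = 0) →
        WarpedField.IsEssentiallySelfAdjoint
          ((WarpedField.deformedField θ V f).domRestrict (WarpedField.finiteParticle n m)))) ∧
    -- d) the Reeh-Schlieder property
    (∀ O : Set (WarpedField.Spacetime n), IsOpen O → O.Nonempty →
      Dense (Submodule.span ℂ {Ψ : WarpedField.Fock n m |
        WarpedField.IsLocalMonomial θ V O Ψ} : Set (WarpedField.Fock n m))) := by
  refine ⟨⟨WarpedField.dense_finiteParticle, fun f =>
    ⟨WarpedField.finiteParticle_le_domain V hθ f,
      WarpedField.deformedField_mem_finiteParticle V hθ f,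
      WarpedField.deformedField_vacuum V hθ f⟩⟩,
    fun Ψ hΨ => WarpedField.exists_deformedField_clm V hθ hΨ,
    fun f => ⟨fun Ψ hΨ => WarpedField.adjoint_deformedField V hθ f hΨ,
      WarpedField.isEssentiallySelfAdjoint_deformedField V hθ⟩,
    fun O hO hne => WarpedField.dense_localSpan V hθ hO hne⟩
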